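/- **Notation.** Let $Q$ be the quiver with vertices $1,2$ and arrows $a\colon 1\to 2$, $b\colon 2\to 1$, with paths composed from right to left, so that $a=e(2)\,a\,e(1)$ and $b=e(1)\,b\,e(2)$. Let $B=\mathbb{C}Q/(ba)$, graded by path length; it has basis $e(1),e(2),a,b,c$ with $c=ab$. Put $P(i)=e(i)B$ and $C=\mathrm{End}_B(P(2))\cong\mathbb{C}[x]/(x^2)$ with $\deg x=2$, where $x$ acts on $P(2)$ as left multiplication by $c$. Modules are graded right modules, and $(M\langle r\rangle)_j=M_{j-r}$. A complex $M$ has terms $M^i=\bigoplus_j M^i_j$. * For $R=B,C$ let $D^{<}(\mathrm{gmod}\text{-}R)$ be the localization at quasi-isomorphisms of the category of complexes of finite dimensional graded right $R$-modules with $M^i_j=0$ if $i\gg0$ or $i+j\ll0$. * Let $D^{>}(B)$ be the localization at quasi-isomorphisms of the category of complexes of graded right $B$-modules with $M^i_j=0$ if $i\ll0$ or $i+j\gg0$. * Let $\widetilde\pi\colon M\mapsto\mathrm{Hom}_B(P(2),M)\langle-1\rangle$ (an exact functor from graded $B$-modules to graded $C$-modules) and $\widetilde\iota\colon N\mapsto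 N\otimes_C P(2)\langle1\rangle$ (a right exact functor in the other direction), and let $\mathbb{P}=\mathcal{L}\widetilde\iota\circ\widetilde\pi\colon D^{<}(\mathrm{gmod}\text{-}B)\to D^{<}(\mathrm{gmod}\text{-}B)$, where $\mathcal{L}\widetilde\iota\colon D^{<}(\mathrm{gmod}\text{-}C)\to D^{<}(\mathrm{gmod}\text{-}B)$ is the left derived functor. * For a complex $M$ of graded right $B$-modules let $\mathbb{D}M$ be the complex of graded right $B$-modules with $$(\mathbb{D}M)^p_q=\bigoplus_{p=r+s,\;q=l-s}M^r_s\otimes_{B_0}B_l,\qquad \tilde d(m\otimes g)=dm\otimes g+(-1)^{r+s}(ma\otimes ag+mb\otimes bg)\quad(m\in M^r_s),$$ where the left action of $B_0=\mathbb{C}e(1)\oplus\mathbb{C}e(2)$ on $B$ is twisted by $e(1)\leftrightarrow e(2)$, so that $M^r_se(1)$ is tensored with $e(2)B_l$ and $M^r_se(2)$ with $e(1)B_l$. * Let $\theta$ be the graded $(B,B)$-bimodule $Be(2)\otimes_{\mathbb{C}}e(2)B\langle-1\rangle$, and let $\mathbb{CK}$ be the complex of bimodules $$0\to B\xrightarrow{\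 \alpha\ }\theta\langle-1\rangle\xrightarrow{\ \beta\ }\theta\langle-3\rangle\xrightarrow{\ \gamma\ }\theta\langle-5\rangle\xrightarrow{\ \beta\ }\theta\langle-7\rangle\xrightarrow{\ \gamma\ }\cdots$$ with $B$ in homological degree $0$, where $\alpha(e(2))=c\otimes e(2)+e(2)\otimes c$, $\alpha(e(1))=b\otimes a$, $\beta(e(2)\otimes e(2))=c\otimes e(2)-e(2)\otimes c$ and $\gamma(e(2)\otimes e(2))=c\otimes e(2)+e(2)\otimes c$. For a complex $X$ of graded right $B$-modules let $\mathbb{CK}(X)$ be the total complex of the bicomplex $X\otimes_B\mathbb{CK}$. **Theorem.** The left derived functor $\mathcal{L}\widetilde\iota$ exists, and the constructions $M\mapsto\mathbb{D}M$ and $X\mapsto\mathbb{CK}(X)$ preserve quasi-isomorphisms, so that they induce functors $\mathbb{D}\colon D^{<}(\mathrm{gmod}\text{-}B)\to D^{>}(B)$ and $\mathbb{CK}\colon D^{>}(B)\to D^{>}(B)$. There is an isomorphism of functors $$\mathbb{D}\circ\mathbb{P}\;\cong\;\mathbb{CK}\circ\mathbb{D}\colon\; D^{<}(\mathrm{gmod}\text{-}B)\to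 D^{>}(B).$$ -/

import Mathlib

open CategoryTheory
open scoped DirectSum

namespace JW

/-! ### The graded algebra `B = ℂQ / (ba)` -/

/-- The two vertices of the quiver `Q`. -/
inductive Vertex
  | one
  | two
  deriving DecidableEq

/-- The other vertex. -/
def Vertex.other : Vertex → Vertex
  | .one => .two
  | .two => .one

/-- The paths of `Q` that do not contain `ba`, where `a : 1 → 2` and `b : 2 → 1` and paths are
composed from right to left: `e(1), e(2), a, b` and `c = ab`. They are a basis of
`B = ℂQ / (ba)`. -/
inductive Path
  | e1
  | e2
  | a
  | b
  | c
  deriving DecidableEq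

namespace Path

instance : Fintype Path := ⟨{e1, e2, a, b, c}, fun g => by cases g <;> decide⟩

/-- The end point `v` of a path `g`, so that `g = e(v) g`. -/
def left : Path → Vertex
  | e1 => .one
  | e2 => .two
  | a => .two
  | b => .one
  | c => .two

/-- The starting point `v` of a path `g`, so that `g = g e(v)`. -/
def right : Path → Vertex
  | e1 => .one
  | e2 => .two
  | a => .one
  | b => .two
  | c => .two

/-- The length of a path, which is its degree in `B`. -/
def len : Path → ℤ
  | e1 => 0
  | e2 => 0
  | a => 1
  | b => 1
  | c => 2

/-- The multiplication table of `B`; `none` stands for `0`. -/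
def mul : Path → Path → Option Path
  | e1, e1 => some e1
  | e1, b => some b
  | e2, e2 => some e2
  | e2, a => some a
  | e2, c => some c
  | a, e1 => some a
  | a, b => some c
  | b, e2 => some b
  | c, e2 => some c
  | _, _ => none

/-- The trivial path `e(v)`. -/
def idem : Vertex → Path
  | .one => e1
  | .two => e2

/-- The unique arrow `α` with `α = e(v) α`: `b` for `v = 1` and `a` for `v = 2`. -/
def arr : Vertex → Path
  | .one => b
  | .two => a

theorem left_mul {g h k : Path} (H : k ∈ mul g h) : k.left = g.left := by
  cases g <;> cases h <;> simp [mul] at H <;> subst H <;> rfl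

theorem right_mul {g h k : Path} (H : k ∈ mul g h) : k.right = h.right := by
  cases g <;> cases h <;> simp [mul] at H <;> subst H <;> rfl

theorem len_mul {g h k : Path} (H : k ∈ mul g h) : k.len = g.len + h.len := by
  cases g <;> cases h <;> simp [mul] at H <;> subst H <;> rfl

theorem mul_assoc' (g h k : Path) :
    (mul g h).bind (fun x => mul x k) = (mul h k).bind (fun x => mul g x) := by
  cases g <;> cases h <;> cases k <;> rfl

theorem idem_mul (g : Path) : mul (idem g.left) g = some g := by
  cases g <;> rfl

theorem right_a : a.right = .one := rfl
theorem right_b : b.right = .two := rfl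
theorem add_len_a {i j : ℤ} (h : i + 1 = j) : i + a.len = j := h
theorem add_len_b {i j : ℤ} (h : i + 1 = j) : i + b.len = j := h
@[simp] theorem left_idem (v : Vertex) : (idem v).left = v := by cases v <;> rfl
@[simp] theorem right_idem (v : Vertex) : (idem v).right = v := by cases v <;> rfl
@[simp] theorem len_idem (v : Vertex) : (idem v).len = 0 := by cases v <;> rfl
@[simp] theorem left_arr (v : Vertex) : (arr v).left = v := by cases v <;> rfl
@[simp] theorem right_arr (v : Vertex) : (arr v).right = v.other := by cases v <;> rfl
@[simp] theorem len_arr (v : Vertex) : (arr v).len = 1 := by cases v <;> rfl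

end Path

/-! ### Graded right modules over `B` -/

/-- A graded right `B`-module `M = ⨁_j M_j`, given by the vector spaces `X v j = M_j e(v)` and by
right multiplication with the arrows `a = e(2) a e(1)` and `b = e(1) b e(2)`, subject to
`(m b) a = 0`. -/
structure GrB where
  X : Vertex → ℤ → ModuleCat.{0} ℂ
  a : ∀ i j : ℤ, i + 1 = j → (X .two i →ₗ[ℂ] X .one j)
  b : ∀ i j : ℤ, i + 1 = j → (X .one i →ₗ[ℂ] X .two j)
  ba : ∀ (i j k : ℤ) (h : i + 1 = j) (h' : j + 1 = k) (m : X .one i), a j k h' (b i j h m) = 0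

namespace GrB

/-- Right multiplication by the unique arrow `α` with `α = e(v) α`. -/
def arr (M : GrB) : ∀ (v : Vertex) (i j : ℤ), i + 1 = j → (M.X v i →ₗ[ℂ] M.X v.other j)
  | .one => M.b
  | .two => M.a

/-- Right multiplication by `c = ab`. -/
def c (M : GrB) (i j : ℤ) (h : i + 2 = j) : M.X .two i →ₗ[ℂ] M.X .two j :=
  (M.b (i + 1) j (by omega)).comp (M.a i (i + 1) rfl)

theorem c_c (M : GrB) (i j k : ℤ) (h : i + 2 = j) (h' : j + 2 = k) (m : M.X .two i) :
    M.c j k h' (M.c i j h m) = 0 := by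
  have := M.ba (i + 1) j (j + 1) (by omega) rfl (M.a _ _ rfl m)
  simp [c, this]

/-- Homomorphisms of graded right `B`-modules (of degree `0`). -/
@[ext]
structure Hom (M N : GrB) where
  f : ∀ v i, M.X v i →ₗ[ℂ] N.X v i
  comm_a : ∀ (i j : ℤ) (h : i + 1 = j) (m : M.X .two i),
    f .one j (M.a i j h m) = N.a i j h (f .two i m)
  comm_b : ∀ (i j : ℤ) (h : i + 1 = j) (m : M.X .one i),
    f .two j (M.b i j h m) = N.b i j h (f .one i m)

instance : Category GrB where
  Hom := Hom
  id M := ⟨fun _ _ => LinearMap.id, fun _ _ _ _ => rfl, fun _ _ _ _ => rfl⟩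
  comp φ ψ := ⟨fun v i => (ψ.f v i).comp (φ.f v i),
    fun i j h m => by simp [φ.comm_a, ψ.comm_a],
    fun i j h m => by simp [φ.comm_b, ψ.comm_b]⟩

@[ext]
theorem hom_ext {M N : GrB} {φ ψ : M ⟶ N} (h : ∀ v i m, φ.f v i m = ψ.f v i m) : φ = ψ :=
  Hom.ext (funext fun v => funext fun i => LinearMap.ext (h v i))

@[simp] theorem id_f (M : GrB) (v i) : Hom.f (𝟙 M) v i = LinearMap.id := rfl

@[simp] theorem comp_f {M N K : GrB} (φ : M ⟶ N) (ψ : N ⟶ K) (v i) :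
    (φ ≫ ψ).f v i = (ψ.f v i).comp (φ.f v i) := rfl

variable {M N : GrB}

instance : Zero (M ⟶ N) := ⟨⟨fun _ _ => 0, by simp, by simp⟩⟩
instance : Add (M ⟶ N) := ⟨fun φ ψ => ⟨fun v i => φ.f v i + ψ.f v i,
  by simp [φ.comm_a, ψ.comm_a], by simp [φ.comm_b, ψ.comm_b]⟩⟩
instance : Neg (M ⟶ N) := ⟨fun φ => ⟨fun v i => -φ.f v i,
  by simp [φ.comm_a], by simp [φ.comm_b]⟩⟩
instance : Sub (M ⟶ N) := ⟨fun φ ψ => ⟨fun v i => φ.f v i - ψ.f v i,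
  by simp [φ.comm_a, ψ.comm_a], by simp [φ.comm_b, ψ.comm_b]⟩⟩
instance : SMul ℕ (M ⟶ N) := ⟨fun n φ => ⟨fun v i => n • φ.f v i,
  by simp [φ.comm_a], by simp [φ.comm_b]⟩⟩
instance : SMul ℤ (M ⟶ N) := ⟨fun n φ => ⟨fun v i => n • φ.f v i,
  by simp [φ.comm_a], by simp [φ.comm_b]⟩⟩

theorem f_injective : Function.Injective (fun φ : M ⟶ N => Hom.f φ) :=
  fun _ _ h => Hom.ext h

instance : AddCommGroup (M ⟶ N) :=
  f_injective.addCommGroup _ rfl (fun _ _ => rfl) (fun _ => rfl) (fun _ _ => rfl)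
    (fun _ _ => rfl) (fun _ _ => rfl)

instance : Preadditive GrB where
  add_comp _ _ _ _ _ _ := hom_ext fun _ _ _ => by
    exact map_add (Hom.f _ _ _) _ _
  comp_add _ _ _ _ _ _ := hom_ext fun _ _ _ => rfl

@[simp] theorem zero_f (v i) : Hom.f (0 : M ⟶ N) v i = 0 := rfl
@[simp] theorem add_f (φ ψ : M ⟶ N) (v i) : (φ + ψ).f v i = φ.f v i + ψ.f v i := rfl
@[simp] theorem neg_f (φ : M ⟶ N) (v i) : (-φ).f v i = -φ.f v i := rfl
@[simp] theorem sub_f (φ ψ : M ⟶ N) (v i) : (φ - ψ).f v i = φ.f v i - ψ.f v i := rfl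
@[simp] theorem zsmul_f (n : ℤ) (φ : M ⟶ N) (v i) : (n • φ).f v i = n • φ.f v i := rfl

theorem comm_arr (φ : M ⟶ N) (v : Vertex) (i j : ℤ) (h : i + 1 = j) (m : M.X v i) :
    φ.f v.other j (M.arr v i j h m) = N.arr v i j h (φ.f v i m) := by
  cases v
  · exact φ.comm_b i j h m
  · exact φ.comm_a i j h m

theorem comm_c (φ : M ⟶ N) (i j : ℤ) (h : i + 2 = j) (m : M.X .two i) :
    φ.f .two j (M.c i j h m) = N.c i j h (φ.f .two i m) := by
  simp [c, φ.comm_a, φ.comm_b]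

/-- The functor `M ↦ M_j e(v)`. -/
def ev (v : Vertex) (j : ℤ) : GrB ⥤ ModuleCat.{0} ℂ where
  obj M := M.X v j
  map φ := ModuleCat.ofHom (φ.f v j)

instance (v : Vertex) (j : ℤ) : (ev v j).Additive where
  map_add := rfl

/-- `M` is finite dimensional over `ℂ`. -/
def IsFinDim (M : GrB) : Prop :=
  (∀ v j, FiniteDimensional ℂ (M.X v j)) ∧
    ∃ n : ℤ, ∀ v j, n < |j| → Subsingleton (M.X v j)

/-- The direct sum of two graded right `B`-modules. -/
def prod (M N : GrB) : GrB where
  X v i := ModuleCat.of ℂ (M.X v i × N.X v i)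
  a i j h := (M.a i j h).prodMap (N.a i j h)
  b i j h := (M.b i j h).prodMap (N.b i j h)
  ba i j k h h' m := Prod.ext (M.ba i j k h h' m.1) (N.ba i j k h h' m.2)

/-- The map `M ⊕ N ⟶ M' ⊕ N'`, `(m, n) ↦ (φ m, χ m + ψ n)`. -/
def prodHom {M N M' N' : GrB} (φ : M ⟶ M') (χ : M ⟶ N') (ψ : N ⟶ N') :
    M.prod N ⟶ M'.prod N' where
  f v i := ((φ.f v i).comp (LinearMap.fst ℂ _ _)).prod
    ((χ.f v i).comp (LinearMap.fst ℂ _ _) + (ψ.f v i).comp (LinearMap.snd ℂ _ _))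
  comm_a i j h m := Prod.ext (φ.comm_a i j h m.1) (by
    change χ.f _ _ (M.a i j h m.1) + ψ.f _ _ (N.a i j h m.2) = N'.a i j h (_ + _)
    rw [χ.comm_a, ψ.comm_a, map_add]; rfl)
  comm_b i j h m := Prod.ext (φ.comm_b i j h m.1) (by
    change χ.f _ _ (M.b i j h m.1) + ψ.f _ _ (N.b i j h m.2) = N'.b i j h (_ + _)
    rw [χ.comm_b, ψ.comm_b, map_add]; rfl)

theorem prodHom_comp {M N M' N' M'' N'' : GrB} (φ : M ⟶ M') (χ : M ⟶ N') (ψ : N ⟶ N')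
    (φ' : M' ⟶ M'') (χ' : M' ⟶ N'') (ψ' : N' ⟶ N'') :
    prodHom φ χ ψ ≫ prodHom φ' χ' ψ' =
      prodHom (φ ≫ φ') (φ ≫ χ' + χ ≫ ψ') (ψ ≫ ψ') := by
  refine hom_ext fun v i m => Prod.ext rfl ?_
  change χ'.f v i (φ.f v i m.1) + ψ'.f v i (χ.f v i m.1 + ψ.f v i m.2) =
    χ'.f v i (φ.f v i m.1) + ψ'.f v i (χ.f v i m.1) + ψ'.f v i (ψ.f v i m.2)
  rw [map_add, add_assoc]

theorem prodHom_zero {M N M' N' : GrB} :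
    prodHom (0 : M ⟶ M') (0 : M ⟶ N') (0 : N ⟶ N') = 0 :=
  hom_ext fun _ _ _ => Prod.ext rfl (add_zero _)

theorem prodHom_id (M N : GrB) : prodHom (𝟙 M) (0 : M ⟶ N) (𝟙 N) = 𝟙 (M.prod N) :=
  hom_ext fun _ _ _ => Prod.ext rfl (zero_add _)

/-- The cokernel of a homomorphism of graded right `B`-modules. -/
def coker (φ : M ⟶ N) : GrB where
  X v i := ModuleCat.of ℂ (N.X v i ⧸ LinearMap.range (φ.f v i))
  a i j h := Submodule.mapQ _ _ (N.a i j h) (by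
    rintro _ ⟨m, rfl⟩; exact ⟨M.a i j h m, φ.comm_a i j h m⟩)
  b i j h := Submodule.mapQ _ _ (N.b i j h) (by
    rintro _ ⟨m, rfl⟩; exact ⟨M.b i j h m, φ.comm_b i j h m⟩)
  ba i j k h h' m := by
    obtain ⟨n, rfl⟩ := Submodule.Quotient.mk_surjective _ m
    exact congrArg (Submodule.Quotient.mk) (N.ba i j k h h' n)

/-- The map between cokernels induced by a commutative square. -/
def cokerMap {M' N' : GrB} {φ : M ⟶ N} {φ' : M' ⟶ N'} (μ : M ⟶ M') (ν : N ⟶ N')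
    (w : φ ≫ ν = μ ≫ φ') : coker φ ⟶ coker φ' where
  f v i := Submodule.mapQ _ _ (ν.f v i) (by
    rintro _ ⟨m, rfl⟩
    exact ⟨μ.f v i m, (congrArg (fun χ : M ⟶ N' => χ.f v i m) w).symm⟩)
  comm_a i j h m := by
    obtain ⟨n, rfl⟩ := Submodule.Quotient.mk_surjective _ m
    exact congrArg (Submodule.Quotient.mk) (ν.comm_a i j h n)
  comm_b i j h m := by
    obtain ⟨n, rfl⟩ := Submodule.Quotient.mk_surjective _ m
    exact congrArg (Submodule.Quotient.mk) (ν.comm_b i j h n)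

end GrB

/-! ### Direct sums of modules `V ⊗ e(v)B⟨d⟩` -/

/-- An index set `J` with, for each `j`, a projective module `e(side j) B ⟨deg j⟩`. -/
structure Shape where
  J : Type
  side : J → Vertex
  deg : J → ℤ

namespace Shape

/-- The indices of the elements `x ⊗ g` which lie in `(⨁_j V_j ⊗ e(side j) B ⟨deg j⟩)_n e(w)`. -/
structure Idx (S : Shape) (w : Vertex) (n : ℤ) where
  j : S.J
  g : Path
  cond : g.left = S.side j ∧ g.right = w ∧ S.deg j + g.len = n

noncomputable instance (S : Shape) (w : Vertex) (n : ℤ) : DecidableEq (S.Idx w n) :=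
  Classical.decEq _

variable (S T U : Shape)
variable (V : S.J → ModuleCat.{0} ℂ) (W : T.J → ModuleCat.{0} ℂ) (Z : U.J → ModuleCat.{0} ℂ)

/-- The degree `n` part of `(⨁_j V_j ⊗ e(side j) B ⟨deg j⟩) e(w)`. -/
abbrev Comp (w : Vertex) (n : ℤ) : Type := ⨁ x : S.Idx w n, V x.j

/-- The map `x ↦ x ⊗ g` from `V_j` to the degree `n` part, with `x ⊗ 0 = 0`. -/
noncomputable def ten (w : Vertex) (n : ℤ) (j : S.J) : (g : Option Path) →
    (∀ k ∈ g, k.left = S.side j ∧ k.right = w ∧ S.deg j + k.len = n) →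
    (V j →ₗ[ℂ] S.Comp V w n)
  | none, _ => 0
  | some k, h => DirectSum.lof ℂ (S.Idx w n) (fun x => V x.j) ⟨j, k, h k rfl⟩

theorem ten_none {w : Vertex} {n : ℤ} {j : S.J} {g : Option Path} (e : g = none) {hg} (x : V j) :
    S.ten V w n j g hg x = 0 := by
  subst e; rfl

theorem ten_congr {w : Vertex} {n : ℤ} {j : S.J} {g g' : Option Path} (e : g = g') {hg hg'}
    (x : V j) : S.ten V w n j g hg x = S.ten V w n j g' hg' x := by
  subst e; rfl

theorem lof_eq_ten {w : Vertex} {n : ℤ} (x : S.Idx w n) (m : V x.j) :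
    DirectSum.lof ℂ (S.Idx w n) (fun x => V x.j) x m =
      S.ten V w n x.j (some x.g) (by rintro _ ⟨⟩; exact x.cond) m := rfl

theorem mul_cond {w : Vertex} {n n' : ℤ} {j : S.J} {g α : Path} (hg : g.left = S.side j)
    (hn : S.deg j + g.len = n) (hw : α.right = w) (h : n + α.len = n') :
    ∀ k ∈ g.mul α, k.left = S.side j ∧ k.right = w ∧ S.deg j + k.len = n' := by
  intro k hk
  rw [Path.left_mul hk, Path.right_mul hk, Path.len_mul hk]
  exact ⟨hg, hw, by omega⟩

theorem bind_mul_cond {v w : Vertex} {n n' : ℤ} {j : S.J} {g : Option Path} {α : Path}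
    (hg : ∀ k ∈ g, k.left = S.side j ∧ k.right = v ∧ S.deg j + k.len = n)
    (hw : α.right = w) (h : n + α.len = n') :
    ∀ k ∈ g.bind (fun k => k.mul α),
      k.left = S.side j ∧ k.right = w ∧ S.deg j + k.len = n' := by
  cases g with
  | none => simp
  | some k => exact S.mul_cond (hg k rfl).1 (hg k rfl).2.2 hw h

/-- Right multiplication by a path: `x ⊗ g ↦ x ⊗ gα`. -/
noncomputable def act (α : Path) (v w : Vertex) (n n' : ℤ) (hw : α.right = w)
    (h : n + α.len = n') : S.Comp V v n →ₗ[ℂ] S.Comp V w n' :=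
  DirectSum.toModule ℂ _ _ fun x =>
    S.ten V w n' x.j (x.g.mul α) (S.mul_cond x.cond.1 x.cond.2.2 hw h)

theorem act_ten {α : Path} {v w : Vertex} {n n' : ℤ} {hw : α.right = w}
    {h : n + α.len = n'} {j : S.J} {g : Option Path} {hg} (x : V j) :
    S.act V α v w n n' hw h (S.ten V v n j g hg x) =
      S.ten V w n' j (g.bind fun k => k.mul α) (S.bind_mul_cond hg hw h) x := by
  cases g with
  | none => exact map_zero _
  | some k => exact DirectSum.toModule_lof ℂ (φ := fun x : S.Idx v n =>
      S.ten V w n' x.j (x.g.mul α) (S.mul_cond x.cond.1 x.cond.2.2 hw h)) ⟨j, k, hg k rfl⟩ x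

/-- The graded right `B`-module `⨁_j V_j ⊗ e(side j) B ⟨deg j⟩`. -/
noncomputable abbrev mod : GrB where
  X w n := ModuleCat.of ℂ (S.Comp V w n)
  a i j h := S.act V .a .two .one i j Path.right_a (Path.add_len_a h)
  b i j h := S.act V .b .one .two i j Path.right_b (Path.add_len_b h)
  ba i j k h h' m := by
    have : (S.act V .a .two .one j k Path.right_a (Path.add_len_a h')).comp (S.act V .b .one .two i j Path.right_b (Path.add_len_b h)) = 0 := by
      refine DirectSum.linearMap_ext _ fun x => LinearMap.ext fun m => ?_
      change S.act V .a .two .one j k Path.right_a (Path.add_len_a h') (S.act V .b .one .two i j Path.right_b (Path.add_len_b h)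
        (DirectSum.lof ℂ (S.Idx _ i) (fun x => V x.j) x m)) = 0
      rw [lof_eq_ten, act_ten, act_ten]
      exact S.ten_none V (by cases x.g <;> rfl) m
    exact LinearMap.congr_fun this m

/-- Homomorphisms out of `S.mod V` agree if they agree on all `x ⊗ g`. -/
theorem mod_hom_ext {N : GrB} {φ ψ : S.mod V ⟶ N}
    (h : ∀ w n j g hg (m : V j),
      φ.f w n (S.ten V w n j g hg m) = ψ.f w n (S.ten V w n j g hg m)) : φ = ψ := by
  refine GrB.Hom.ext (funext fun w => funext fun n => ?_)
  exact DirectSum.linearMap_ext _ fun x => LinearMap.ext fun m => h w n x.j (some x.g) (by rintro _ ⟨⟩; exact x.cond) m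

theorem subsingleton_comp {w : Vertex} {n : ℤ} (h : ∀ x : S.Idx w n, Subsingleton (V x.j)) :
    Subsingleton (S.Comp V w n) :=
  ⟨fun _ _ => DFinsupp.ext fun i => (h i).elim _ _⟩

variable {S T U V W Z}

theorem lmul_cond {s : T.J} {j : S.J} {u : Path}
    (hu : u.left = T.side s ∧ u.right = S.side j ∧ T.deg s + u.len = S.deg j)
    {w : Vertex} {n : ℤ} {g : Option Path}
    (hg : ∀ k ∈ g, k.left = S.side j ∧ k.right = w ∧ S.deg j + k.len = n) :
    ∀ k ∈ g.bind (fun k => u.mul k), k.left = T.side s ∧ k.right = w ∧ T.deg s + k.len = n := by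
  cases g with
  | none => simp
  | some g =>
    intro k (hk : k ∈ u.mul g)
    rw [Path.left_mul hk, Path.right_mul hk, Path.len_mul hk]
    obtain ⟨h1, h2, h3⟩ := hu
    obtain ⟨h4, h5, h6⟩ := hg g rfl
    exact ⟨h1, h5, by omega⟩

/-- The linear map `x ⊗ g ↦ φ_j(x) ⊗ u_j g` for `x ∈ V_j`, where `φ_j : V_j → W_{τ j}` is linear
and `u_j` is a path. -/
noncomputable def lmulAux (τ : S.J → T.J) (u : S.J → Path)
    (hu : ∀ j, (u j).left = T.side (τ j) ∧ (u j).right = S.side j ∧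
      T.deg (τ j) + (u j).len = S.deg j)
    (φ : ∀ j, V j →ₗ[ℂ] W (τ j)) (w : Vertex) (n : ℤ) : S.Comp V w n →ₗ[ℂ] T.Comp W w n :=
  DirectSum.toModule ℂ _ _ fun x =>
    (T.ten W w n (τ x.j) ((u x.j).mul x.g)
      (lmul_cond (hu x.j) (g := some x.g) (by rintro _ ⟨⟩; exact x.cond))).comp (φ x.j)

theorem lmulAux_ten {τ : S.J → T.J} {u : S.J → Path} {hu}
    {φ : ∀ j, V j →ₗ[ℂ] W (τ j)} {w : Vertex} {n : ℤ} {j : S.J} {g : Option Path} {hg}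
    (x : V j) :
    lmulAux τ u hu φ w n (S.ten V w n j g hg x) =
      T.ten W w n (τ j) (g.bind fun k => (u j).mul k) (lmul_cond (hu j) hg) (φ j x) := by
  cases g with
  | none => exact map_zero _
  | some k =>
    exact DirectSum.toModule_lof ℂ (φ := fun x : S.Idx w n =>
      (T.ten W w n (τ x.j) ((u x.j).mul x.g)
        (lmul_cond (hu x.j) (g := some x.g) (by rintro _ ⟨⟩; exact x.cond))).comp (φ x.j))
      ⟨j, k, hg k rfl⟩ x

theorem lmulAux_act {τ : S.J → T.J} {u : S.J → Path} {hu}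
    {φ : ∀ j, V j →ₗ[ℂ] W (τ j)} {α : Path} {v w : Vertex} {n n' : ℤ} {hw : α.right = w}
    {h : n + α.len = n'} (m : S.Comp V v n) :
    lmulAux τ u hu φ w n' (S.act V α v w n n' hw h m) =
      T.act W α v w n n' hw h (lmulAux τ u hu φ v n m) := by
  refine LinearMap.congr_fun (f := (lmulAux τ u hu φ w n').comp (S.act V α v w n n' hw h))
    (g := (T.act W α v w n n' hw h).comp (lmulAux τ u hu φ v n)) ?_ m
  refine DirectSum.linearMap_ext _ fun x => LinearMap.ext fun m => ?_
  change lmulAux τ u hu φ w n' (S.act V α v w n n' hw h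
      (DirectSum.lof ℂ (S.Idx _ n) (fun x => V x.j) x m)) =
    T.act W α v w n n' hw h (lmulAux τ u hu φ v n
      (DirectSum.lof ℂ (S.Idx _ n) (fun x => V x.j) x m))
  rw [lof_eq_ten, act_ten, lmulAux_ten, lmulAux_ten, act_ten]
  exact T.ten_congr W (Path.mul_assoc' _ _ _).symm _

/-- The homomorphism `x ⊗ g ↦ φ_j(x) ⊗ u_j g` for `x ∈ V_j`, where `φ_j : V_j → W_{τ j}` is linear
and `u_j` is a path. -/
noncomputable abbrev lmul (τ : S.J → T.J) (u : S.J → Path)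
    (hu : ∀ j, (u j).left = T.side (τ j) ∧ (u j).right = S.side j ∧
      T.deg (τ j) + (u j).len = S.deg j)
    (φ : ∀ j, V j →ₗ[ℂ] W (τ j)) : S.mod V ⟶ T.mod W where
  f w n := lmulAux τ u hu φ w n
  comm_a _ _ h m := lmulAux_act (hw := Path.right_a) (h := Path.add_len_a h) m
  comm_b _ _ h m := lmulAux_act (hw := Path.right_b) (h := Path.add_len_b h) m

theorem lmul_ten {τ : S.J → T.J} {u : S.J → Path} {hu}
    {φ : ∀ j, V j →ₗ[ℂ] W (τ j)} {w : Vertex} {n : ℤ} {j : S.J} {g : Option Path} {hg}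
    (x : V j) :
    (lmul τ u hu φ).f w n (S.ten V w n j g hg x) =
      T.ten W w n (τ j) (g.bind fun k => (u j).mul k) (lmul_cond (hu j) hg) (φ j x) :=
  lmulAux_ten (hu := hu) x

/-- The homomorphism `x ⊗ g ↦ φ_j(x) ⊗ g` for `x ∈ V_j`, where `φ_j : V_j → W_{τ j}` is linear. -/
noncomputable def map (τ : S.J → T.J)
    (hτ : ∀ j, S.side j = T.side (τ j) ∧ T.deg (τ j) = S.deg j)
    (φ : ∀ j, V j →ₗ[ℂ] W (τ j)) : S.mod V ⟶ T.mod W :=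
  lmul τ (fun j => .idem (S.side j)) (fun j => by simpa using hτ j) φ

theorem map_cond {s : T.J} {j : S.J} (h : S.side j = T.side s ∧ T.deg s = S.deg j)
    {w : Vertex} {n : ℤ} {g : Option Path}
    (hg : ∀ k ∈ g, k.left = S.side j ∧ k.right = w ∧ S.deg j + k.len = n) :
    ∀ k ∈ g, k.left = T.side s ∧ k.right = w ∧ T.deg s + k.len = n := by
  intro k hk
  rw [← h.1, h.2]
  exact hg k hk

theorem map_ten {τ : S.J → T.J} {hτ} {φ : ∀ j, V j →ₗ[ℂ] W (τ j)}
    {w : Vertex} {n : ℤ} {j : S.J} {g : Option Path} {hg} (x : V j) :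
    (map τ hτ φ).f w n (S.ten V w n j g hg x) =
      T.ten W w n (τ j) g (map_cond (hτ j) hg) (φ j x) := by
  rw [map, lmul_ten]
  refine T.ten_congr W ?_ _
  cases g with
  | none => rfl
  | some k => rw [← (hg k rfl).1]; exact Path.idem_mul k

end Shape

/-! ### Graded modules over `C = ℂ[x] / (x²)`, with `x` of degree two -/

/-- A graded `C`-module. -/
structure GrC where
  X : ℤ → ModuleCat.{0} ℂ
  x : ∀ i j : ℤ, i + 2 = j → (X i →ₗ[ℂ] X j)
  xx : ∀ (i j k : ℤ) (h : i + 2 = j) (h' : j + 2 = k) (m : X i), x j k h' (x i j h m) = 0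

namespace GrC

/-- Homomorphisms of graded `C`-modules (of degree `0`). -/
@[ext]
structure Hom (M N : GrC) where
  f : ∀ i, M.X i →ₗ[ℂ] N.X i
  comm : ∀ (i j : ℤ) (h : i + 2 = j) (m : M.X i), f j (M.x i j h m) = N.x i j h (f i m)

instance : Category GrC where
  Hom := Hom
  id M := ⟨fun _ => LinearMap.id, fun _ _ _ _ => rfl⟩
  comp φ ψ := ⟨fun i => (ψ.f i).comp (φ.f i), fun i j h m => by simp [φ.comm, ψ.comm]⟩

@[ext]
theorem hom_ext {M N : GrC} {φ ψ : M ⟶ N} (h : ∀ i m, φ.f i m = ψ.f i m) : φ = ψ :=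
  Hom.ext (funext fun i => LinearMap.ext (h i))

@[simp] theorem id_f (M : GrC) (i) : Hom.f (𝟙 M) i = LinearMap.id := rfl

@[simp] theorem comp_f {M N K : GrC} (φ : M ⟶ N) (ψ : N ⟶ K) (i) :
    (φ ≫ ψ).f i = (ψ.f i).comp (φ.f i) := rfl

variable {M N : GrC}

instance : Zero (M ⟶ N) := ⟨⟨fun _ => 0, by simp⟩⟩
instance : Add (M ⟶ N) := ⟨fun φ ψ => ⟨fun i => φ.f i + ψ.f i, by simp [φ.comm, ψ.comm]⟩⟩
instance : Neg (M ⟶ N) := ⟨fun φ => ⟨fun i => -φ.f i, by simp [φ.comm]⟩⟩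
instance : Sub (M ⟶ N) := ⟨fun φ ψ => ⟨fun i => φ.f i - ψ.f i, by simp [φ.comm, ψ.comm]⟩⟩
instance : SMul ℕ (M ⟶ N) := ⟨fun n φ => ⟨fun i => n • φ.f i, by simp [φ.comm]⟩⟩
instance : SMul ℤ (M ⟶ N) := ⟨fun n φ => ⟨fun i => n • φ.f i, by simp [φ.comm]⟩⟩

theorem f_injective : Function.Injective (fun φ : M ⟶ N => Hom.f φ) :=
  fun _ _ h => Hom.ext h

instance : AddCommGroup (M ⟶ N) :=
  f_injective.addCommGroup _ rfl (fun _ _ => rfl) (fun _ => rfl) (fun _ _ => rfl)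
    (fun _ _ => rfl) (fun _ _ => rfl)

instance : Preadditive GrC where
  add_comp _ _ _ _ _ _ := hom_ext fun _ _ => by
    exact map_add (Hom.f _ _) _ _
  comp_add _ _ _ _ _ _ := hom_ext fun _ _ => rfl

@[simp] theorem zero_f (i) : Hom.f (0 : M ⟶ N) i = 0 := rfl
@[simp] theorem add_f (φ ψ : M ⟶ N) (i) : (φ + ψ).f i = φ.f i + ψ.f i := rfl

/-- The functor `N ↦ N_j`. -/
def ev (j : ℤ) : GrC ⥤ ModuleCat.{0} ℂ where
  obj M := M.X j
  map φ := ModuleCat.ofHom (φ.f j)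

instance (j : ℤ) : (ev j).Additive where
  map_add := rfl

/-- `N` is finite dimensional over `ℂ`. -/
def IsFinDim (N : GrC) : Prop :=
  (∀ j, FiniteDimensional ℂ (N.X j)) ∧ ∃ n : ℤ, ∀ j, n < |j| → Subsingleton (N.X j)

end GrC

/-! ### The functors `π̃` and `ι̃` -/

/-- The quotient functor `M ↦ Hom(P(2), M)⟨-1⟩ = M e(2)⟨-1⟩`, where `x` acts as right
multiplication by `c`. -/
def piMod : GrB ⥤ GrC where
  obj M :=
    { X := fun j => M.X .two (j + 1)
      x := fun i j h => M.c (i + 1) (j + 1) (by omega)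
      xx := fun i j k h h' m => M.c_c _ _ _ _ _ m }
  map φ := ⟨fun j => φ.f .two (j + 1), fun i j h m => GrB.comm_c φ (i + 1) (j + 1) (by omega) m⟩

instance : piMod.Additive where
  map_add := rfl

/-- The index set for `N ⊗_ℂ P(2)⟨d⟩`, for a graded vector space `N = ⨁_i N_i`. -/
abbrev tensorP2 (d : ℤ) : Shape where
  J := ℤ
  side _ := .two
  deg i := i + d

namespace GrC

/-- The homomorphism `N ⊗_ℂ P(2) → N ⊗_ℂ P(2)` of degree two, `n ⊗ p ↦ n x ⊗ p - n ⊗ x p`, where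
`x` acts on `P(2) = e(2)B` as left multiplication by `c`; here `P(2)` is shifted by `⟨1⟩` in the
target. -/
noncomputable def rel (N : GrC) : (tensorP2 3).mod N.X ⟶ (tensorP2 1).mod N.X :=
  Shape.map (S := tensorP2 3) (T := tensorP2 1) (fun i => i + 2)
      (fun i => ⟨rfl, by dsimp; omega⟩) (fun i => N.x i (i + 2) rfl) -
    Shape.lmul (S := tensorP2 3) (T := tensorP2 1) (fun i => i) (fun _ => .c)
      (fun i => ⟨rfl, rfl, by dsimp [Path.len]; omega⟩) (fun _ => LinearMap.id)

/-- The map `N ⊗_ℂ P(2)⟨d⟩ → N' ⊗_ℂ P(2)⟨d⟩` induced by `N → N'`. -/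
noncomputable def tensorMap {N N' : GrC} (φ : N ⟶ N') (d : ℤ) :
    (tensorP2 d).mod N.X ⟶ (tensorP2 d).mod N'.X :=
  Shape.map (S := tensorP2 d) (T := tensorP2 d) (fun i => i) (fun _ => ⟨rfl, rfl⟩) φ.f

theorem rel_naturality {N N' : GrC} (φ : N ⟶ N') :
    N.rel ≫ tensorMap φ 1 = tensorMap φ 3 ≫ N'.rel := by
  refine Shape.mod_hom_ext _ _ fun w n j g hg m => ?_
  simp only [GrB.comp_f, LinearMap.comp_apply, rel, tensorMap, GrB.sub_f, LinearMap.sub_apply,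
    map_sub]
  rw [Shape.map_ten, Shape.map_ten, Shape.lmul_ten, Shape.map_ten, Shape.map_ten, Shape.lmul_ten,
    Shape.map_ten]
  rw [φ.comm]; rfl

theorem tensorMap_id (N : GrC) (d : ℤ) : tensorMap (𝟙 N) d = 𝟙 _ := by
  refine Shape.mod_hom_ext _ _ fun w n j g hg m => ?_
  rw [tensorMap, Shape.map_ten]; rfl

theorem tensorMap_comp {N N' N'' : GrC} (φ : N ⟶ N') (ψ : N' ⟶ N'') (d : ℤ) :
    tensorMap (φ ≫ ψ) d = tensorMap φ d ≫ tensorMap ψ d := by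
  refine Shape.mod_hom_ext _ _ fun w n j g hg m => ?_
  simp only [GrB.comp_f, LinearMap.comp_apply, tensorMap]
  rw [Shape.map_ten, Shape.map_ten, Shape.map_ten]; rfl

end GrC

/-- The functor `N ↦ N ⊗_C P(2)⟨1⟩`. The tensor product over `C` is the quotient of the tensor
product over `ℂ` by all `n x ⊗ p - n ⊗ x p`. -/
noncomputable def iotaMod : GrC ⥤ GrB where
  obj N := GrB.coker N.rel
  map φ := GrB.cokerMap (GrC.tensorMap φ 3) (GrC.tensorMap φ 1) (GrC.rel_naturality φ)
  map_id N := by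
    refine GrB.hom_ext fun v i m => ?_
    obtain ⟨n, rfl⟩ := Submodule.Quotient.mk_surjective _ m
    exact congrArg Submodule.Quotient.mk
      (congrArg (fun χ : (tensorP2 1).mod N.X ⟶ (tensorP2 1).mod N.X => χ.f v i n)
        (GrC.tensorMap_id N 1))
  map_comp {N N' N''} φ ψ := by
    refine GrB.hom_ext fun v i m => ?_
    obtain ⟨n, rfl⟩ := Submodule.Quotient.mk_surjective _ m
    exact congrArg Submodule.Quotient.mk
      (congrArg (fun χ : (tensorP2 1).mod N.X ⟶ (tensorP2 1).mod N''.X => χ.f v i n)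
        (GrC.tensorMap_comp φ ψ 1))

instance : iotaMod.PreservesZeroMorphisms where
  map_zero N N' := by
    refine GrB.hom_ext fun v i m => ?_
    obtain ⟨n, rfl⟩ := Submodule.Quotient.mk_surjective _ m
    have : GrC.tensorMap (0 : N ⟶ N') 1 = 0 :=
      Shape.mod_hom_ext _ _ fun w n j g hg m => by
        rw [GrC.tensorMap, Shape.map_ten]; exact map_zero _
    exact congrArg Submodule.Quotient.mk
      (congrArg (fun χ : (tensorP2 1).mod N.X ⟶ (tensorP2 1).mod N'.X => χ.f v i n) this)

/-! ### The Koszul duality functor on complexes -/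

/-- Indices of the summands `M^r_s e(v)` with `r + s = p`. -/
structure KIdx (p : ℤ) where
  r : ℤ
  s : ℤ
  v : Vertex
  h : r + s = p

/-- The index set for `(𝔻 M)^p = ⨁_{r + s = p} M^r_s ⊗_{B_0} B⟨-s⟩`, where the left action of `B_0`
on `B` is twisted by `e(1) ↔ e(2)`: thus `M^r_s e(v)` is tensored with `e(v')B⟨-s⟩`, where `v'` is
the vertex other than `v`. -/
abbrev koszulShape (p : ℤ) : Shape where
  J := KIdx p
  side j := j.v.other
  deg j := -j.s

namespace Koszul

variable (M : CochainComplex GrB ℤ)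

/-- The vector spaces `M^r_s e(v)`. -/
abbrev V (p : ℤ) (j : KIdx p) : ModuleCat.{0} ℂ := (M.X j.r).X j.v j.s

/-- The map `m ⊗ g ↦ d m ⊗ g`. -/
noncomputable abbrev dM (p p' : ℤ) (h : p + 1 = p') :
    (koszulShape p).mod (V M p) ⟶ (koszulShape p').mod (V M p') :=
  Shape.map (S := koszulShape p) (T := koszulShape p') (W := V M p')
    (fun j => ⟨j.r + 1, j.s, j.v, by have := j.h; omega⟩) (fun _ => ⟨rfl, rfl⟩)
    (fun j => (M.d j.r (j.r + 1)).f j.v j.s)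

theorem dK_cond (v : Vertex) (s : ℤ) : (Path.arr v).left = v.other.other ∧
    (Path.arr v).right = v.other ∧ -(s + 1) + (Path.arr v).len = -s := by
  cases v <;> refine ⟨rfl, rfl, ?_⟩ <;> dsimp [Path.arr, Path.len] <;> omega

/-- The map `m ⊗ g ↦ m a ⊗ a g + m b ⊗ b g`. For `m = m e(v)` only the arrow `α` with `α = e(v) α`
contributes. -/
noncomputable abbrev dK (p p' : ℤ) (h : p + 1 = p') :
    (koszulShape p).mod (V M p) ⟶ (koszulShape p').mod (V M p') :=
  Shape.lmul (S := koszulShape p) (T := koszulShape p') (W := V M p')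
    (fun j => ⟨j.r, j.s + 1, j.v.other, by have := j.h; omega⟩) (fun j => .arr j.v)
    (fun j => dK_cond j.v j.s)
    (fun j => (M.X j.r).arr j.v j.s (j.s + 1) rfl)

theorem dM_dM (p p' p'' : ℤ) (h : p + 1 = p') (h' : p' + 1 = p'') :
    dM M p p' h ≫ dM M p' p'' h' = 0 := by
  refine Shape.mod_hom_ext _ _ fun w n j g hg m => ?_
  simp only [GrB.comp_f, LinearMap.comp_apply, GrB.zero_f, LinearMap.zero_apply]
  rw [Shape.map_ten, Shape.map_ten]
  have := congrArg (fun χ => GrB.Hom.f χ j.v j.s m) (M.d_comp_d j.r (j.r + 1) (j.r + 1 + 1))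
  exact (congrArg _ this).trans (map_zero _)

theorem dK_dK (p p' p'' : ℤ) (h : p + 1 = p') (h' : p' + 1 = p'') :
    dK M p p' h ≫ dK M p' p'' h' = 0 := by
  refine Shape.mod_hom_ext _ _ fun w n j g hg m => ?_
  simp only [GrB.comp_f, LinearMap.comp_apply, GrB.zero_f, LinearMap.zero_apply]
  rw [Shape.lmul_ten, Shape.lmul_ten]
  obtain ⟨r, s, v, hj⟩ := j
  cases v
  · exact (congrArg _ ((M.X r).ba s (s + 1) (s + 1 + 1) rfl rfl m)).trans (map_zero _)
  · refine Shape.ten_none _ _ ?_ _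
    rcases g with _ | g
    · rfl
    · cases g <;> rfl

theorem dM_dK (p p' p'' : ℤ) (h : p + 1 = p') (h' : p' + 1 = p'') :
    dM M p p' h ≫ dK M p' p'' h' = dK M p p' h ≫ dM M p' p'' h' := by
  refine Shape.mod_hom_ext _ _ fun w n j g hg m => ?_
  simp only [GrB.comp_f, LinearMap.comp_apply]
  rw [Shape.map_ten, Shape.lmul_ten, Shape.lmul_ten, Shape.map_ten]
  exact congrArg _ (GrB.comm_arr (M.d j.r (j.r + 1)) j.v j.s (j.s + 1) rfl m).symm

/-- The differential `m ⊗ g ↦ d m ⊗ g + (-1)^(r+s) (m a ⊗ a g + m b ⊗ b g)`. -/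
noncomputable def d (p p' : ℤ) (h : p + 1 = p') :
    (koszulShape p).mod (V M p) ⟶ (koszulShape p').mod (V M p') :=
  dM M p p' h + (p.negOnePow : ℤ) • dK M p p' h

theorem d_d (p p' p'' : ℤ) (h : p + 1 = p') (h' : p' + 1 = p'') :
    d M p p' h ≫ d M p' p'' h' = 0 := by
  have e : (p'.negOnePow : ℤ) = -(p.negOnePow : ℤ) := by
    rw [← h, Int.negOnePow_succ]; rfl
  simp only [d, Preadditive.add_comp, Preadditive.comp_add, Preadditive.zsmul_comp,
    Preadditive.comp_zsmul, Preadditive.comp_neg, dM_dM, dK_dK, dM_dK, e, smul_zero, neg_smul]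
  rw [zero_add, add_zero, add_neg_cancel]

/-- The complex `𝔻 M`. -/
noncomputable def obj : CochainComplex GrB ℤ where
  X p := (koszulShape p).mod (V M p)
  d p p' := if h : p + 1 = p' then d M p p' h else 0
  shape p p' h := dif_neg h
  d_comp_d' p p' p'' h h' := by
    exact (congrArg₂ (· ≫ ·) (dif_pos h) (dif_pos h')).trans (d_d M p p' p'' h h')

variable {M}

/-- The map `m ⊗ g ↦ f m ⊗ g`. -/
noncomputable def mapAux {N : CochainComplex GrB ℤ} (f : M ⟶ N) (p : ℤ) :
    (koszulShape p).mod (V M p) ⟶ (koszulShape p).mod (V N p) :=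
  Shape.map (S := koszulShape p) (T := koszulShape p) (fun j => j) (fun _ => ⟨rfl, rfl⟩)
    (fun j => (f.f j.r).f j.v j.s)

theorem mapAux_d {N : CochainComplex GrB ℤ} (f : M ⟶ N) (p p' : ℤ) (h : p + 1 = p') :
    mapAux f p ≫ d N p p' h = d M p p' h ≫ mapAux f p' := by
  have h1 : mapAux f p ≫ dM N p p' h = dM M p p' h ≫ mapAux f p' := by
    refine Shape.mod_hom_ext _ _ fun w n j g hg m => ?_
    simp only [GrB.comp_f, LinearMap.comp_apply, mapAux]
    rw [Shape.map_ten, Shape.map_ten, Shape.map_ten, Shape.map_ten]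
    exact congrArg _ (congrArg (fun χ => GrB.Hom.f χ j.v j.s m) (f.comm j.r (j.r + 1)))
  have h2 : mapAux f p ≫ dK N p p' h = dK M p p' h ≫ mapAux f p' := by
    refine Shape.mod_hom_ext _ _ fun w n j g hg m => ?_
    simp only [GrB.comp_f, LinearMap.comp_apply, mapAux]
    rw [Shape.map_ten, Shape.lmul_ten, Shape.lmul_ten, Shape.map_ten]
    exact congrArg _ (GrB.comm_arr (f.f j.r) j.v j.s (j.s + 1) rfl m).symm
  simp only [d, Preadditive.add_comp, Preadditive.comp_add, Preadditive.zsmul_comp,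
    Preadditive.comp_zsmul, h1, h2]

end Koszul

/-- The functor `M ↦ 𝔻 M` on complexes. -/
noncomputable def koszulCpx : CochainComplex GrB ℤ ⥤ CochainComplex GrB ℤ where
  obj M := Koszul.obj M
  map {M N} f :=
    { f := fun p => Koszul.mapAux f p
      comm' := fun p p' (h : p + 1 = p') => by
        simp only [Koszul.obj, dif_pos h]
        exact Koszul.mapAux_d f p p' h }
  map_id M := by
    refine HomologicalComplex.hom_ext _ _ fun p => Shape.mod_hom_ext _ _ fun w n j g hg m => ?_
    exact Shape.map_ten (S := koszulShape p) (T := koszulShape p) (hτ := fun _ => ⟨rfl, rfl⟩) m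
  map_comp {M N K} f f' := by
    refine HomologicalComplex.hom_ext _ _ fun p => Shape.mod_hom_ext _ _ fun w n j g hg m => ?_
    change (Koszul.mapAux (f ≫ f') p).f w n _ =
      (Koszul.mapAux f' p).f w n ((Koszul.mapAux f p).f w n _)
    simp only [Koszul.mapAux]
    rw [Shape.map_ten, Shape.map_ten, Shape.map_ten]; rfl

/-! ### The Cooper–Krushkal projector on complexes -/

theorem negOnePow_add_one (i : ℤ) : ((i + 1).negOnePow : ℤ) = -(i.negOnePow : ℤ) := by
  rw [Int.negOnePow_succ]; rfl

theorem map_add_map_eq_zero {A A' : Type} [AddCommGroup A] [AddCommGroup A'] [Module ℂ A]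
    [Module ℂ A'] (φ : A →ₗ[ℂ] A') {x y : A} (h : x + y = 0) : φ x + φ y = 0 := by
  rw [← map_add, h, map_zero]

/-- Indices of the summands `(X^i)_t e(2)` of `X^i ⊗_B ℂ𝕂^(k+1)` with `i + (k + 1) = n`. -/
structure TIdx (n : ℤ) where
  i : ℤ
  k : ℕ
  t : ℤ
  h : i + (k + 1) = n

/-- The index set for `⨁_{i + (k+1) = n} X^i ⊗_B θ⟨-1-2k⟩`, where
`θ = B e(2) ⊗ e(2) B ⟨-1⟩`, so that `X^i ⊗_B θ⟨-1-2k⟩ = X^i e(2) ⊗ e(2) B ⟨-2(k+1)⟩`. -/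
abbrev tailShape (n : ℤ) : Shape where
  J := TIdx n
  side _ := .two
  deg j := j.t - 2 * (j.k + 1)

namespace CK

variable (M : CochainComplex GrB ℤ)

/-- The vector spaces `(X^i)_t e(2)`. -/
abbrev V (n : ℤ) (j : TIdx n) : ModuleCat.{0} ℂ := (M.X j.i).X .two j.t

/-- The map `x ⊗ g ↦ d x ⊗ g`. -/
noncomputable abbrev dM (n n' : ℤ) (h : n + 1 = n') :
    (tailShape n).mod (V M n) ⟶ (tailShape n').mod (V M n') :=
  Shape.map (S := tailShape n) (T := tailShape n') (W := V M n')
    (fun j => ⟨j.i + 1, j.k, j.t, by have := j.h; omega⟩) (fun _ => ⟨rfl, rfl⟩)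
    (fun j => (M.d j.i (j.i + 1)).f .two j.t)

/-- The map `x ⊗ g ↦ (-1)^i x c ⊗ g`, from `X^i ⊗_B θ⟨-1-2k⟩` to `X^i ⊗_B θ⟨-1-2(k+1)⟩`. -/
noncomputable abbrev dL (n n' : ℤ) (h : n + 1 = n') :
    (tailShape n).mod (V M n) ⟶ (tailShape n').mod (V M n') :=
  Shape.map (S := tailShape n) (T := tailShape n') (W := V M n')
    (fun j => ⟨j.i, j.k + 1, j.t + 2, by have := j.h; push_cast; omega⟩)
    (fun _ => ⟨rfl, by push_cast; ring⟩)
    (fun j => (j.i.negOnePow : ℤ) • (M.X j.i).c j.t (j.t + 2) rfl)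

/-- The map `x ⊗ g ↦ (-1)^i (-1)^(k+1) x ⊗ c g`, from `X^i ⊗_B θ⟨-1-2k⟩` to
`X^i ⊗_B θ⟨-1-2(k+1)⟩`. -/
noncomputable abbrev dR (n n' : ℤ) (h : n + 1 = n') :
    (tailShape n).mod (V M n) ⟶ (tailShape n').mod (V M n') :=
  Shape.lmul (S := tailShape n) (T := tailShape n') (W := V M n')
    (fun j => ⟨j.i, j.k + 1, j.t, by have := j.h; push_cast; omega⟩)
    (fun _ => .c) (fun _ => ⟨rfl, rfl, by dsimp [Path.len]; ring⟩)
    (fun j => ((j.i.negOnePow : ℤ) * (-1) ^ (j.k + 1)) • LinearMap.id)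

/-- The differential on `⨁_{i + (k+1) = n} X^i ⊗_B θ⟨-1-2k⟩`:
`x ⊗ g ↦ d x ⊗ g + (-1)^i (x c ⊗ g + (-1)^(k+1) x ⊗ c g)`. The last bracket is induced by
`β : e(2) ⊗ e(2) ↦ c ⊗ e(2) - e(2) ⊗ c` for even `k` and by
`γ : e(2) ⊗ e(2) ↦ c ⊗ e(2) + e(2) ⊗ c` for odd `k`. -/
noncomputable def dTail (n n' : ℤ) (h : n + 1 = n') :
    (tailShape n).mod (V M n) ⟶ (tailShape n').mod (V M n') :=
  dM M n n' h + (dL M n n' h + dR M n n' h)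

theorem dTail_dTail (n n' n'' : ℤ) (h : n + 1 = n') (h' : n' + 1 = n'') :
    dTail M n n' h ≫ dTail M n' n'' h' = 0 := by
  have hMM : dM M n n' h ≫ dM M n' n'' h' = 0 := by
    refine Shape.mod_hom_ext _ _ fun w q j g hg m => ?_
    simp only [GrB.comp_f, LinearMap.comp_apply, GrB.zero_f, LinearMap.zero_apply]
    rw [Shape.map_ten, Shape.map_ten]
    have := congrArg (fun χ => GrB.Hom.f χ .two j.t m) (M.d_comp_d j.i (j.i + 1) (j.i + 1 + 1))
    exact (congrArg _ this).trans (map_zero _)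
  have hLL : dL M n n' h ≫ dL M n' n'' h' = 0 := by
    refine Shape.mod_hom_ext _ _ fun w q j g hg m => ?_
    simp only [GrB.comp_f, LinearMap.comp_apply, GrB.zero_f, LinearMap.zero_apply]
    rw [Shape.map_ten, Shape.map_ten]
    refine (congrArg _ ?_).trans (map_zero _)
    change (j.i.negOnePow : ℤ) • (M.X j.i).c (j.t + 2) (j.t + 2 + 2) rfl
      ((j.i.negOnePow : ℤ) • (M.X j.i).c j.t (j.t + 2) rfl m) = 0
    rw [map_zsmul, GrB.c_c, smul_zero, smul_zero]
  have hRR : dR M n n' h ≫ dR M n' n'' h' = 0 := by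
    refine Shape.mod_hom_ext _ _ fun w q j g hg m => ?_
    simp only [GrB.comp_f, LinearMap.comp_apply, GrB.zero_f, LinearMap.zero_apply]
    rw [Shape.lmul_ten, Shape.lmul_ten]
    refine Shape.ten_none _ _ ?_ _
    rcases g with _ | g
    · rfl
    · cases g <;> rfl
  have hML : dM M n n' h ≫ dL M n' n'' h' + dL M n n' h ≫ dM M n' n'' h' = 0 := by
    refine Shape.mod_hom_ext _ _ fun w q j g hg m => ?_
    simp only [GrB.comp_f, LinearMap.comp_apply, GrB.zero_f, LinearMap.zero_apply, GrB.add_f,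
      LinearMap.add_apply]
    rw [Shape.map_ten, Shape.map_ten, Shape.map_ten, Shape.map_ten]
    refine map_add_map_eq_zero _ ?_
    change ((j.i + 1).negOnePow : ℤ) • (M.X (j.i + 1)).c j.t (j.t + 2) rfl
        ((M.d j.i (j.i + 1)).f .two j.t m) +
      (M.d j.i (j.i + 1)).f .two (j.t + 2)
        ((j.i.negOnePow : ℤ) • (M.X j.i).c j.t (j.t + 2) rfl m) = 0
    rw [map_zsmul, GrB.comm_c, negOnePow_add_one, neg_smul, neg_add_cancel]
  have hMR : dM M n n' h ≫ dR M n' n'' h' + dR M n n' h ≫ dM M n' n'' h' = 0 := by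
    refine Shape.mod_hom_ext _ _ fun w q j g hg m => ?_
    simp only [GrB.comp_f, LinearMap.comp_apply, GrB.zero_f, LinearMap.zero_apply, GrB.add_f,
      LinearMap.add_apply]
    rw [Shape.map_ten, Shape.lmul_ten, Shape.lmul_ten, Shape.map_ten]
    refine map_add_map_eq_zero _ ?_
    change (((j.i + 1).negOnePow : ℤ) * (-1) ^ (j.k + 1)) • (M.d j.i (j.i + 1)).f .two j.t m +
      (M.d j.i (j.i + 1)).f .two j.t (((j.i.negOnePow : ℤ) * (-1) ^ (j.k + 1)) • m) = 0
    rw [map_zsmul, negOnePow_add_one, neg_mul, neg_smul, neg_add_cancel]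
  have hLR : dL M n n' h ≫ dR M n' n'' h' + dR M n n' h ≫ dL M n' n'' h' = 0 := by
    refine Shape.mod_hom_ext _ _ fun w q j g hg m => ?_
    simp only [GrB.comp_f, LinearMap.comp_apply, GrB.zero_f, LinearMap.zero_apply, GrB.add_f,
      LinearMap.add_apply]
    rw [Shape.map_ten, Shape.lmul_ten, Shape.lmul_ten, Shape.map_ten]
    refine map_add_map_eq_zero _ ?_
    change ((j.i.negOnePow : ℤ) * (-1) ^ (j.k + 1 + 1)) •
        ((j.i.negOnePow : ℤ) • (M.X j.i).c j.t (j.t + 2) rfl m) +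
      (j.i.negOnePow : ℤ) • (M.X j.i).c j.t (j.t + 2) rfl
        (((j.i.negOnePow : ℤ) * (-1) ^ (j.k + 1)) • m) = 0
    rw [map_zsmul, smul_smul, smul_smul, ← add_smul]
    convert zero_smul ℤ _ using 2
    ring
  calc dTail M n n' h ≫ dTail M n' n'' h'
      = dM M n n' h ≫ dM M n' n'' h' + dL M n n' h ≫ dL M n' n'' h' +
        dR M n n' h ≫ dR M n' n'' h' +
        (dM M n n' h ≫ dL M n' n'' h' + dL M n n' h ≫ dM M n' n'' h') +
        (dM M n n' h ≫ dR M n' n'' h' + dR M n n' h ≫ dM M n' n'' h') +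
        (dL M n n' h ≫ dR M n' n'' h' + dR M n n' h ≫ dL M n' n'' h') := by
        simp only [dTail, Preadditive.add_comp, Preadditive.comp_add]
        generalize dM M n n' h ≫ dM M n' n'' h' = x1
        generalize dM M n n' h ≫ dL M n' n'' h' = x2
        generalize dM M n n' h ≫ dR M n' n'' h' = x3
        generalize dL M n n' h ≫ dM M n' n'' h' = x4
        generalize dL M n n' h ≫ dL M n' n'' h' = x5
        generalize dL M n n' h ≫ dR M n' n'' h' = x6
        generalize dR M n n' h ≫ dM M n' n'' h' = x7
        generalize dR M n n' h ≫ dL M n' n'' h' = x8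
        generalize dR M n n' h ≫ dR M n' n'' h' = x9
        abel
    _ = 0 := by rw [hMM, hLL, hRR, hML, hMR, hLR]; simp

/-- The map `x ↦ x ⊗ g` from `(X^n)_t e(2)` to `(X^n ⊗_B θ⟨-1⟩)_q e(w)`, with `x ⊗ 0 = 0`. -/
noncomputable def first (n n' : ℤ) (h : n + 1 = n') (w : Vertex) (q t : ℤ) (g : Option Path)
    (hg : ∀ k ∈ g, k.left = .two ∧ k.right = w ∧ t - 2 + k.len = q) :
    (M.X n).X .two t →ₗ[ℂ] (tailShape n').Comp (V M n') w q :=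
  (tailShape n').ten (V M n') w q ⟨n, 0, t, by push_cast; omega⟩ g
    (fun k hk => ⟨(hg k hk).1, (hg k hk).2.1, by have := (hg k hk).2.2; push_cast; omega⟩)

theorem first_b_congr {n n' : ℤ} {h : n + 1 = n'} {w : Vertex} {p q t t' : ℤ}
    {g : Option Path} (u : q + 1 = t) (u' : q + 1 = t') {hg hg'} (m : (M.X n).X .one q) :
    first M n n' h w p t g hg ((M.X n).b q t u m) =
      first M n n' h w p t' g hg' ((M.X n).b q t' u' m) := by
  subst u; subst u'; rfl

theorem first_none {n n' : ℤ} {h : n + 1 = n'} {w : Vertex} {q t : ℤ} {g : Option Path}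
    (e : g = none) {hg} (m : (M.X n).X .two t) : first M n n' h w q t g hg m = 0 := by
  subst e; rfl

theorem act_first {n n' : ℤ} {h : n + 1 = n'} {α : Path} {v w : Vertex} {q q' t : ℤ}
    {g : Option Path} {hg} (hw : α.right = w) (hq : q + α.len = q') (m : (M.X n).X .two t) :
    (tailShape n').act (V M n') α v w q q' hw hq (first M n n' h v q t g hg m) =
      first M n n' h w q' t (g.bind fun k => k.mul α) (by
        cases g with
        | none => simp
        | some g =>
          intro k (hk : k ∈ g.mul α)
          have := hg g rfl
          rw [Path.left_mul hk, Path.right_mul hk, Path.len_mul hk]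
          exact ⟨this.1, hw, by omega⟩) m := by
  unfold first
  exact Shape.act_ten (S := tailShape n') (V := V M n') (j := ⟨n, 0, t, by push_cast; omega⟩) m

theorem cond_a (q : ℤ) : ∀ k ∈ some Path.a,
    k.left = .two ∧ k.right = .one ∧ q + 1 - 2 + k.len = q := by
  rintro _ ⟨⟩; exact ⟨rfl, rfl, by dsimp [Path.len]; ring⟩

theorem cond_e2 (q : ℤ) : ∀ k ∈ some Path.e2,
    k.left = .two ∧ k.right = .two ∧ q + 2 - 2 + k.len = q := by
  rintro _ ⟨⟩; exact ⟨rfl, rfl, by dsimp [Path.len]; ring⟩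

theorem cond_c (q : ℤ) : ∀ k ∈ some Path.c,
    k.left = .two ∧ k.right = .two ∧ q - 2 + k.len = q := by
  rintro _ ⟨⟩; exact ⟨rfl, rfl, by dsimp [Path.len]; ring⟩

/-- The map `X^n → X^n ⊗_B θ⟨-1⟩` induced by `(-1)^n α`, where
`α : e(2) ↦ c ⊗ e(2) + e(2) ⊗ c` and `α : e(1) ↦ b ⊗ a`. -/
noncomputable def alphaAux (n n' : ℤ) (h : n + 1 = n') : ∀ (w : Vertex) (q : ℤ),
    (M.X n).X w q →ₗ[ℂ] (tailShape n').Comp (V M n') w q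
  | .one, q =>
    (n.negOnePow : ℤ) •
      (first M n n' h .one q (q + 1) (some .a) (cond_a q)).comp
      ((M.X n).b q (q + 1) rfl)
  | .two, q =>
    (n.negOnePow : ℤ) •
      ((first M n n' h .two q (q + 2) (some .e2) (cond_e2 q)).comp
        ((M.X n).c q (q + 2) rfl) +
      first M n n' h .two q q (some .c) (cond_c q))

theorem alphaAux_one {n n' : ℤ} {h : n + 1 = n'} {q : ℤ} (m : (M.X n).X .one q) :
    alphaAux M n n' h .one q m = (n.negOnePow : ℤ) •
      first M n n' h .one q (q + 1) (some .a) (cond_a q)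
      ((M.X n).b q (q + 1) rfl m) := rfl

theorem alphaAux_two {n n' : ℤ} {h : n + 1 = n'} {q : ℤ} (m : (M.X n).X .two q) :
    alphaAux M n n' h .two q m = (n.negOnePow : ℤ) •
      (first M n n' h .two q (q + 2) (some .e2) (cond_e2 q)
        ((M.X n).c q (q + 2) rfl m) +
      first M n n' h .two q q (some .c) (cond_c q) m) := rfl

/-- The homomorphism `X^n → X^n ⊗_B θ⟨-1⟩` induced by `(-1)^n α`. -/
noncomputable def alpha (n n' : ℤ) (h : n + 1 = n') :
    M.X n ⟶ (tailShape n').mod (V M n') where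
  f w q := alphaAux M n n' h w q
  comm_a i j hij m := by
    subst hij
    change _ = (tailShape n').act (V M n') .a .two .one i (i + 1) Path.right_a
      (Path.add_len_a rfl) _
    rw [alphaAux_one, alphaAux_two, map_zsmul, map_add, act_first, act_first]
    refine congrArg _ (Eq.trans ?_ (congrArg₂ (· + ·) rfl (first_none M rfl m).symm))
    rw [add_zero]
    exact first_b_congr M rfl _ _
  comm_b i j hij m := by
    subst hij
    have e : (M.X n).c (i + 1) (i + 1 + 2) rfl ((M.X n).b i (i + 1) rfl m) = 0 := by
      have := (M.X n).ba i (i + 1) (i + 1 + 1) rfl rfl m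
      simp [GrB.c, this]
    change _ = (tailShape n').act (V M n') .b .one .two i (i + 1) Path.right_b
      (Path.add_len_b rfl) _
    rw [alphaAux_one, alphaAux_two, e, map_zero, zero_add, map_zsmul, act_first]
    rfl

/-- The map `x ↦ x ⊗ g` from `(X^n)_t e(2)` to `(X^n ⊗_B θ⟨-3⟩)_q e(w)`, with `x ⊗ 0 = 0`. -/
noncomputable def second (n n' : ℤ) (h : n + 2 = n') (w : Vertex) (q t : ℤ) (g : Option Path)
    (hg : ∀ k ∈ g, k.left = .two ∧ k.right = w ∧ t - 4 + k.len = q) :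
    (M.X n).X .two t →ₗ[ℂ] (tailShape n').Comp (V M n') w q :=
  (tailShape n').ten (V M n') w q ⟨n, 1, t, by push_cast; omega⟩ g
    (fun k hk => ⟨(hg k hk).1, (hg k hk).2.1, by have := (hg k hk).2.2; push_cast; omega⟩)

theorem second_none {n n' : ℤ} {h : n + 2 = n'} {w : Vertex} {q t : ℤ} {g : Option Path}
    (e : g = none) {hg} (m : (M.X n).X .two t) : second M n n' h w q t g hg m = 0 := by
  subst e; rfl

theorem second_cond {w : Vertex} {q t : ℤ} {g : Option Path}
    (hg : ∀ k ∈ g, k.left = .two ∧ k.right = w ∧ t - 2 + k.len = q) :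
    ∀ k ∈ g, k.left = .two ∧ k.right = w ∧ t + 2 - 4 + k.len = q :=
  fun k hk => ⟨(hg k hk).1, (hg k hk).2.1, by have := (hg k hk).2.2; omega⟩

theorem second_cond' {w : Vertex} {q t : ℤ} {g : Option Path}
    (hg : ∀ k ∈ g, k.left = .two ∧ k.right = w ∧ t - 2 + k.len = q) :
    ∀ k ∈ g.bind (fun k => Path.c.mul k),
      k.left = .two ∧ k.right = w ∧ t - 4 + k.len = q := by
  cases g with
  | none => simp
  | some g =>
    intro k (hk : k ∈ Path.c.mul g)
    obtain ⟨-, h2, h3⟩ := hg g rfl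
    rw [Path.left_mul hk, Path.right_mul hk, Path.len_mul hk]
    exact ⟨rfl, h2, by dsimp [Path.len] at *; omega⟩

theorem dTail_first {n n'' : ℤ} {h' : n + 1 + 1 = n''} {w : Vertex} {q t : ℤ}
    {g : Option Path} {hg} (m : (M.X n).X .two t) :
    (dTail M (n + 1) n'' h').f w q (first M n (n + 1) rfl w q t g hg m) =
      first M (n + 1) n'' h' w q t g hg ((M.d n (n + 1)).f .two t m) +
      ((n.negOnePow : ℤ) •
          second M n n'' (by omega) w q (t + 2) g (second_cond hg) ((M.X n).c t (t + 2) rfl m) -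
        (n.negOnePow : ℤ) •
          second M n n'' (by omega) w q t (g.bind fun k => Path.c.mul k) (second_cond' hg) m) := by
  simp only [dTail, GrB.add_f, LinearMap.add_apply, first]
  rw [Shape.map_ten, Shape.map_ten, Shape.lmul_ten]
  refine congrArg₂ (· + ·) rfl ?_
  rw [sub_eq_add_neg]
  refine congrArg₂ (· + ·) ?_ ?_
  · exact map_zsmul _ _ _
  · rw [← neg_smul, ← map_zsmul]
    refine congrArg _ ?_
    change ((n.negOnePow : ℤ) * (-1) ^ (0 + 1)) • m = _
    rw [zero_add, pow_one, mul_neg_one]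

theorem cancel_one {A : Type} [AddCommGroup A] (ε : ℤ) (x : A) {y : A} (hy : y = 0) :
    -ε • x + ε • (x + -(ε • y)) = 0 := by
  subst hy; simp

theorem cancel_two {A : Type} [AddCommGroup A] (ε : ℤ) (x x' : A) {y y' z : A} (h : y = y')
    (hz : z = 0) : -ε • (x + x') + ε • (x + -(ε • y) + (x' + (ε • y' - ε • z))) = 0 := by
  subst h; subst hz
  simp only [smul_zero, sub_zero, smul_add, neg_smul, smul_neg]
  abel

theorem d_alpha (n n' n'' : ℤ) (h : n + 1 = n') (h' : n' + 1 = n'') :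
    M.d n n' ≫ alpha M n' n'' h' + alpha M n n' h ≫ dTail M n' n'' h' = 0 := by
  subst h
  refine GrB.hom_ext fun w q m => ?_
  cases w
  · change alphaAux M (n + 1) n'' h' .one q ((M.d n (n + 1)).f .one q m) +
      (dTail M (n + 1) n'' h').f .one q (alphaAux M n (n + 1) rfl .one q m) = 0
    have e : (M.X n).c (q + 1) (q + 1 + 2) rfl ((M.X n).b q (q + 1) rfl m) = 0 := by
      have := (M.X n).ba q (q + 1) (q + 1 + 1) rfl rfl m
      simp [GrB.c, this]
    rw [alphaAux_one, alphaAux_one, map_zsmul, dTail_first, e, map_zero, smul_zero, zero_sub,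
      ← GrB.Hom.comm_b, negOnePow_add_one]
    exact cancel_one _ _ (second_none M rfl _)
  · change alphaAux M (n + 1) n'' h' .two q ((M.d n (n + 1)).f .two q m) +
      (dTail M (n + 1) n'' h').f .two q (alphaAux M n (n + 1) rfl .two q m) = 0
    rw [alphaAux_two, alphaAux_two, map_zsmul, map_add, dTail_first, dTail_first, GrB.c_c,
      map_zero, smul_zero, zero_sub, ← GrB.comm_c, negOnePow_add_one]
    exact cancel_two _ _ _ rfl (second_none M rfl _)

/-- The degree `n` part `X^n ⊕ ⨁_{i + (k+1) = n} X^i ⊗_B θ⟨-1-2k⟩` of the total complex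
of `X ⊗_B ℂ𝕂`. -/
noncomputable abbrev X (n : ℤ) : GrB := (M.X n).prod ((tailShape n).mod (V M n))

/-- The total complex of `X ⊗_B ℂ𝕂`, where `ℂ𝕂` is the complex of bimodules
`B → θ⟨-1⟩ → θ⟨-3⟩ → θ⟨-5⟩ → ⋯` with differentials `α, β, γ, β, γ, …` and with `B` in degree `0`.
The differential is `x ⊗ y ↦ d x ⊗ y + (-1)^i x ⊗ d y` for `x` in `X^i`. -/
noncomputable def obj : CochainComplex GrB ℤ where
  X n := X M n
  d n n' :=
    if h : n + 1 = n' then GrB.prodHom (M.d n n') (alpha M n n' h) (dTail M n n' h) else 0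
  shape n n' h := dif_neg h
  d_comp_d' n n' n'' h h' := by
    refine (congrArg₂ (· ≫ ·) (dif_pos h) (dif_pos h')).trans ?_
    change GrB.prodHom (M.d n n') (alpha M n n' h) (dTail M n n' h) ≫
      GrB.prodHom (M.d n' n'') (alpha M n' n'' h') (dTail M n' n'' h') = 0
    rw [GrB.prodHom_comp, d_alpha M n n' n'' h h', dTail_dTail M n n' n'' h h', M.d_comp_d,
      GrB.prodHom_zero]

variable {M}

/-- The map `x ⊗ g ↦ f x ⊗ g`. -/
noncomputable def mapTail {N : CochainComplex GrB ℤ} (f : M ⟶ N) (n : ℤ) :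
    (tailShape n).mod (V M n) ⟶ (tailShape n).mod (V N n) :=
  Shape.map (S := tailShape n) (T := tailShape n) (fun j => j) (fun _ => ⟨rfl, rfl⟩)
    (fun j => (f.f j.i).f .two j.t)

theorem mapTail_dTail {N : CochainComplex GrB ℤ} (f : M ⟶ N) (n n' : ℤ) (h : n + 1 = n') :
    mapTail f n ≫ dTail N n n' h = dTail M n n' h ≫ mapTail f n' := by
  have h1 : mapTail f n ≫ dM N n n' h = dM M n n' h ≫ mapTail f n' := by
    refine Shape.mod_hom_ext _ _ fun w q j g hg m => ?_
    simp only [GrB.comp_f, LinearMap.comp_apply, mapTail]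
    rw [Shape.map_ten, Shape.map_ten, Shape.map_ten, Shape.map_ten]
    exact congrArg _ (congrArg (fun χ => GrB.Hom.f χ .two j.t m) (f.comm j.i (j.i + 1)))
  have h2 : mapTail f n ≫ dL N n n' h = dL M n n' h ≫ mapTail f n' := by
    refine Shape.mod_hom_ext _ _ fun w q j g hg m => ?_
    simp only [GrB.comp_f, LinearMap.comp_apply, mapTail]
    rw [Shape.map_ten, Shape.map_ten, Shape.map_ten, Shape.map_ten]
    refine congrArg _ ?_
    change (j.i.negOnePow : ℤ) • (N.X j.i).c j.t (j.t + 2) rfl ((f.f j.i).f .two j.t m) =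
      (f.f j.i).f .two (j.t + 2) ((j.i.negOnePow : ℤ) • (M.X j.i).c j.t (j.t + 2) rfl m)
    rw [map_zsmul, GrB.comm_c]
  have h3 : mapTail f n ≫ dR N n n' h = dR M n n' h ≫ mapTail f n' := by
    refine Shape.mod_hom_ext _ _ fun w q j g hg m => ?_
    simp only [GrB.comp_f, LinearMap.comp_apply, mapTail]
    rw [Shape.map_ten, Shape.lmul_ten, Shape.lmul_ten, Shape.map_ten]
    exact congrArg _ (map_zsmul ((f.f j.i).f .two j.t) _ m).symm
  simp only [dTail, Preadditive.add_comp, Preadditive.comp_add, h1, h2, h3]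

theorem alpha_naturality {N : CochainComplex GrB ℤ} (f : M ⟶ N) (n n' : ℤ) (h : n + 1 = n') :
    f.f n ≫ alpha N n n' h = alpha M n n' h ≫ mapTail f n' := by
  have e {w : Vertex} {q t : ℤ} {g : Option Path} {hg} (m : (M.X n).X .two t) :
      (mapTail f n').f w q (first M n n' h w q t g hg m) =
        first N n n' h w q t g hg ((f.f n).f .two t m) := by
    unfold first mapTail
    rw [Shape.map_ten]
  refine GrB.hom_ext fun w q m => ?_
  cases w
  · change alphaAux N n n' h .one q ((f.f n).f .one q m) =
      (mapTail f n').f .one q (alphaAux M n n' h .one q m)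
    rw [alphaAux_one, alphaAux_one, map_zsmul, e, GrB.Hom.comm_b]
  · change alphaAux N n n' h .two q ((f.f n).f .two q m) =
      (mapTail f n').f .two q (alphaAux M n n' h .two q m)
    rw [alphaAux_two, alphaAux_two, map_zsmul, map_add, e, e, GrB.comm_c]

theorem map_comm {N : CochainComplex GrB ℤ} (f : M ⟶ N) (n n' : ℤ) (h : n + 1 = n') :
    GrB.prodHom (f.f n) 0 (mapTail f n) ≫
        GrB.prodHom (N.d n n') (alpha N n n' h) (dTail N n n' h) =
      GrB.prodHom (M.d n n') (alpha M n n' h) (dTail M n n' h) ≫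
        GrB.prodHom (f.f n') 0 (mapTail f n') := by
  rw [GrB.prodHom_comp, GrB.prodHom_comp, f.comm, alpha_naturality, mapTail_dTail,
    Limits.zero_comp, Limits.comp_zero, zero_add, add_zero]

theorem mapTail_id (n : ℤ) : mapTail (𝟙 M) n = 𝟙 _ := by
  refine Shape.mod_hom_ext _ _ fun w q j g hg m => ?_
  simp only [mapTail, GrB.id_f, LinearMap.id_apply]
  rw [Shape.map_ten]
  exact congrArg _ rfl

theorem mapTail_comp {N K : CochainComplex GrB ℤ} (f : M ⟶ N) (f' : N ⟶ K) (n : ℤ) :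
    mapTail (f ≫ f') n = mapTail f n ≫ mapTail f' n := by
  refine Shape.mod_hom_ext _ _ fun w q j g hg m => ?_
  simp only [mapTail, GrB.comp_f, LinearMap.comp_apply]
  rw [Shape.map_ten, Shape.map_ten, Shape.map_ten]; rfl

theorem map_comp {N K : CochainComplex GrB ℤ} (f : M ⟶ N) (f' : N ⟶ K) (n : ℤ) :
    GrB.prodHom (f.f n ≫ f'.f n) 0 (mapTail (f ≫ f') n) =
      GrB.prodHom (f.f n) 0 (mapTail f n) ≫ GrB.prodHom (f'.f n) 0 (mapTail f' n) := by
  rw [mapTail_comp, GrB.prodHom_comp, Limits.zero_comp, Limits.comp_zero, add_zero]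

end CK

/-- The functor `X ↦ Tot (X ⊗_B ℂ𝕂)` on complexes. -/
noncomputable def ckCpx : CochainComplex GrB ℤ ⥤ CochainComplex GrB ℤ where
  obj M := CK.obj M
  map {M N} f :=
    { f := fun n => GrB.prodHom (f.f n) 0 (CK.mapTail f n)
      comm' := fun n n' (h : n + 1 = n') => by
        have e (K : CochainComplex GrB ℤ) : (CK.obj K).d n n' =
          GrB.prodHom (K.d n n') (CK.alpha K n n' h) (CK.dTail K n n' h) := dif_pos h
        rw [e, e]
        exact CK.map_comm f n n' h }
  map_id M := HomologicalComplex.hom_ext _ _ fun n =>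
    (congrArg (GrB.prodHom (𝟙 (M.X n)) 0) (CK.mapTail_id n)).trans (GrB.prodHom_id _ _)
  map_comp f f' := HomologicalComplex.hom_ext _ _ fun n => CK.map_comp f f' n

/-! ### Derived categories

The category `𝒟` is obtained from a category of complexes by inverting the quasi-isomorphisms.
Homotopy equivalences are quasi-isomorphisms, so this is also the localization of the corresponding
homotopy category at the quasi-isomorphisms. -/

/-- Complexes `M` of finite dimensional graded right `B`-modules with `M^i_j = 0` if `i ≫ 0` or
`i + j ≪ 0`. -/
def BLt : ObjectProperty (CochainComplex GrB ℤ) := fun M =>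
  (∀ i, (M.X i).IsFinDim) ∧
    ∃ N : ℤ, ∀ v i j, (N < i ∨ i + j < -N) → Subsingleton ((M.X i).X v j)

/-- Complexes `M` of graded right `B`-modules with `M^i_j = 0` if `i ≪ 0` or `i + j ≫ 0`. -/
def BGt : ObjectProperty (CochainComplex GrB ℤ) := fun M =>
  ∃ N : ℤ, ∀ v i j, (i < -N ∨ N < i + j) → Subsingleton ((M.X i).X v j)

/-- Complexes `M` of finite dimensional graded `C`-modules with `M^i_j = 0` if `i ≫ 0` or
`i + j ≪ 0`. -/
def CLt : ObjectProperty (CochainComplex GrC ℤ) := fun M =>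
  (∀ i, (M.X i).IsFinDim) ∧
    ∃ N : ℤ, ∀ i j, (N < i ∨ i + j < -N) → Subsingleton ((M.X i).X j)

/-- Quasi-isomorphisms of complexes of graded right `B`-modules: the maps `M_j e(v) → N_j e(v)` are
quasi-isomorphisms of complexes of vector spaces for all `v` and `j`. -/
def qisB : MorphismProperty (CochainComplex GrB ℤ) := fun _ _ f =>
  ∀ v j, QuasiIso (((GrB.ev v j).mapHomologicalComplex (ComplexShape.up ℤ)).map f)

/-- Quasi-isomorphisms of complexes of graded `C`-modules. -/
def qisC : MorphismProperty (CochainComplex GrC ℤ) := fun _ _ f =>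
  ∀ j, QuasiIso (((GrC.ev j).mapHomologicalComplex (ComplexShape.up ℤ)).map f)

/-- Quasi-isomorphisms between objects of `BLt`. -/
abbrev qisBLt : MorphismProperty BLt.FullSubcategory := qisB.inverseImage BLt.ι

/-- Quasi-isomorphisms between objects of `BGt`. -/
abbrev qisBGt : MorphismProperty BGt.FullSubcategory := qisB.inverseImage BGt.ι

/-- Quasi-isomorphisms between objects of `CLt`. -/
abbrev qisCLt : MorphismProperty CLt.FullSubcategory := qisC.inverseImage CLt.ι

/-- The category `𝒟^<(gmod-B)`. -/
abbrev DLtB := qisBLt.Localization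

/-- The category `𝒟^>` of graded right `B`-modules. -/
abbrev DGtB := qisBGt.Localization

/-- The category `𝒟^<(gmod-C)`. -/
abbrev DLtC := qisCLt.Localization

/-! ### The functors on complexes with the required boundedness -/

theorem GrB.isFinDim_iotaMod {N : GrC} (hN : N.IsFinDim) : (iotaMod.obj N).IsFinDim := by
  obtain ⟨h1, n, hn⟩ := hN
  constructor
  · intro w j
    have : Finite ((tensorP2 1).Idx w j) := by
      refine Finite.of_injective (fun x => x.g) ?_
      rintro ⟨(i : ℤ), g, hi⟩ ⟨(i' : ℤ), g', hi'⟩ (rfl : g = g')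
      obtain rfl : i = i' := by
        have e : i + 1 + g.len = j := hi.2.2
        have e' : i' + 1 + g.len = j := hi'.2.2
        omega
      rfl
    have : ∀ x : (tensorP2 1).Idx w j, Module.Finite ℂ (N.X x.j) := fun x => h1 x.j
    have : Module.Finite ℂ ((tensorP2 1).Comp N.X w j) := inferInstance
    exact Module.Finite.quotient ℂ _
  · refine ⟨n + 3, fun w j hj => ?_⟩
    have : Subsingleton ((tensorP2 1).Comp N.X w j) :=
      Shape.subsingleton_comp _ _ fun ⟨(i : ℤ), g, hc⟩ => by
        have e : i + 1 + g.len = j := hc.2.2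
        have : 0 ≤ g.len ∧ g.len ≤ 2 := by cases g <;> decide
        refine hn i ?_
        rw [lt_abs] at hj ⊢
        omega
    exact (Submodule.Quotient.mk_surjective (LinearMap.range (N.rel.f w j))).subsingleton

/-- The functor `π̃` on complexes. -/
noncomputable def piCpx : BLt.FullSubcategory ⥤ CLt.FullSubcategory :=
  CLt.lift (BLt.ι ⋙ piMod.mapHomologicalComplex (ComplexShape.up ℤ)) fun M => by
    obtain ⟨h, N, hN⟩ := M.property
    refine ⟨fun i => ⟨fun j => (h i).1 .two (j + 1), ?_⟩, N + 1, fun i j hij => ?_⟩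
    · obtain ⟨n, hn⟩ := (h i).2
      refine ⟨n + 1, fun j hj => hn .two (j + 1) ?_⟩
      rw [lt_abs] at hj ⊢
      omega
    · exact hN .two i (j + 1) (by omega)

/-- The functor `ι̃` on complexes. -/
noncomputable def iotaCpx : CLt.FullSubcategory ⥤ BLt.FullSubcategory :=
  BLt.lift (CLt.ι ⋙ iotaMod.mapHomologicalComplex (ComplexShape.up ℤ)) fun M => by
    obtain ⟨h, N, hN⟩ := M.property
    refine ⟨fun i => GrB.isFinDim_iotaMod (h i), N, fun w i j hij => ?_⟩
    have : Subsingleton ((tensorP2 1).Comp (M.obj.X i).X w j) :=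
      Shape.subsingleton_comp _ _ fun x => hN i _ <| by
        have e := x.cond.2.2
        have : 0 ≤ x.g.len := by cases x.g <;> decide
        dsimp at e
        omega
    exact (Submodule.Quotient.mk_surjective
      (LinearMap.range ((M.obj.X i).rel.f w j))).subsingleton

/-- The functor `𝔻` on complexes. -/
noncomputable def koszulLt : BLt.FullSubcategory ⥤ BGt.FullSubcategory :=
  BGt.lift (BLt.ι ⋙ koszulCpx) fun M => by
    obtain ⟨-, N, hN⟩ := M.property
    refine ⟨N + 2, fun w p q hpq => Shape.subsingleton_comp _ _ fun x => hN _ _ _ ?_⟩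
    have e := x.cond.2.2
    have e' := x.j.h
    have : 0 ≤ x.g.len ∧ x.g.len ≤ 2 := by cases x.g <;> decide
    dsimp at e
    omega

/-- The functor `ℂ𝕂` on complexes. -/
noncomputable def ckGt : BGt.FullSubcategory ⥤ BGt.FullSubcategory :=
  BGt.lift (BGt.ι ⋙ ckCpx) fun M => by
    obtain ⟨N, hN⟩ := M.property
    refine ⟨N + 2, fun w n q hnq => ?_⟩
    have h1 : Subsingleton ((M.obj.X n).X w q) := hN w n q (by omega)
    have h2 : Subsingleton ((tailShape n).Comp (CK.V M.obj n) w q) :=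
      Shape.subsingleton_comp _ _ fun x => hN _ _ _ <| by
        have e := x.cond.2.2
        have e' := x.j.h
        have : 0 ≤ x.g.len ∧ x.g.len ≤ 2 := by cases x.g <;> decide
        dsimp at e
        omega
    exact inferInstanceAs
      (Subsingleton ((M.obj.X n).X w q × (tailShape n).Comp (CK.V M.obj n) w q))

/-! ### The functors on derived categories -/

/-- The functor `π̃` preserves quasi-isomorphisms. -/
theorem piCpx_inverts : qisBLt.IsInvertedBy (piCpx ⋙ qisCLt.Q) := fun _ _ _ hf =>
  Localization.inverts qisCLt.Q qisCLt _ fun j => hf .two (j + 1)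

/-- The functor `π̃ : 𝒟^<(gmod-B) ⥤ 𝒟^<(gmod-C)`. -/
noncomputable def piD : DLtB ⥤ DLtC :=
  Localization.lift (piCpx ⋙ qisCLt.Q) piCpx_inverts qisBLt.Q

/-- The left derived functor `ℒι̃ : 𝒟^<(gmod-C) ⥤ 𝒟^<(gmod-B)`. -/
noncomputable def LiotaD (h : (iotaCpx ⋙ qisBLt.Q).HasLeftDerivedFunctor qisCLt) : DLtC ⥤ DLtB :=
  (iotaCpx ⋙ qisBLt.Q).totalLeftDerived qisCLt.Q qisCLt

/-- The Lie theoretic projector `ℙ = ℒι̃ ∘ π̃`. -/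
noncomputable def projectorD (h : (iotaCpx ⋙ qisBLt.Q).HasLeftDerivedFunctor qisCLt) :
    DLtB ⥤ DLtB :=
  piD ⋙ LiotaD h

/-- The Koszul duality functor `𝔻`, induced by the functor on complexes. -/
noncomputable def koszulD (h : qisBLt.IsInvertedBy (koszulLt ⋙ qisBGt.Q)) : DLtB ⥤ DGtB :=
  Localization.lift (koszulLt ⋙ qisBGt.Q) h qisBLt.Q

/-- The Cooper–Krushkal projector `ℂ𝕂`, induced by the functor on complexes. -/
noncomputable def ckD (h : qisBGt.IsInvertedBy (ckGt ⋙ qisBGt.Q)) : DGtB ⥤ DGtB :=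
  Localization.lift (ckGt ⋙ qisBGt.Q) h qisBGt.Q

end JW

/-! Write `K N` for `resCpx N`, the complex with terms N ⊗_ℂ P(2)⟨2k+1⟩ that resolves N ⊗_C P(2)⟨1⟩.
It computes the left derived functor of ι̃. The augmentation `Res.rho : π̃(K N) ⟶ N` is a
quasi-isomorphism for every N, the modules of π̃(K N) are free over C, and on complexes of free
modules `K` and ι̃ agree up to quasi-isomorphism (`Res.qisB_alpha`). The general criterion
`isLeftDerivedFunctor_of_resolution` then identifies ℒι̃ with the functor `resD` induced by `K`, so
that ℙ M is represented by K(π̃ M).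

The counit `eps : K(π̃ M) ⟶ M` and the projection `ckEta : ℂ𝕂 X ⟶ X`, induced by the projection of
ℂ𝕂 onto its term B, give a zigzag 𝔻(K(π̃ M)) ⟵ ℂ𝕂(𝔻(K(π̃ M))) ⟶ ℂ𝕂(𝔻 M) which is natural in M. Both
arrows are quasi-isomorphisms, for different reasons.

Left arrow: its kernel is built from copies of X e(2), where X = 𝔻(K N), so it suffices that X e(2)
is acyclic (`qisB_ckEta`). For any Y, (𝔻 Y) e(2) is the total complex of Y e(1) → Y e(2) → Y e(1),
the maps being multiplication by b and a. For Y = K N this sequence is short exact, because P(2) has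
the basis e(2), a, c (`acyc_koszulCpx_resCpx_two`).

Right arrow: ℂ𝕂 ∘ 𝔻 sees M only through π̃ M (`qisB_ckCpx_map_koszulCpx_map`). The e(2)-part of ℂ𝕂 X
is acyclic for every X bounded below (`CK.acyc_two`). In ℂ𝕂(𝔻 M) e(1) most summands cancel in pairs,
and the rest is a complex made of copies of π̃ M with the action of x (`CKD.coneExact_pMap`). Since
π̃(`eps`) is the augmentation `Res.rho` of π̃ M, it is a quasi-isomorphism, and hence so is the
right arrow.

Quasi-isomorphisms are tested on elements of the mapping cone (`ConeExact`). Filtered complexes are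
compared column by column (`Columns.coneExact`); this also shows that 𝔻 and ℂ𝕂 preserve
quasi-isomorphisms. -/

namespace JW

/-! ### Quasi-isomorphisms in terms of elements -/

section Elements

variable {K L : CochainComplex (ModuleCat.{0} ℂ) ℤ}

theorem exists_cycle {i j : ℤ} (h : i + 1 = j) (x : K.X i) (hx : K.d i j x = 0) :
    ∃ c : K.cycles i, K.iCycles i c = x := by
  have hn : (ComplexShape.up ℤ).next i = j := (ComplexShape.up ℤ).next_eq' h
  subst hn
  refine ⟨(K.sc i).moduleCatCyclesIso.inv ⟨x, hx⟩, ?_⟩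
  exact (K.sc i).moduleCatCyclesIso_inv_iCycles_apply ⟨x, hx⟩

theorem iCycles_injective (i : ℤ) : Function.Injective (K.iCycles i) :=
  (ModuleCat.mono_iff_injective _).1 inferInstance

theorem d_iCycles (i j : ℤ) (c : K.cycles i) : K.d i j (K.iCycles i c) = 0 := by
  rw [← ConcreteCategory.comp_apply, K.iCycles_d]; rfl

theorem homologyπ_eq_zero_iff {i j : ℤ} (h : i + 1 = j) (c : K.cycles j) :
    K.homologyπ j c = 0 ↔ ∃ y : K.X i, K.d i j y = K.iCycles j c := by
  have hp : (ComplexShape.up ℤ).prev j = i := (ComplexShape.up ℤ).prev_eq' h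
  have hS : (ShortComplex.mk (K.toCycles i j) (K.homologyπ j) (K.toCycles_comp_homologyπ i j)).Exact :=
    ShortComplex.exact_of_g_is_cokernel _ (K.homologyIsCokernel i j hp)
  constructor
  · intro hc
    obtain ⟨y, hy⟩ := (ShortComplex.moduleCat_exact_iff _).1 hS c hc
    refine ⟨y, ?_⟩
    rw [← hy, ← K.toCycles_i i j]; rfl
  · rintro ⟨y, hy⟩
    obtain rfl : K.toCycles i j y = c := iCycles_injective j (by
      rw [← hy, ← ConcreteCategory.comp_apply, K.toCycles_i])
    rw [← ConcreteCategory.comp_apply, K.toCycles_comp_homologyπ]; rfl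

theorem homologyπ_surjective (i : ℤ) : Function.Surjective (K.homologyπ i) :=
  (ModuleCat.epi_iff_surjective _).1 inferInstance

theorem homologyMap_homologyπ (f : K ⟶ L) (i : ℤ) (c : K.cycles i) :
    HomologicalComplex.homologyMap f i (K.homologyπ i c) =
      L.homologyπ i (HomologicalComplex.cyclesMap f i c) := by
  rw [← ConcreteCategory.comp_apply, ← ConcreteCategory.comp_apply,
    HomologicalComplex.homologyπ_naturality]

theorem iCycles_cyclesMap (f : K ⟶ L) (i : ℤ) (c : K.cycles i) :
    L.iCycles i (HomologicalComplex.cyclesMap f i c) = f.f i (K.iCycles i c) := by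
  rw [← ConcreteCategory.comp_apply, ← ConcreteCategory.comp_apply,
    HomologicalComplex.cyclesMap_i]

theorem Hom.comm_apply (f : K ⟶ L) (i j : ℤ) (x : K.X i) :
    f.f j (K.d i j x) = L.d i j (f.f i x) := by
  rw [← ConcreteCategory.comp_apply, ← ConcreteCategory.comp_apply, f.comm]

theorem d_d_apply (K : CochainComplex (ModuleCat.{0} ℂ) ℤ) (i j k : ℤ) (x : K.X i) :
    K.d j k (K.d i j x) = 0 := by
  rw [← ConcreteCategory.comp_apply, K.d_comp_d]; rfl

/-- The mapping cone of `f` is exact. -/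
def ConeExact (f : K ⟶ L) : Prop :=
  ∀ (i j k l : ℤ), i + 1 = j → j + 1 = k → k + 1 = l → ∀ (x : K.X k) (y : L.X j),
    K.d k l x = 0 → f.f k x = L.d j k y →
      ∃ (x' : K.X j) (y' : L.X i), K.d j k x' = x ∧ f.f j x' = y + L.d i j y'

/-- A map is a quasi-isomorphism exactly when its cone is acyclic. In elements, injectivity on
cohomology is the first half of the conclusion of `ConeExact`, and surjectivity is the case x = 0.
-/
theorem quasiIso_iff_coneExact (f : K ⟶ L) : QuasiIso f ↔ ConeExact f := by
  constructor
  · intro hf i j k l hij hjk hkl x y hx hxy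
    have bij (n : ℤ) : Function.Bijective (HomologicalComplex.homologyMap f n) :=
      (ConcreteCategory.isIso_iff_bijective _).1 inferInstance
    obtain ⟨c, rfl⟩ := exists_cycle hkl x hx
    have h0 : K.homologyπ k c = 0 := (bij k).1 (by
      rw [homologyMap_homologyπ, map_zero, homologyπ_eq_zero_iff hjk, iCycles_cyclesMap]
      exact ⟨y, hxy.symm⟩)
    obtain ⟨x1, hx1⟩ := (homologyπ_eq_zero_iff hjk c).1 h0
    -- The primitive x1 of x need not map to y modulo boundaries. The difference is a cycle, whose
    -- class lifts to K, and x1 is corrected by a lift.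
    obtain ⟨e, he⟩ := exists_cycle (K := L) hjk (f.f j x1 - y) (by
      rw [map_sub, ← Hom.comm_apply, hx1, hxy, sub_self])
    obtain ⟨z, hz⟩ := (bij j).2 (L.homologyπ j e)
    obtain ⟨c2, rfl⟩ := homologyπ_surjective j z
    rw [homologyMap_homologyπ, ← sub_eq_zero, ← map_sub, homologyπ_eq_zero_iff hij] at hz
    obtain ⟨y', hy'⟩ := hz
    rw [map_sub, iCycles_cyclesMap, he] at hy'
    refine ⟨x1 - K.iCycles j c2, -y', ?_, ?_⟩
    · rw [map_sub, hx1, d_iCycles, sub_zero]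
    · rw [map_sub, map_neg, hy']; abel
  · intro h
    rw [quasiIso_iff]
    intro n
    rw [quasiIsoAt_iff_isIso_homologyMap, ConcreteCategory.isIso_iff_bijective]
    constructor
    · rw [injective_iff_map_eq_zero]
      intro z hz
      obtain ⟨c, rfl⟩ := homologyπ_surjective n z
      rw [homologyMap_homologyπ, homologyπ_eq_zero_iff (sub_add_cancel n 1),
        iCycles_cyclesMap] at hz
      obtain ⟨y, hy⟩ := hz
      obtain ⟨x', -, hx', -⟩ := h (n - 1 - 1) (n - 1) n (n + 1) (by ring) (by ring) rfl
        (K.iCycles n c) y (d_iCycles _ _ _) hy.symm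
      exact (homologyπ_eq_zero_iff (sub_add_cancel n 1) c).2 ⟨x', hx'⟩
    · intro z
      obtain ⟨e, rfl⟩ := homologyπ_surjective n z
      obtain ⟨x', y', hx', hy'⟩ := h (n - 1) n (n + 1) (n + 1 + 1) (by ring) rfl rfl 0
        (L.iCycles n e) (map_zero _) (by rw [map_zero, d_iCycles])
      obtain ⟨c, rfl⟩ := exists_cycle rfl x' hx'
      refine ⟨K.homologyπ n c, ?_⟩
      rw [homologyMap_homologyπ, ← sub_eq_zero, ← map_sub,
        homologyπ_eq_zero_iff (sub_add_cancel n 1)]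
      exact ⟨y', by rw [map_sub, iCycles_cyclesMap, hy']; abel⟩

/-- `K` has no cohomology. -/
def Acyc (K : CochainComplex (ModuleCat.{0} ℂ) ℤ) : Prop :=
  ∀ (i j k : ℤ), i + 1 = j → j + 1 = k → ∀ x : K.X j, K.d j k x = 0 → ∃ y : K.X i, K.d i j y = x

theorem ConeExact.of_acyc (f : K ⟶ L) (hK : Acyc K) (hL : Acyc L) : ConeExact f := by
  intro i j k l hij hjk hkl x y hx hxy
  obtain ⟨x', rfl⟩ := hK j k l hjk hkl x hx
  obtain ⟨y', hy'⟩ := hL i j k hij hjk (f.f j x' - y) (by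
    rw [map_sub, ← hxy, Hom.comm_apply, sub_self])
  exact ⟨x', y', rfl, by rw [hy']; abel⟩

theorem ConeExact.of_bijective (f : K ⟶ L) (h : ∀ i, Function.Bijective (f.f i)) :
    ConeExact f := by
  intro i j k l hij hjk hkl x y hx hxy
  obtain ⟨x', hx'⟩ := (h j).2 y
  refine ⟨x', 0, (h k).1 ?_, ?_⟩
  · rw [Hom.comm_apply, hx', hxy]
  · rw [map_zero, add_zero, hx']

end Elements

/-! ### Filtered complexes -/

/-- The complex `n ↦ K^(n+m)`. -/
def reindex (K : CochainComplex (ModuleCat.{0} ℂ) ℤ) (m : ℤ) :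
    CochainComplex (ModuleCat.{0} ℂ) ℤ where
  X n := K.X (n + m)
  d n n' := K.d (n + m) (n' + m)
  shape n n' h := K.shape _ _ fun (h' : n + m + 1 = n' + m) => h (by
    change n + 1 = n'
    omega)
  d_comp_d' _ _ _ _ _ := K.d_comp_d _ _ _

/-- The map between reindexed complexes. -/
def reindexMap {K L : CochainComplex (ModuleCat.{0} ℂ) ℤ} (f : K ⟶ L) (m : ℤ) :
    reindex K m ⟶ reindex L m where
  f n := f.f (n + m)
  comm' _ _ _ := f.comm _ _

theorem ConeExact.reindexMap {K L : CochainComplex (ModuleCat.{0} ℂ) ℤ} {f : K ⟶ L}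
    (h : ConeExact f) (m : ℤ) : ConeExact (reindexMap f m) :=
  fun i j k l hij hjk hkl => h (i + m) (j + m) (k + m) (l + m) (by omega) (by omega) (by omega)

/-- A filtration of a complex `K` with subquotients `A γ`, given by coordinates `pr γ`. -/
structure Columns (K : CochainComplex (ModuleCat.{0} ℂ) ℤ) {Γ : Type} (wt : Γ → ℤ)
    (A : Γ → CochainComplex (ModuleCat.{0} ℂ) ℤ) where
  pr : ∀ n γ, K.X n →ₗ[ℂ] (A γ).X n
  exists_pr : ∀ n γ (a : (A γ).X n), ∃ x, pr n γ x = a ∧ ∀ γ' ≠ γ, pr n γ' x = 0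
  -- The part of the differential that leaves a column may only raise the weight, so the elements
  -- without coordinates below a given weight form a subcomplex.
  lead : ∀ n n' γ (x : K.X n), n + 1 = n' → (∀ γ', wt γ' < wt γ → pr n γ' x = 0) →
    pr n' γ (K.d n n' x) = (A γ).d n n' (pr n γ x)
  ext : ∀ n (x : K.X n), (∀ γ, pr n γ x = 0) → x = 0
  bounded : ∀ n, ∃ p q : ℤ, ∀ γ, (wt γ < p ∨ q ≤ wt γ) → Subsingleton ((A γ).X n)

namespace Columns

variable {K L : CochainComplex (ModuleCat.{0} ℂ) ℤ} {Γ : Type} {wt : Γ → ℤ}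
  {A B : Γ → CochainComplex (ModuleCat.{0} ℂ) ℤ}

theorem lead_lt (cK : Columns K wt A) {n n' : ℤ} (h : n + 1 = n') {p : ℤ} {x : K.X n}
    (hx : ∀ γ, wt γ < p → cK.pr n γ x = 0) {γ : Γ} (hγ : wt γ < p) :
    cK.pr n' γ (K.d n n' x) = 0 := by
  rw [cK.lead n n' γ x h fun γ' h' => hx γ' (h'.trans hγ), hx γ hγ, map_zero]

/-- Successive approximation replaces the spectral sequence argument. A solution on one column
corrects the lowest nonzero coordinate of the error, the corrections never disturb lower weights,
and in each degree only finitely many weights occur. -/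
theorem coneExact (cK : Columns K wt A) (cL : Columns L wt B) (hwt : Function.Injective wt)
    (f : K ⟶ L) (φ : ∀ γ, A γ ⟶ B γ) (hφ : ∀ γ, ConeExact (φ γ))
    (comm : ∀ n γ x, cL.pr n γ (f.f n x) = (φ γ).f n (cK.pr n γ x)) : ConeExact f := by
  intro i j k l hij hjk hkl x y hx hxy
  obtain ⟨p1, q1, h1⟩ := cK.bounded k
  obtain ⟨p2, q2, h2⟩ := cL.bounded j
  -- After m steps the errors in both equations vanish in all weights below the common lower bound
  -- plus m.
  have key : ∀ m : ℕ, ∃ (x' : K.X j) (y' : L.X i),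
      (∀ γ, wt γ < min p1 p2 + m → cK.pr k γ (x - K.d j k x') = 0) ∧
      (∀ γ, wt γ < min p1 p2 + m → cL.pr j γ (f.f j x' - y - L.d i j y') = 0) := by
    intro m
    induction m with
    | zero =>
      refine ⟨0, 0, fun γ hγ => ?_, fun γ hγ => ?_⟩
      · exact (h1 γ (Or.inl (by rw [Nat.cast_zero, add_zero, lt_min_iff] at hγ; exact hγ.1))).elim _ _
      · exact (h2 γ (Or.inl (by rw [Nat.cast_zero, add_zero, lt_min_iff] at hγ; exact hγ.2))).elim _ _
    | succ m ih =>
      obtain ⟨x', y', hx', hy'⟩ := ih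
      set p := min p1 p2 + (m : ℤ) with hp
      have hlt {γ : Γ} (h : wt γ < min p1 p2 + (m + 1 : ℕ)) : wt γ < p ∨ wt γ = p := by
        push_cast at h; omega
      by_cases hγ : ∃ γ, wt γ = p
      · obtain ⟨γ, hγ⟩ := hγ
        set u := x - K.d j k x' with hu
        set v := f.f j x' - y - L.d i j y' with hv
        have du : K.d k l u = 0 := by rw [hu, map_sub, hx, d_d_apply, sub_zero]
        have dv : L.d j k v = -f.f k u := by
          rw [hv, hu, map_sub, map_sub, map_sub, d_d_apply, hxy, Hom.comm_apply]; abel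
        -- The error (u, -v) is again a cycle of the cone, and by `lead` its lowest coordinates form
        -- a cycle of the cone of `φ γ`.
        obtain ⟨a, b, ha, hb⟩ := hφ γ i j k l hij hjk hkl (cK.pr k γ u) (-cL.pr j γ v) (by
            rw [← cK.lead k l γ u hkl fun γ' h => hx' γ' (hγ ▸ h), du, map_zero]) (by
            rw [map_neg, ← cL.lead j k γ v hjk fun γ' h => hy' γ' (hγ ▸ h), dv, ← comm, map_neg,
              neg_neg])
        obtain ⟨x1, hx1, hx1'⟩ := cK.exists_pr j γ a
        obtain ⟨y1, hy1, hy1'⟩ := cL.exists_pr i γ b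
        have hx1'' : ∀ γ', wt γ' < wt γ → cK.pr j γ' x1 = 0 :=
          fun γ' h => hx1' γ' (by rintro rfl; exact h.ne rfl)
        have hy1'' : ∀ γ', wt γ' < wt γ → cL.pr i γ' y1 = 0 :=
          fun γ' h => hy1' γ' (by rintro rfl; exact h.ne rfl)
        have ex : x - K.d j k (x' + x1) = u - K.d j k x1 := by rw [map_add, hu]; abel
        have ey : f.f j (x' + x1) - y - L.d i j (y' + y1) = v + f.f j x1 - L.d i j y1 := by
          rw [map_add, map_add, hv]; abel
        refine ⟨x' + x1, y' + y1, fun γ' h => ?_, fun γ' h => ?_⟩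
        · rw [ex, map_sub]
          rcases hlt h with h | h
          · rw [hx' γ' h, cK.lead_lt hjk hx1'' (hγ ▸ h), sub_zero]
          · obtain rfl : γ' = γ := hwt (h.trans hγ.symm)
            rw [cK.lead j k _ x1 hjk hx1'', hx1, ha, sub_self]
        · rw [ey, map_sub, map_add, comm]
          rcases hlt h with h | h
          · rw [hy' γ' h, hx1'' γ' (hγ ▸ h), map_zero, cL.lead_lt hij hy1'' (hγ ▸ h), add_zero,
              sub_zero]
          · obtain rfl : γ' = γ := hwt (h.trans hγ.symm)
            rw [cL.lead i j _ y1 hij hy1'', hy1, hx1, hb]; abel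
      -- No column has weight p, so nothing has to be corrected.
      · refine ⟨x', y', fun γ h => hx' γ ?_, fun γ h => hy' γ ?_⟩
        · exact (hlt h).resolve_right fun h' => hγ ⟨γ, h'⟩
        · exact (hlt h).resolve_right fun h' => hγ ⟨γ, h'⟩
  -- After this many steps the errors vanish below both upper bounds, and above them the columns are
  -- zero.
  obtain ⟨x', y', hx', hy'⟩ := key (max q1 q2 - min p1 p2).toNat
  have hle : max q1 q2 ≤ min p1 p2 + ((max q1 q2 - min p1 p2).toNat : ℤ) := by
    have := Int.self_le_toNat (max q1 q2 - min p1 p2)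
    linarith
  refine ⟨x', y', ?_, ?_⟩
  · refine (sub_eq_zero.1 (cK.ext k _ fun γ => ?_)).symm
    by_cases h : wt γ < min p1 p2 + ((max q1 q2 - min p1 p2).toNat : ℤ)
    · exact hx' γ h
    · exact (h1 γ (Or.inr ((le_max_left _ _).trans (hle.trans (not_lt.1 h))))).elim _ _
  · have : f.f j x' - y - L.d i j y' = 0 := cL.ext j _ fun γ => by
      by_cases h : wt γ < min p1 p2 + ((max q1 q2 - min p1 p2).toNat : ℤ)
      · exact hy' γ h
      · exact (h2 γ (Or.inr ((le_max_right _ _).trans (hle.trans (not_lt.1 h))))).elim _ _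
    rw [sub_sub, sub_eq_zero] at this
    exact this

end Columns

end JW

namespace JW

/-! ### Derived functors from functorial resolutions -/

section Derived

variable {C D H : Type*} [Category* C] [Category* D] [Category* H] {F : C ⥤ H} {L : C ⥤ D}
  {W : MorphismProperty C} [L.IsLocalization W] {LF : D ⥤ H} (α : L ⋙ LF ⟶ F) {R : C ⥤ C}
  (ρ : R ⟶ 𝟭 C)

/-- The natural transformation `G ⟶ LF` induced by `L ⋙ G ⟶ F`. -/
noncomputable def resolutionLift (hρ : ∀ X, W (ρ.app X)) (hα : ∀ X, IsIso (α.app (R.obj X)))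
    {G : D ⥤ H} (β : L ⋙ G ⟶ F) : G ⟶ LF :=
  Localization.liftNatTrans L W (L ⋙ G) (L ⋙ LF) G LF
    -- Go back along ρ to the resolution, where α can be inverted, and return along ρ.
    { app := fun X => G.map (Localization.isoOfHom L W (ρ.app X) (hρ X)).inv ≫
        β.app (R.obj X) ≫ inv (α.app (R.obj X)) ≫ LF.map (L.map (ρ.app X))
      naturality := fun X Y f => by
        have h1 : G.map (L.map f) ≫ G.map (Localization.isoOfHom L W (ρ.app Y) (hρ Y)).inv =
            G.map (Localization.isoOfHom L W (ρ.app X) (hρ X)).inv ≫ G.map (L.map (R.map f)) := by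
          rw [← G.map_comp, ← G.map_comp]
          congr 1
          rw [Iso.comp_inv_eq, Category.assoc, Iso.eq_inv_comp, Localization.isoOfHom_hom,
            Localization.isoOfHom_hom, ← L.map_comp, ← L.map_comp]
          exact congrArg L.map (ρ.naturality f).symm
        have h2 := β.naturality (R.map f)
        have h3 : F.map (R.map f) ≫ inv (α.app (R.obj Y)) =
            inv (α.app (R.obj X)) ≫ LF.map (L.map (R.map f)) := by
          rw [IsIso.comp_inv_eq, Category.assoc, IsIso.eq_inv_comp]
          exact (α.naturality (R.map f)).symm
        have h4 : LF.map (L.map (R.map f)) ≫ LF.map (L.map (ρ.app Y)) =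
            LF.map (L.map (ρ.app X)) ≫ LF.map (L.map f) := by
          rw [← LF.map_comp, ← L.map_comp, ← LF.map_comp, ← L.map_comp]
          exact congrArg (fun g => LF.map (L.map g)) (ρ.naturality f)
        dsimp only [Functor.comp_map] at h2 ⊢
        rw [reassoc_of% h1, reassoc_of% h2, reassoc_of% h3, h4]
        simp only [Category.assoc] }

theorem resolutionLift_app (hρ : ∀ X, W (ρ.app X)) (hα : ∀ X, IsIso (α.app (R.obj X)))
    {G : D ⥤ H} (β : L ⋙ G ⟶ F) (X : C) :
    (resolutionLift α ρ hρ hα β).app (L.obj X) =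
      G.map (Localization.isoOfHom L W (ρ.app X) (hρ X)).inv ≫
        β.app (R.obj X) ≫ inv (α.app (R.obj X)) ≫ LF.map (L.map (ρ.app X)) := by
  rw [resolutionLift, Localization.liftNatTrans_app]
  simp [Localization.Lifting.iso]

theorem resolutionLift_fac (hρ : ∀ X, W (ρ.app X)) (hα : ∀ X, IsIso (α.app (R.obj X)))
    {G : D ⥤ H} (β : L ⋙ G ⟶ F) (X : C) :
    (resolutionLift α ρ hρ hα β).app (L.obj X) ≫ α.app X = β.app X := by
  rw [resolutionLift_app]
  have h1 : LF.map (L.map (ρ.app X)) ≫ α.app X = α.app (R.obj X) ≫ F.map (ρ.app X) :=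
    α.naturality (ρ.app X)
  have h2 : G.map (L.map (ρ.app X)) ≫ β.app X = β.app (R.obj X) ≫ F.map (ρ.app X) :=
    β.naturality (ρ.app X)
  have h3 : G.map (Localization.isoOfHom L W (ρ.app X) (hρ X)).inv ≫ G.map (L.map (ρ.app X)) =
      𝟙 _ := by
    rw [← G.map_comp, Localization.isoOfHom_inv_hom_id]; exact G.map_id _
  simp only [Category.assoc]
  refine (congrArg (fun g => _ ≫ _ ≫ inv (α.app (R.obj X)) ≫ g) h1).trans ?_
  rw [IsIso.inv_hom_id_assoc, ← h2]
  exact (reassoc_of% h3) (β.app X)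

/-- This is the uniqueness half of the universal property: naturality along ρ reduces γ to its
values on resolutions, and there α can be cancelled. -/
theorem eq_resolutionLift_app (hρ : ∀ X, W (ρ.app X)) (hα : ∀ X, IsIso (α.app (R.obj X)))
    {G : D ⥤ H} (β : L ⋙ G ⟶ F) (γ : G ⟶ LF) (hγ : ∀ X, γ.app (L.obj X) ≫ α.app X = β.app X)
    (X : C) : γ.app (L.obj X) = (resolutionLift α ρ hρ hα β).app (L.obj X) := by
  rw [resolutionLift_app, ← hγ, Category.assoc, IsIso.hom_inv_id_assoc]
  have h3 : G.map (Localization.isoOfHom L W (ρ.app X) (hρ X)).inv ≫ G.map (L.map (ρ.app X)) =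
      𝟙 _ := by
    rw [← G.map_comp, Localization.isoOfHom_inv_hom_id]; exact G.map_id _
  refine Eq.trans ?_ (congrArg (fun g => _ ≫ g) (γ.naturality (L.map (ρ.app X))))
  exact ((reassoc_of% h3) (γ.app (L.obj X))).symm

/-- If `α : L ⋙ LF ⟶ F` is an isomorphism on functorial resolutions, then `LF` is the left derived
functor of `F`. -/
theorem isLeftDerivedFunctor_of_resolution (hρ : ∀ X, W (ρ.app X))
    (hα : ∀ X, IsIso (α.app (R.obj X))) : LF.IsLeftDerivedFunctor α W where
  isRightKanExtension := ⟨⟨Limits.IsTerminal.ofUniqueHom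
    (fun Y => CostructuredArrow.homMk (resolutionLift α ρ hρ hα Y.hom)
      (NatTrans.ext (funext fun X => resolutionLift_fac α ρ hρ hα Y.hom X)))
    (fun Y m => CostructuredArrow.hom_ext _ _ (Localization.natTrans_ext L W fun X =>
      eq_resolutionLift_app α ρ hρ hα Y.hom m.left
        (fun X => NatTrans.congr_app (CostructuredArrow.w m) X) X))⟩⟩

end Derived

end JW

namespace JW

/-! ### The resolution `N ⊗_ℂ P(2)⟨1⟩ ← N ⊗_ℂ P(2)⟨3⟩ ← ⋯` of `N ⊗_C P(2)⟨1⟩` -/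

/-- Indices of the vector spaces `N^i_t` with `i - k = n` and `t + 2k = d`. -/
structure KI (n d : ℤ) where
  k : ℕ
  i : ℤ
  t : ℤ
  hi : i = n + k
  ht : t + 2 * k = d

/-- The numbers i and t are determined by k. Keeping them as fields with equations avoids transport
along equalities of degrees in most formulas. -/
theorem KI.ext' {n d : ℤ} {y y' : KI n d} (h : y.k = y'.k) : y = y' := by
  obtain ⟨k, i, t, hi, ht⟩ := y
  obtain ⟨k', i', t', hi', ht'⟩ := y'
  obtain rfl : k = k' := h
  obtain rfl : i = i' := hi.trans hi'.symm
  obtain rfl : t = t' := by omega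
  rfl

namespace KX

variable (N : CochainComplex GrC ℤ)

/-- The vector space `∏_k N^(n+k)_(d-2k)`. -/
abbrev _root_.JW.KX (n d : ℤ) : Type := ∀ y : KI n d, (N.X y.i).X y.t

/-- The identification of `∏_k N^(n+k)_(d-2k)` for equal `d`. -/
def cast (n : ℤ) {d d' : ℤ} (h : d = d') : KX N n d →ₗ[ℂ] KX N n d' where
  toFun u y := u ⟨y.k, y.i, y.t, y.hi, y.ht.trans h.symm⟩
  map_add' _ _ := rfl
  map_smul' _ _ := rfl

/-- The differential `u ↦ d u + ε (-1)^i u x`, where `x` lowers `k` by one. -/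
def D (ε : ℤˣ) (n n' d : ℤ) (h : n + 1 = n') : KX N n d →ₗ[ℂ] KX N n' d where
  toFun u y := (N.d (y.i - 1) y.i).f y.t
        (u ⟨y.k, y.i - 1, y.t, by have := y.hi; omega, y.ht⟩) +
      ((ε * y.i.negOnePow : ℤˣ) : ℤ) • (N.X y.i).x (y.t - 2) y.t (by omega)
        (u ⟨y.k + 1, y.i, y.t - 2, by have := y.hi; push_cast; omega,
          by have := y.ht; push_cast; omega⟩)
  map_add' u v := by
    funext y
    simp only [Pi.add_apply, map_add, smul_add]
    abel
  map_smul' r u := by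
    funext y
    simp only [Pi.smul_apply, map_smul, smul_add, RingHom.id_apply]
    rw [smul_comm]

/-- The map which lowers `k` by one. -/
def S (n n' d d' : ℤ) (h : n + 1 = n') (hd : d' + 2 = d) : KX N n d →ₗ[ℂ] KX N n' d' where
  toFun u y := (n.negOnePow : ℤ) • u ⟨y.k + 1, y.i, y.t, by have := y.hi; push_cast; omega,
    by have := y.ht; push_cast; omega⟩
  map_add' u v := funext fun y => smul_add _ _ _
  map_smul' r u := funext fun y => smul_comm _ _ _

variable {N}

theorem d_apply_congr {n d : ℤ} (u : KX N n d) {k : ℕ} {i i' j t : ℤ} (h : i = i')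
    {hi ht hi' ht'} :
    (N.d i j).f t (u ⟨k, i, t, hi, ht⟩) = (N.d i' j).f t (u ⟨k, i', t, hi', ht'⟩) := by
  subst h; rfl

theorem x_apply_congr {n d : ℤ} (u : KX N n d) {k : ℕ} {i t t' s : ℤ} (h : t = t')
    {hi ht hi' ht' hs hs'} :
    (N.X i).x t s hs (u ⟨k, i, t, hi, ht⟩) = (N.X i).x t' s hs' (u ⟨k, i, t', hi', ht'⟩) := by
  subst h; rfl

theorem d_d_zero (i j k t : ℤ) (m : (N.X i).X t) : (N.d j k).f t ((N.d i j).f t m) = 0 :=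
  congrArg (fun χ => GrC.Hom.f χ t m) (N.d_comp_d i j k)

theorem negOnePow_sub_one (i : ℤ) : ((i - 1).negOnePow : ℤˣ) = -i.negOnePow := by
  rw [Int.negOnePow_sub, Int.negOnePow_one, mul_neg, mul_one]

/-- Besides d² = 0 and x² = 0, the mixed terms cancel because d raises i by one and so changes the
sign (-1)^i. The constant ε plays no part: it is 1 for the resolution, while ℂ𝕂(𝔻 M) produces
strands with ε = (-1)^(q+1). -/
theorem D_D (ε : ℤˣ) (n n' n'' d : ℤ) (h : n + 1 = n') (h' : n' + 1 = n'') (u : KX N n d) :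
    D N ε n' n'' d h' (D N ε n n' d h u) = 0 := by
  funext y
  dsimp only [D, LinearMap.coe_mk, AddHom.coe_mk, Pi.zero_apply]
  rw [map_add, map_add, map_zsmul, map_zsmul, GrC.Hom.comm, d_d_zero, GrC.xx, smul_zero, add_zero,
    zero_add, negOnePow_sub_one, mul_neg, Units.val_neg, neg_smul, neg_add_cancel]

/-- The sign of `S` is (-1)^n and not (-1)^i, which makes `S` anticommute with `D`. As i = n + k + 1
in the component that is moved, the relative sign is (-1)^(k+1): this is the alternation of n x ⊗ p
± n ⊗ x p in the periodic resolution over C. -/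
theorem S_D (n n' n'' d d' : ℤ) (h : n + 1 = n') (h' : n' + 1 = n'') (hd : d' + 2 = d)
    (u : KX N n d) :
    D N 1 n' n'' d' h' (S N n n' d d' h hd u) + S N n' n'' d d' h' hd (D N 1 n n' d h u) = 0 := by
  funext y
  dsimp only [D, S, LinearMap.coe_mk, AddHom.coe_mk, Pi.zero_apply, Pi.add_apply]
  have e : (n'.negOnePow : ℤ) = -(n.negOnePow : ℤ) := by rw [← h, negOnePow_add_one]
  rw [map_zsmul, map_zsmul, e, smul_add, neg_smul, neg_smul, smul_comm]
  abel

/-- The complex `∏_k N^(n+k)_(d-2k)` with differential `u ↦ d u + ε (-1)^i u x`. -/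
noncomputable def strand (N : CochainComplex GrC ℤ) (ε : ℤˣ) (d : ℤ) :
    CochainComplex (ModuleCat.{0} ℂ) ℤ where
  X n := ModuleCat.of ℂ (KX N n d)
  d n n' := if h : n + 1 = n' then ModuleCat.ofHom (D N ε n n' d h) else 0
  shape n n' h := dif_neg h
  d_comp_d' n n' n'' h h' := by
    refine (congrArg₂ (· ≫ ·) (dif_pos h) (dif_pos h')).trans ?_
    exact ModuleCat.hom_ext (LinearMap.ext fun u => D_D ε n n' n'' d h h' u)

theorem strand_d (ε : ℤˣ) {n n' d : ℤ} (h : n + 1 = n') (u : KX N n d) :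
    (strand N ε d).d n n' u = D N ε n n' d h u := by
  have : (strand N ε d).d n n' = ModuleCat.ofHom (D N ε n n' d h) := dif_pos h
  rw [this]; rfl

variable {N' N'' : CochainComplex GrC ℤ}

/-- The map induced by a map of complexes. -/
def map (f : N ⟶ N') (n d : ℤ) : KX N n d →ₗ[ℂ] KX N' n d :=
  LinearMap.pi fun y => ((f.f y.i).f y.t).comp (LinearMap.proj y)

theorem map_apply (f : N ⟶ N') {n d : ℤ} (u : KX N n d) (y : KI n d) :
    map f n d u y = (f.f y.i).f y.t (u y) := rfl

theorem f_d_comm (f : N ⟶ N') (i j t : ℤ) (m : (N.X i).X t) :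
    (f.f j).f t ((N.d i j).f t m) = (N'.d i j).f t ((f.f i).f t m) :=
  (congrArg (fun χ => GrC.Hom.f χ t m) (f.comm i j)).symm

theorem map_D (f : N ⟶ N') (ε : ℤˣ) (n n' d : ℤ) (h : n + 1 = n') (u : KX N n d) :
    map f n' d (D N ε n n' d h u) = D N' ε n n' d h (map f n d u) := by
  funext y
  dsimp only [D, LinearMap.coe_mk, AddHom.coe_mk, map_apply]
  rw [map_add, map_zsmul, f_d_comm, GrC.Hom.comm]

theorem map_S (f : N ⟶ N') (n n' d d' : ℤ) (h : n + 1 = n') (hd : d' + 2 = d) (u : KX N n d) :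
    map f n' d' (S N n n' d d' h hd u) = S N' n n' d d' h hd (map f n d u) :=
  funext fun y => map_zsmul ((f.f y.i).f y.t) _ _

/-- The map of strands induced by a map of complexes. -/
noncomputable def strandMap (f : N ⟶ N') (ε : ℤˣ) (d : ℤ) : strand N ε d ⟶ strand N' ε d where
  f n := ModuleCat.ofHom (map f n d)
  comm' n n' (h : n + 1 = n') := by
    refine ModuleCat.hom_ext (LinearMap.ext fun u => ?_)
    exact (strand_d ε h _).trans ((map_D f ε n n' d h u).symm.trans
      (congrArg (map f n' d) (strand_d ε h u).symm))

end KX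

open KX in
/-- The graded `B`-module `⨁_k N^(n+k) ⊗ P(2)⟨2k+1⟩`. The two components in `e(2)` belong to
the elements `e(2)` and `c` of `P(2)`, and the component in `e(1)` belongs to `a`. -/
noncomputable def resMod (N : CochainComplex GrC ℤ) (n : ℤ) : GrB where
  X
    -- In P(2)⟨2k+1⟩ the elements e(2), a, c have degrees 2k+1, 2k+2, 2k+3. This explains the shifts
    -- by 1, 2 and 3.
    | .one, q => ModuleCat.of ℂ (KX N n (q - 2))
    | .two, q => ModuleCat.of ℂ (KX N n (q - 1) × KX N n (q - 3))
  a i j h := (cast N n (by omega)).comp (LinearMap.fst ℂ _ _)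
  b i j h := (LinearMap.inr ℂ _ _).comp (cast N n (by omega))
  ba _ _ _ _ _ _ := rfl

namespace Res

open KX

variable (N : CochainComplex GrC ℤ)

/-- The differential of the resolution. -/
noncomputable def d (n n' : ℤ) (h : n + 1 = n') : resMod N n ⟶ resMod N n' where
  f
    | .one, q => D N 1 n n' (q - 2) h
    -- Left multiplication by c takes e(2) to c and kills a and c. So `S` occurs only here, from the
    -- first component to the second.
    | .two, q => ((D N 1 n n' (q - 1) h).comp (LinearMap.fst ℂ _ _)).prod
        ((D N 1 n n' (q - 3) h).comp (LinearMap.snd ℂ _ _) +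
          (S N n n' (q - 1) (q - 3) h (by ring)).comp (LinearMap.fst ℂ _ _))
  comm_a _ _ _ _ := rfl
  comm_b i j hij m := by
    refine Prod.ext (map_zero (D N 1 n n' (j - 1) h)) ?_
    exact (congrArg _ (map_zero (S N n n' (j - 1) (j - 3) h (by ring)))).trans (add_zero _)

theorem d_d (n n' n'' : ℤ) (h : n + 1 = n') (h' : n' + 1 = n'') :
    d N n n' h ≫ d N n' n'' h' = 0 := by
  refine GrB.hom_ext fun v q m => ?_
  cases v
  · exact D_D 1 n n' n'' (q - 2) h h' m
  · refine Prod.ext (D_D 1 n n' n'' (q - 1) h h' m.1) ?_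
    change D N 1 n' n'' (q - 3) h' (D N 1 n n' (q - 3) h m.2 +
        S N n n' (q - 1) (q - 3) h (by ring) m.1) +
      S N n' n'' (q - 1) (q - 3) h' (by ring) (D N 1 n n' (q - 1) h m.1) = 0
    rw [map_add, D_D, zero_add, S_D]

/-- The resolution of `N ⊗_C P(2)⟨1⟩`. -/
noncomputable def obj : CochainComplex GrB ℤ where
  X n := resMod N n
  d n n' := if h : n + 1 = n' then d N n n' h else 0
  shape n n' h := dif_neg h
  d_comp_d' _ _ _ h h' := (congrArg₂ (· ≫ ·) (dif_pos h) (dif_pos h')).trans (d_d N _ _ _ h h')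

theorem obj_d {n n' : ℤ} (h : n + 1 = n') : (obj N).d n n' = d N n n' h := dif_pos h

theorem obj_d_one {n n' : ℤ} (h : n + 1 = n') (q : ℤ) (u : KX N n (q - 2)) :
    ((obj N).d n n').f .one q u = D N 1 n n' (q - 2) h u :=
  congrArg (fun χ : resMod N n ⟶ resMod N n' => χ.f .one q u) (obj_d N h)

theorem obj_d_two {n n' : ℤ} (h : n + 1 = n') (q : ℤ) (u : KX N n (q - 1) × KX N n (q - 3)) :
    ((obj N).d n n').f .two q u = (D N 1 n n' (q - 1) h u.1,
      D N 1 n n' (q - 3) h u.2 + S N n n' (q - 1) (q - 3) h (by ring) u.1) :=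
  congrArg (fun χ : resMod N n ⟶ resMod N n' => χ.f .two q u) (obj_d N h)

variable {N} {N' N'' : CochainComplex GrC ℤ}

/-- The map of resolutions induced by a map of complexes. -/
noncomputable def mapMod (f : N ⟶ N') (n : ℤ) : resMod N n ⟶ resMod N' n where
  f
    | .one, q => KX.map f n (q - 2)
    | .two, q => (KX.map f n (q - 1)).prodMap (KX.map f n (q - 3))
  comm_a _ _ _ _ := rfl
  comm_b _ j _ _ := Prod.ext (map_zero (KX.map f n (j - 1))) rfl

theorem mapMod_d (f : N ⟶ N') (n n' : ℤ) (h : n + 1 = n') :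
    mapMod f n ≫ d N' n n' h = d N n n' h ≫ mapMod f n' := by
  refine GrB.hom_ext fun v q m => ?_
  cases v
  · exact (map_D f 1 n n' (q - 2) h m).symm
  · refine Prod.ext (map_D f 1 n n' (q - 1) h m.1).symm ?_
    change D N' 1 n n' (q - 3) h (KX.map f n (q - 3) m.2) +
        S N' n n' (q - 1) (q - 3) h (by ring) (KX.map f n (q - 1) m.1) =
      KX.map f n' (q - 3) (D N 1 n n' (q - 3) h m.2 + S N n n' (q - 1) (q - 3) h (by ring) m.1)
    rw [map_add, map_D, map_S]

end Res

/-- The functor `N ↦ (N ⊗_ℂ P(2)⟨1⟩ ← N ⊗_ℂ P(2)⟨3⟩ ← ⋯)` on complexes. -/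
noncomputable def resCpx : CochainComplex GrC ℤ ⥤ CochainComplex GrB ℤ where
  obj N := Res.obj N
  map {N N'} f :=
    { f := fun n => Res.mapMod f n
      comm' := fun n n' (h : n + 1 = n') => by
        rw [Res.obj_d N h, Res.obj_d N' h]
        exact Res.mapMod_d f n n' h }
  map_id N := by
    refine HomologicalComplex.hom_ext _ _ fun n => GrB.hom_ext fun v q m => ?_
    cases v <;> rfl
  map_comp f g := by
    refine HomologicalComplex.hom_ext _ _ fun n => GrB.hom_ext fun v q m => ?_
    cases v <;> rfl

end JW

/-! ### Filtration of the strands, and the augmentation of the resolution. -/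

namespace JW

/-- The complexes `(M^i)_q e(v)`. -/
abbrev evB (v : Vertex) (q : ℤ) : CochainComplex GrB ℤ ⥤ CochainComplex (ModuleCat.{0} ℂ) ℤ :=
  (GrB.ev v q).mapHomologicalComplex (ComplexShape.up ℤ)

/-- The complexes `(N^i)_q`. -/
abbrev evC (q : ℤ) : CochainComplex GrC ℤ ⥤ CochainComplex (ModuleCat.{0} ℂ) ℤ :=
  (GrC.ev q).mapHomologicalComplex (ComplexShape.up ℤ)

/-- The functor `π̃` on all complexes. -/
abbrev piC : CochainComplex GrB ℤ ⥤ CochainComplex GrC ℤ :=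
  piMod.mapHomologicalComplex (ComplexShape.up ℤ)

theorem qisB_iff {M M' : CochainComplex GrB ℤ} (f : M ⟶ M') :
    qisB f ↔ ∀ v q, ConeExact ((evB v q).map f) :=
  forall_congr' fun _ => forall_congr' fun _ => quasiIso_iff_coneExact _

theorem qisC_iff {N N' : CochainComplex GrC ℤ} (f : N ⟶ N') :
    qisC f ↔ ∀ q, ConeExact ((evC q).map f) :=
  forall_congr' fun _ => quasiIso_iff_coneExact _

namespace KX

variable {N N' : CochainComplex GrC ℤ}

/-- Transport of elements of `N^i_t`. -/
def tr {i i' t t' : ℤ} (hi : i = i') (ht : t = t') (m : (N.X i).X t) : (N.X i').X t' :=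
  hi ▸ ht ▸ m

theorem d_tr {i i' j t t' : ℤ} (hi : i = i') (ht : t = t') (m : (N.X i).X t) :
    (N.d i' j).f t' (tr hi ht m) = tr rfl ht ((N.d i j).f t m) := by
  subst hi; subst ht; rfl

theorem apply_eq_zero {n d : ℤ} (u : KX N n d) {y y' : KI n d} (h : y.k = y'.k) (hu : u y = 0) :
    u y' = 0 := by
  obtain rfl := KI.ext' h
  exact hu

/-- The columns of a strand. -/
abbrev col (N : CochainComplex GrC ℤ) (d : ℤ) (k : ℕ) : CochainComplex (ModuleCat.{0} ℂ) ℤ :=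
  reindex ((evC (d - 2 * k)).obj N) k

open Classical in
/-- The filtration of a strand by `k`. -/
noncomputable def columns (N : CochainComplex GrC ℤ) {b : ℤ}
    (hb : ∀ i j, b < i → Subsingleton ((N.X i).X j)) (ε : ℤˣ) (d : ℤ) :
    Columns (strand N ε d) (fun k : ℕ => -(k : ℤ)) (col N d) where
  -- The action of x lowers k and hence raises the weight -k, so only d survives on the
  -- subquotients.
  pr n k := LinearMap.proj (⟨k, n + k, d - 2 * k, rfl, by ring⟩ : KI n d)
  exists_pr n k a := by
    refine ⟨Pi.single (⟨k, n + k, d - 2 * k, rfl, by ring⟩ : KI n d) a, ?_, fun k' h => ?_⟩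
    · exact Pi.single_eq_same (M := fun y : KI n d => (N.X y.i).X y.t) _ _
    · exact Pi.single_eq_of_ne (M := fun y : KI n d => (N.X y.i).X y.t)
        (fun e => h (congrArg KI.k e)) _
  lead n n' k u h hu := by
    have h0 := hu (k + 1) (by push_cast; omega)
    change KX N n d at u
    refine (congrFun (strand_d ε h u) ⟨k, n' + k, d - 2 * k, rfl, by ring⟩).trans ?_
    dsimp only [D, LinearMap.coe_mk, AddHom.coe_mk]
    have e : u ⟨k + 1, n' + k, d - 2 * k - 2, by push_cast; omega, by push_cast; ring⟩ = 0 :=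
      apply_eq_zero u
        (y := ⟨k + 1, n + (k + 1 : ℕ), d - 2 * (k + 1 : ℕ), rfl, by ring⟩) rfl h0
    rw [e, map_zero, smul_zero, add_zero]
    exact d_apply_congr u (by omega)
  ext n u hu := funext fun y => 
    apply_eq_zero (N := N) u (y := ⟨y.k, n + y.k, d - 2 * y.k, rfl, by ring⟩) rfl (hu y.k)
  bounded n := by
    -- Only k with n + k ≤ b contribute; this is where boundedness above enters.
    refine ⟨n - b, 1, fun k hk => hb _ _ ?_⟩
    omega

theorem coneExact_strandMap {f : N ⟶ N'} (hf : qisC f) {b : ℤ}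
    (hb : ∀ i j, b < i → Subsingleton ((N.X i).X j))
    (hb' : ∀ i j, b < i → Subsingleton ((N'.X i).X j)) (ε : ℤˣ) (d : ℤ) :
    ConeExact (strandMap f ε d) :=
  (columns N hb ε d).coneExact (columns N' hb' ε d) (fun k k' h => by simpa using h) _
    (fun k => reindexMap ((evC (d - 2 * k)).map f) k)
    (fun k => ((qisC_iff f).1 hf _).reindexMap _) fun n k x => rfl

end KX

/-! ### The augmentation `π̃ (resCpx N) ⟶ N` -/

namespace Res

open KX

variable (N : CochainComplex GrC ℤ)

/-- The augmentation `n ⊗ p ↦ n p` in degree `q`. -/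
def rhoAux (n q : ℤ) : (KX N n (q + 1 - 1) × KX N n (q + 1 - 3)) →ₗ[ℂ] (N.X n).X q where
  toFun u := u.1 ⟨0, n, q, by simp, by simp⟩ +
      (N.X n).x (q - 2) q (by ring) (u.2 ⟨0, n, q - 2, by simp, by push_cast; ring⟩)
  map_add' u v := by
    simp only [Prod.fst_add, Prod.snd_add, Pi.add_apply, map_add]
    abel
  map_smul' r u := by
    simp only [Prod.smul_fst, Prod.smul_snd, Pi.smul_apply, map_smul, smul_add, RingHom.id_apply]

theorem rhoAux_apply {n q : ℤ} (u : KX N n (q + 1 - 1) × KX N n (q + 1 - 3)) :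
    rhoAux N n q u = u.1 ⟨0, n, q, by simp, by simp⟩ +
      (N.X n).x (q - 2) q (by ring) (u.2 ⟨0, n, q - 2, by simp, by push_cast; ring⟩) := rfl

/-- The augmentation `n ⊗ p ↦ n p` of the resolution of `N`. -/
noncomputable def rhoMod (n : ℤ) : piMod.obj (resMod N n) ⟶ N.X n where
  f q := rhoAux N n q
  comm i j h m := by
    change KX N n (i + 1 - 1) × KX N n (i + 1 - 3) at m
    refine (zero_add _).trans ?_
    refine Eq.trans ?_ (map_add ((N.X n).x i j h) _ _).symm
    rw [GrC.xx, add_zero]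
    exact x_apply_congr m.1 (by omega)

/-- The component with k = 1 reaches k = 0 twice, as n x ⊗ e(2) through `D` and as n ⊗ c through
`S`. Both have the image n x in N and they carry opposite signs. -/
theorem rhoAux_d {n n' : ℤ} (h : n + 1 = n') (q : ℤ)
    (m : KX N n (q + 1 - 1) × KX N n (q + 1 - 3)) :
    (N.d n n').f q (rhoAux N n q m) = rhoAux N n' q (D N 1 n n' (q + 1 - 1) h m.1,
      D N 1 n n' (q + 1 - 3) h m.2 + S N n n' (q + 1 - 1) (q + 1 - 3) h (by ring) m.1) := by
  rw [rhoAux_apply, rhoAux_apply]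
  dsimp only [D, S, LinearMap.coe_mk, AddHom.coe_mk, Pi.add_apply]
  have e : ((1 * n'.negOnePow : ℤˣ) : ℤ) = -(n.negOnePow : ℤ) := by
    rw [one_mul, ← h, negOnePow_add_one]
  simp only [map_add, map_zsmul, e, GrC.xx, smul_zero, add_zero, GrC.Hom.comm]
  rw [d_apply_congr (i := n' - 1) (i' := n) (hi' := by simp) (ht' := by simp) m.1 (by omega),
    d_apply_congr (i := n' - 1) (i' := n) (hi' := by simp) (ht' := by push_cast; ring) m.2
      (by omega), neg_smul]
  abel

/-- The augmentation of the resolution of `N` as a map of complexes. -/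
noncomputable def rho : piC.obj (resCpx.obj N) ⟶ N where
  f n := rhoMod N n
  comm' n n' (h : n + 1 = n') := GrC.hom_ext fun q m =>
    (rhoAux_d N h q m).trans (congrArg (rhoAux N n' q) (obj_d_two N h (q + 1) m).symm)

/-- On e(2), `S` identifies the e(2)-component for k + 1 with the c-component for k. After
cancelling these pairs only the e(2)-component for k = 0 is left, which is N itself. Neither
freeness nor boundedness of N is needed. -/
theorem coneExact_rho (q : ℤ) : ConeExact ((evC q).map (rho N)) := by
  intro n0 n1 n2 n3 h0 h1 h2 x y hx hxy
  change KX N n2 (q + 1 - 1) × KX N n2 (q + 1 - 3) at x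
  change (N.X n1).X q at y
  have hx' := (obj_d_two N h2 (q + 1) x).symm.trans hx
  have hy' : rhoAux N n2 q x = (N.d n1 n2).f q y := hxy
  rw [rhoAux_apply] at hy'
  -- The component v_0 = y is dictated by ρ, and v_(k+1) by the requirement that `S v` be the c-part
  -- of x. The c-part of the primitive is taken to be zero.
  let v : KX N n1 (q + 1 - 1) := fun y' =>
    match y' with
    | ⟨0, i, t, hi, ht⟩ => tr (by simpa using hi.symm) (by simp at ht; exact ht.symm) y
    | ⟨k + 1, i, t, hi, ht⟩ => (n1.negOnePow : ℤ) •
        x.2 ⟨k, i, t, by push_cast at hi; omega, by push_cast at ht; omega⟩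
  have hsq : (n1.negOnePow : ℤ) * n1.negOnePow = 1 := by
    rw [← Units.val_mul, Int.units_mul_self, Units.val_one]
  have e2 : (n2.negOnePow : ℤ) = -(n1.negOnePow : ℤ) := by rw [← h1, negOnePow_add_one]
  refine ⟨(v, 0), 0, ?_, ?_⟩
  · refine (obj_d_two N h1 (q + 1) (v, 0)).trans ?_
    refine Prod.ext (funext fun y' => ?_) (funext fun y' => ?_)
    · obtain ⟨_ | k, i, t, hi, ht⟩ := y'
      · have e1 : ((1 * i.negOnePow : ℤˣ) : ℤ) = -(n1.negOnePow : ℤ) := by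
          rw [one_mul, ← e2]; congr 2; simpa using hi
        obtain rfl : i = n2 := by simpa using hi
        obtain rfl : t = q := by simpa using ht
        change (N.d (i - 1) i).f t (tr _ rfl y) + ((1 * i.negOnePow : ℤˣ) : ℤ) •
          (N.X i).x (t - 2) t _ ((n1.negOnePow : ℤ) • x.2 ⟨0, i, t - 2, _, _⟩) = x.1 ⟨0, i, t, _, _⟩
        rw [d_tr, map_zsmul, e1, smul_smul, neg_mul, hsq, neg_one_smul]
        exact (sub_eq_add_neg _ _).symm.trans (sub_eq_iff_eq_add.2 hy'.symm)
      · change (N.d (i - 1) i).f t ((n1.negOnePow : ℤ) • x.2 ⟨k, i - 1, t, _, _⟩) +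
          ((1 * i.negOnePow : ℤˣ) : ℤ) • (N.X i).x (t - 2) t _
            ((n1.negOnePow : ℤ) • x.2 ⟨k + 1, i, t - 2, _, _⟩) = x.1 ⟨k + 1, i, t, _, _⟩
        -- For k + 1 the e(2)-part of the equation is the c-part for k of the cycle condition on x.
        -- For k = 0 it was the hypothesis ρ x = d y.
        have := congrFun (congrArg Prod.snd hx') ⟨k, i, t, by push_cast at hi; omega,
          by push_cast at ht; omega⟩
        change (N.d (i - 1) i).f t (x.2 ⟨k, i - 1, t, _, _⟩) +
          ((1 * i.negOnePow : ℤˣ) : ℤ) • (N.X i).x (t - 2) t _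
            (x.2 ⟨k + 1, i, t - 2, _, _⟩) + (n2.negOnePow : ℤ) • x.1 ⟨k + 1, i, t, _, _⟩ = 0
          at this
        rw [e2, neg_smul, add_neg_eq_zero] at this
        rw [map_zsmul, map_zsmul, smul_comm _ (n1.negOnePow : ℤ), ← smul_add, this, smul_smul, hsq,
          one_smul]
    · change D N 1 n1 n2 (q + 1 - 3) h1 0 y' + (n1.negOnePow : ℤ) • (n1.negOnePow : ℤ) •
        x.2 _ = x.2 y'
      rw [map_zero, smul_smul, hsq, one_smul]
      exact zero_add _
  · refine (congrArg (y + ·) (map_zero ((N.X n1).x (q - 2) q (by ring)))).trans ?_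
    exact congrArg (y + ·) (map_zero ((N.d n0 n1).f q)).symm

end Res

end JW

namespace JW

/-! ### Coordinates -/

namespace Shape

variable {S T : Shape} {V : S.J → ModuleCat.{0} ℂ} {W : T.J → ModuleCat.{0} ℂ}

theorem act_lof {α : Path} {v w : Vertex} {n n' : ℤ} {hw : α.right = w}
    {h : n + α.len = n'} (x : S.Idx v n) (m : V x.j) :
    S.act V α v w n n' hw h (DirectSum.lof ℂ (S.Idx v n) (fun x => V x.j) x m) =
      S.ten V w n' x.j (x.g.mul α) (S.mul_cond x.cond.1 x.cond.2.2 hw h) m :=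
  DirectSum.toModule_lof ℂ (φ := fun x : S.Idx v n =>
      S.ten V w n' x.j (x.g.mul α) (S.mul_cond x.cond.1 x.cond.2.2 hw h)) x m

theorem lof_apply_self {w : Vertex} {n : ℤ} (x : S.Idx w n) (m : V x.j) :
    DirectSum.lof ℂ (S.Idx w n) (fun x => V x.j) x m x = m :=
  DirectSum.of_eq_same (β := fun x : S.Idx w n => V x.j) x m

theorem lof_apply_ne {w : Vertex} {n : ℤ} {x x' : S.Idx w n} (h : x ≠ x') (m : V x.j) :
    DirectSum.lof ℂ (S.Idx w n) (fun x => V x.j) x m x' = 0 :=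
  DirectSum.of_eq_of_ne (β := fun x : S.Idx w n => V x.j) x x' m h.symm

/-- The coordinate `⨁_j V_j ⊗ e(side j) B ⟨deg j⟩ → V_j` at `x`. -/
def proj (V : S.J → ModuleCat.{0} ℂ) {w : Vertex} {n : ℤ} (x : S.Idx w n) :
    S.Comp V w n →ₗ[ℂ] V x.j :=
  DirectSum.component ℂ (S.Idx w n) (fun x => V x.j) x

theorem proj_lof_self {w : Vertex} {n : ℤ} (x : S.Idx w n) (m : V x.j) :
    proj V x (DirectSum.lof ℂ (S.Idx w n) (fun x => V x.j) x m) = m := lof_apply_self x m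

theorem proj_lof_ne {w : Vertex} {n : ℤ} {x x' : S.Idx w n} (h : x ≠ x') (m : V x.j) :
    proj V x' (DirectSum.lof ℂ (S.Idx w n) (fun x => V x.j) x m) = 0 := lof_apply_ne h m

theorem ext_proj {w : Vertex} {n : ℤ} {z z' : S.Comp V w n} (h : ∀ x, proj V x z = proj V x z') :
    z = z' :=
  DFinsupp.ext h

/-- By `inj` only one summand of the source reaches the given summand of the target, so the
coordinate is a single term and not a sum. Left multiplication by a path is injective on the paths
it does not kill, so the condition is easy to check in practice. -/
theorem proj_lmulAux {τ : S.J → T.J} {u : S.J → Path} {hu} {φ : ∀ j, V j →ₗ[ℂ] W (τ j)}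
    {w : Vertex} {n : ℤ} (x : S.Idx w n) (k : Path) (hk : (u x.j).mul x.g = some k) {hc}
    (inj : ∀ x' : S.Idx w n, τ x'.j = τ x.j → (u x'.j).mul x'.g = some k → x' = x)
    (z : S.Comp V w n) :
    proj W ⟨τ x.j, k, hc⟩ (lmulAux τ u hu φ w n z) = φ x.j (proj V x z) := by
  suffices H : (proj W ⟨τ x.j, k, hc⟩).comp (lmulAux τ u hu φ w n) = (φ x.j).comp (proj V x) from
    LinearMap.congr_fun H z
  refine DirectSum.linearMap_ext _ fun x' => LinearMap.ext fun m => ?_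
  change proj W ⟨τ x.j, k, hc⟩ (lmulAux τ u hu φ w n
    (DirectSum.lof ℂ (S.Idx w n) (fun x => V x.j) x' m)) =
    φ x.j (proj V x (DirectSum.lof ℂ (S.Idx w n) (fun x => V x.j) x' m))
  rw [lof_eq_ten, lmulAux_ten, ← lof_eq_ten]
  by_cases h : x' = x
  · subst h
    rw [proj_lof_self, T.ten_congr W (g := (some x'.g).bind fun k => (u x'.j).mul k)
      (g' := some k) hk (hg' := by rintro _ ⟨⟩; exact hc)]
    exact proj_lof_self (V := W) ⟨τ x'.j, k, hc⟩ _
  · rw [proj_lof_ne h, map_zero]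
    rcases hg : (u x'.j).mul x'.g with _ | k'
    · rw [T.ten_none W (g := (some x'.g).bind fun k => (u x'.j).mul k) hg, map_zero]
    · rw [T.ten_congr W (g := (some x'.g).bind fun k => (u x'.j).mul k)
        (g' := some k') hg (hg' := by
        rintro _ ⟨⟩; exact lmul_cond (hu x'.j) (g := some x'.g)
          (by rintro _ ⟨⟩; exact x'.cond) k' hg)]
      refine proj_lof_ne (V := W) (fun e => h ?_) _
      have e1 : τ x'.j = τ x.j := congrArg Idx.j e
      have e2 : k' = k := congrArg Idx.g e
      exact inj x' e1 (e2 ▸ hg)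

theorem proj_lmulAux_eq_zero {τ : S.J → T.J} {u : S.J → Path} {hu}
    {φ : ∀ j, V j →ₗ[ℂ] W (τ j)} {w : Vertex} {n : ℤ} (y : T.Idx w n)
    (hy : ∀ x' : S.Idx w n, τ x'.j = y.j → (u x'.j).mul x'.g = some y.g → False)
    (z : S.Comp V w n) : proj W y (lmulAux τ u hu φ w n z) = 0 := by
  suffices H : (proj W y).comp (lmulAux τ u hu φ w n) = 0 from LinearMap.congr_fun H z
  refine DirectSum.linearMap_ext _ fun x' => LinearMap.ext fun m => ?_
  change proj W y (lmulAux τ u hu φ w n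
    (DirectSum.lof ℂ (S.Idx w n) (fun x => V x.j) x' m)) = 0
  rw [lof_eq_ten, lmulAux_ten]
  rcases hg : (u x'.j).mul x'.g with _ | k'
  · rw [T.ten_none W (g := (some x'.g).bind fun k => (u x'.j).mul k) hg, map_zero]
  · rw [T.ten_congr W (g := (some x'.g).bind fun k => (u x'.j).mul k)
      (g' := some k') hg (hg' := by
      rintro _ ⟨⟩; exact lmul_cond (hu x'.j) (g := some x'.g)
        (by rintro _ ⟨⟩; exact x'.cond) k' hg)]
    refine proj_lof_ne (V := W) (fun e => ?_) _
    subst e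
    exact hy x' rfl hg

theorem map_f_apply {τ : S.J → T.J} {hτ} {φ : ∀ j, V j →ₗ[ℂ] W (τ j)} {w : Vertex} {n : ℤ}
    (z : S.Comp V w n) : (map τ hτ φ).f w n z =
      lmulAux τ (fun j => .idem (S.side j)) (fun j => by simpa using hτ j) φ w n z := rfl

theorem proj_map {τ : S.J → T.J} {hτ} {φ : ∀ j, V j →ₗ[ℂ] W (τ j)} {w : Vertex} {n : ℤ}
    (hinj : Function.Injective τ) (x : S.Idx w n) {hc} (z : S.Comp V w n) :
    proj W ⟨τ x.j, x.g, hc⟩ ((map τ hτ φ).f w n z) = φ x.j (proj V x z) := by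
  rw [map_f_apply]
  refine proj_lmulAux (τ := τ) x x.g ?_ (fun x' h h' => ?_) z
  · rw [← x.cond.1, Path.idem_mul]
  · rw [← x'.cond.1, Path.idem_mul] at h'
    obtain ⟨j, g, hx⟩ := x
    obtain ⟨j', g', hx'⟩ := x'
    obtain rfl : j' = j := hinj h
    obtain rfl : g' = g := by simpa using h'
    rfl

theorem proj_map_eq_zero {τ : S.J → T.J} {hτ} {φ : ∀ j, V j →ₗ[ℂ] W (τ j)} {w : Vertex} {n : ℤ}
    (y : T.Idx w n) (hy : ∀ j, τ j ≠ y.j) (z : S.Comp V w n) :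
    proj W y ((map τ hτ φ).f w n z) = 0 := by
  rw [map_f_apply]
  exact proj_lmulAux_eq_zero y (fun x' h _ => hy _ h) z

/-- Elements with given coordinates exist if almost all coordinate spaces vanish. -/
theorem exists_proj {w : Vertex} {n : ℤ} (s : Set (S.Idx w n)) (hs : s.Finite)
    (h : ∀ x ∉ s, Subsingleton (V x.j)) (f : ∀ x : S.Idx w n, V x.j) :
    ∃ z : S.Comp V w n, ∀ x, proj V x z = f x := by
  let z : S.Comp V w n := DFinsupp.mk hs.toFinset fun x => f x.1
  refine ⟨z, fun x => ?_⟩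
  by_cases hx : x ∈ s
  · have e : z x = if H : x ∈ hs.toFinset then f x else 0 := DFinsupp.mk_apply
    exact e.trans (dif_pos (hs.mem_toFinset.2 hx))
  · exact (h x hx).elim _ _

end Shape

end JW

namespace JW

/-! ### The tensor product `N ⊗_C P(2)⟨1⟩` -/

namespace Iota

open Shape

variable (P : GrC)

theorem c_mul {g k : Path} (h : Path.c.mul g = some k) : g = .e2 ∧ k = .c := by
  cases g <;> cases h
  exact ⟨rfl, rfl⟩

theorem idx_ext {d : ℤ} {w : Vertex} {q : ℤ} {x x' : (tensorP2 d).Idx w q} (h : x.g = x'.g) :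
    x = x' := by
  obtain ⟨(j : ℤ), g, hx⟩ := x
  obtain ⟨(j' : ℤ), g', hx'⟩ := x'
  obtain rfl : g = g' := h
  have e : j + d + g.len = q := hx.2.2
  have e' : j' + d + g.len = q := hx'.2.2
  obtain rfl : j = j' := by omega
  rfl

/-- The map `n ↦ n ⊗ g` to `N ⊗_C P(2)⟨1⟩`. -/
noncomputable def nu {w : Vertex} {q : ℤ} (x : (tensorP2 1).Idx w q) :
    P.X x.j →ₗ[ℂ] (iotaMod.obj P).X w q :=
  (Submodule.mkQ (LinearMap.range (P.rel.f w q))).comp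
    (DirectSum.lof ℂ ((tensorP2 1).Idx w q) (fun x => P.X x.j) x)

/-- The index of elements `n ⊗ e(2)`. -/
abbrev xe (i q : ℤ) (h : i + 1 = q) : (tensorP2 1).Idx .two q :=
  ⟨i, .e2, rfl, rfl, by dsimp [Path.len]; omega⟩

/-- The index of elements `n ⊗ c`. -/
abbrev xc (i q : ℤ) (h : i + 3 = q) : (tensorP2 1).Idx .two q :=
  ⟨i, .c, rfl, rfl, by dsimp [Path.len]; omega⟩

/-- The index of elements `n ⊗ a`. -/
abbrev xa (i q : ℤ) (h : i + 2 = q) : (tensorP2 1).Idx .one q :=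
  ⟨i, .a, rfl, rfl, by dsimp [Path.len]; omega⟩

variable {P}

theorem a_nu_e {i q q' : ℤ} (h : i + 1 = q) (hq : q + 1 = q') (m : P.X i) :
    (iotaMod.obj P).a q q' hq (nu P (xe i q h) m) = nu P (xa i q' (by omega)) m :=
  congrArg (Submodule.mkQ (LinearMap.range (P.rel.f .one q')))
    (act_lof (S := tensorP2 1) (V := P.X) (hw := Path.right_a) (h := Path.add_len_a hq)
      (xe i q h) m)

theorem a_nu_c {i q q' : ℤ} (h : i + 3 = q) (hq : q + 1 = q') (m : P.X i) :
    (iotaMod.obj P).a q q' hq (nu P (xc i q h) m) = 0 :=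
  (congrArg (Submodule.mkQ (LinearMap.range (P.rel.f .one q')))
    (act_lof (S := tensorP2 1) (V := P.X) (hw := Path.right_a) (h := Path.add_len_a hq)
      (xc i q h) m)).trans (map_zero (Submodule.mkQ (LinearMap.range (P.rel.f .one q'))))

theorem b_nu_a {i q q' : ℤ} (h : i + 2 = q) (hq : q + 1 = q') (m : P.X i) :
    (iotaMod.obj P).b q q' hq (nu P (xa i q h) m) = nu P (xc i q' (by omega)) m :=
  congrArg (Submodule.mkQ (LinearMap.range (P.rel.f .two q')))
    (act_lof (S := tensorP2 1) (V := P.X) (hw := Path.right_b) (h := Path.add_len_b hq)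
      (xa i q h) m)

theorem rel_f_apply (w : Vertex) (q : ℤ) (z : (tensorP2 3).Comp P.X w q) :
    P.rel.f w q z = (Shape.map (S := tensorP2 3) (T := tensorP2 1) (fun i => i + 2)
      (fun i => ⟨rfl, by dsimp; omega⟩) (fun i => P.x i (i + 2) rfl)).f w q z -
    lmulAux (S := tensorP2 3) (T := tensorP2 1) (fun i => i) (fun _ => .c)
      (fun i => ⟨rfl, rfl, by dsimp [Path.len]; omega⟩) (fun _ => LinearMap.id) w q z := rfl

theorem nu_x {i j q : ℤ} (h : i + 2 = j) (hj : j + 1 = q) (m : P.X i) :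
    nu P (xe j q hj) (P.x i j h m) = nu P (xc i q (by omega)) m := by
  subst h
  rw [← sub_eq_zero]
  refine (map_sub (Submodule.mkQ (LinearMap.range (P.rel.f .two q))) _ _).symm.trans ?_
  refine (Submodule.Quotient.mk_eq_zero _).2 ⟨(tensorP2 3).ten P.X .two q i (some .e2)
    (by rintro _ ⟨⟩; exact ⟨rfl, rfl, by dsimp [Path.len]; omega⟩) m, ?_⟩
  rw [rel_f_apply, map_ten, lmulAux_ten]
  rfl

/-- In the tensor product n x ⊗ a = n ⊗ c a, and c a = 0 in B because it contains b a. -/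
theorem nu_a_x {i j q : ℤ} (h : i + 2 = j) (hj : j + 2 = q) (m : P.X i) :
    nu P (xa j q hj) (P.x i j h m) = 0 := by
  subst h
  refine (Submodule.Quotient.mk_eq_zero _).2 ⟨(tensorP2 3).ten P.X .one q i (some .a)
    (by rintro _ ⟨⟩; exact ⟨rfl, rfl, by dsimp [Path.len]; omega⟩) m, ?_⟩
  rw [rel_f_apply, map_ten, lmulAux_ten]
  exact sub_zero _

theorem exists_nu_a {i q : ℤ} (h : i + 2 = q) (z : (iotaMod.obj P).X .one q) :
    ∃ m, nu P (xa i q h) m = z := by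
  obtain ⟨z, rfl⟩ := Submodule.Quotient.mk_surjective _ z
  refine ⟨proj P.X (xa i q h) z, congrArg Submodule.Quotient.mk (ext_proj fun x => ?_)⟩
  have e : x = xa i q h := idx_ext (by
    obtain ⟨j, g, h1, h2, h3⟩ := x
    cases g <;> cases h1 <;> cases h2
    rfl)
  subst e
  exact proj_lof_self (S := tensorP2 1) (V := P.X) _ _

theorem exists_nu_e {i q : ℤ} (h : i + 1 = q) (z : (iotaMod.obj P).X .two q) :
    ∃ m, nu P (xe i q h) m = z := by
  obtain ⟨z, rfl⟩ := Submodule.Quotient.mk_surjective _ z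
  -- The summand n ⊗ c is rewritten as n x ⊗ e(2).
  refine ⟨proj P.X (xe i q h) z +
    P.x (i - 2) i (by omega) (proj P.X (xc (i - 2) q (by omega)) z), ?_⟩
  rw [map_add, nu_x]
  refine (map_add (Submodule.mkQ (LinearMap.range (P.rel.f .two q))) _ _).symm.trans ?_
  refine congrArg Submodule.Quotient.mk (ext_proj fun x => ?_)
  rw [map_add]
  have e : x = xe i q h ∨ x = xc (i - 2) q (by omega) := by
    obtain ⟨j, g, h1, h2, h3⟩ := x
    cases g <;> cases h1 <;> cases h2
    · exact Or.inl (idx_ext rfl)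
    · exact Or.inr (idx_ext rfl)
  have hne : xe i q h ≠ xc (i - 2) q (by omega) := fun e => by
    have := congrArg Idx.g e
    cases this
  rcases e with rfl | rfl
  · refine (congrArg₂ (· + ·) (proj_lof_self (S := tensorP2 1) (V := P.X) (xe i q h) _)
      (proj_lof_ne (S := tensorP2 1) (V := P.X) hne.symm _)).trans (add_zero _)
  · refine (congrArg₂ (· + ·) (proj_lof_ne (S := tensorP2 1) (V := P.X) hne _)
      (proj_lof_self (S := tensorP2 1) (V := P.X) _ _)).trans (zero_add _)

/-- Since c a = 0, the relations in this part are exactly the elements n x ⊗ a. Together with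
`exists_nu_a` and `nu_a_x` this identifies (N ⊗_C P(2)⟨1⟩) e(1) with a shift of N / N x. -/
theorem nu_a_eq_zero {i q : ℤ} (h : i + 2 = q) {m : P.X i} (hm : nu P (xa i q h) m = 0) :
    ∃ (k : ℤ) (hk : k + 2 = i) (m' : P.X k), P.x k i hk m' = m := by
  obtain ⟨z, hz⟩ := (Submodule.Quotient.mk_eq_zero _).1 hm
  obtain ⟨k, rfl⟩ : ∃ k, i = k + 2 := ⟨i - 2, by omega⟩
  have hz' := congrArg (proj P.X (xa (k + 2) q h)) hz
  replace hz' := hz'.trans (proj_lof_self (S := tensorP2 1) (V := P.X) (xa (k + 2) q h) m)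
  rw [rel_f_apply, map_sub] at hz'
  let x : (tensorP2 3).Idx .one q := ⟨k, .a, rfl, rfl, by dsimp [Path.len]; omega⟩
  have h1 := proj_map (S := tensorP2 3) (T := tensorP2 1) (V := P.X) (W := P.X)
    (τ := fun i : ℤ => i + 2) (hτ := fun i => ⟨rfl, by dsimp; omega⟩)
    (φ := fun i => P.x i (i + 2) rfl) (fun i j h => by simpa using h) x
    (hc := (xa (k + 2) q h).cond) z
  have h2 := proj_lmulAux_eq_zero (S := tensorP2 3) (T := tensorP2 1) (V := P.X) (W := P.X)
    (τ := fun i : ℤ => i) (u := fun _ => .c) (hu := fun i => ⟨rfl, rfl, by dsimp [Path.len]; omega⟩)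
    (φ := fun _ => LinearMap.id) (xa (k + 2) q h) (fun x' _ h' => by cases (c_mul h').2) z
  rw [h2, sub_zero] at hz'
  exact ⟨k, rfl, _, h1.symm.trans hz'⟩

/-- Suppose m ⊗ e(2) is the relation of z, with coordinates z_e and z_c. Comparing e(2)-coordinates
gives m = z_e x, and comparing c-coordinates gives z_e = z_c x. Hence m = z_c x² = 0. -/
theorem nu_e_injective {i q : ℤ} (h : i + 1 = q) : Function.Injective (nu P (xe i q h)) := by
  rw [injective_iff_map_eq_zero]
  intro m hm
  obtain ⟨z, hz⟩ := (Submodule.Quotient.mk_eq_zero _).1 hm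
  obtain ⟨k, rfl⟩ : ∃ k, i = k + 2 := ⟨i - 2, by omega⟩
  obtain ⟨l, rfl⟩ : ∃ l, k = l + 2 := ⟨k - 2, by omega⟩
  have hne : xe (l + 2 + 2) q h ≠ xc (l + 2) q (by omega) := fun e => by
    have := congrArg Idx.g e
    cases this
  have hz1 := (congrArg (proj P.X (xe (l + 2 + 2) q h)) hz).trans
    (proj_lof_self (S := tensorP2 1) (V := P.X) (xe (l + 2 + 2) q h) m)
  have hz2 := (congrArg (proj P.X (xc (l + 2) q (by omega))) hz).trans
    (proj_lof_ne (S := tensorP2 1) (V := P.X) hne m)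
  rw [rel_f_apply, map_sub] at hz1 hz2
  let x1 : (tensorP2 3).Idx .two q := ⟨l + 2, .e2, rfl, rfl, by dsimp [Path.len]; omega⟩
  let x2 : (tensorP2 3).Idx .two q := ⟨l, .c, rfl, rfl, by dsimp [Path.len]; omega⟩
  have h1 := proj_map (S := tensorP2 3) (T := tensorP2 1) (V := P.X) (W := P.X)
    (τ := fun i : ℤ => i + 2) (hτ := fun i => ⟨rfl, by dsimp; omega⟩)
    (φ := fun i => P.x i (i + 2) rfl) (fun i j h => by simpa using h) x1
    (hc := (xe (l + 2 + 2) q h).cond) z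
  have h2 := proj_map (S := tensorP2 3) (T := tensorP2 1) (V := P.X) (W := P.X)
    (τ := fun i : ℤ => i + 2) (hτ := fun i => ⟨rfl, by dsimp; omega⟩)
    (φ := fun i => P.x i (i + 2) rfl) (fun i j h => by simpa using h) x2
    (hc := (xc (l + 2) q (by omega)).cond) z
  have h3 := proj_lmulAux_eq_zero (S := tensorP2 3) (T := tensorP2 1) (V := P.X) (W := P.X)
    (τ := fun i : ℤ => i) (u := fun _ => .c) (hu := fun i => ⟨rfl, rfl, by dsimp [Path.len]; omega⟩)
    (φ := fun _ => LinearMap.id) (xe (l + 2 + 2) q h) (fun x' _ h' => by cases (c_mul h').2) z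
  have h4 := proj_lmulAux (S := tensorP2 3) (T := tensorP2 1) (V := P.X) (W := P.X)
    (τ := fun i : ℤ => i) (u := fun _ => .c) (hu := fun i => ⟨rfl, rfl, by dsimp [Path.len]; omega⟩)
    (φ := fun _ => LinearMap.id) x1 .c rfl (hc := (xc (l + 2) q (by omega)).cond)
    (fun x' _ h' => idx_ext (c_mul h').1) z
  rw [h3, sub_zero] at hz1
  have e1 := h1.symm.trans hz1
  have e2 := sub_eq_zero.1 hz2
  have e3 := h2.symm.trans (e2.trans h4)
  change P.x (l + 2) (l + 2 + 2) rfl (proj P.X x1 z) = m at e1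
  change P.x l (l + 2) rfl (proj P.X x2 z) = proj P.X x1 z at e3
  rw [← e1, ← e3, P.xx]

theorem iotaMod_map_nu {P' : GrC} (φ : P ⟶ P') {w : Vertex} {q : ℤ}
    (x : (tensorP2 1).Idx w q) (m : P.X x.j) :
    (iotaMod.map φ).f w q (nu P x m) = nu P' x (φ.f x.j m) :=
  congrArg (Submodule.mkQ (LinearMap.range (P'.rel.f w q)))
    (map_ten (S := tensorP2 1) (T := tensorP2 1) (hτ := fun _ => ⟨rfl, rfl⟩) (g := some x.g)
      (hg := by rintro _ ⟨⟩; exact x.cond) m)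

end Iota

end JW

/-! ### Comparison of the resolution with N ⊗_C P(2)⟨1⟩. -/

namespace JW

/-- The functor `ι̃` on all complexes. -/
noncomputable abbrev iotaC : CochainComplex GrC ℤ ⥤ CochainComplex GrB ℤ :=
  iotaMod.mapHomologicalComplex (ComplexShape.up ℤ)

namespace Res

open KX Iota

variable (N : CochainComplex GrC ℤ)

theorem nu_a_congr {n d q i i' : ℤ} (u : KX N n d) (h : i = i') {hq hi ht hq' hi' ht'} :
    nu (N.X n) (xa i q hq) (u ⟨0, n, i, hi, ht⟩) =
      nu (N.X n) (xa i' q hq') (u ⟨0, n, i', hi', ht'⟩) := by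
  subst h; rfl

theorem nu_c_congr {n d q i i' : ℤ} (u : KX N n d) (h : i = i') {hq hi ht hq' hi' ht'} :
    nu (N.X n) (xc i q hq) (u ⟨0, n, i, hi, ht⟩) =
      nu (N.X n) (xc i' q hq') (u ⟨0, n, i', hi', ht'⟩) := by
  subst h; rfl

/-- The map `n ⊗ p ↦ n ⊗ p` from the resolution of `N` to `N ⊗_C P(2)⟨1⟩`. -/
noncomputable def alphaMod (n : ℤ) : resMod N n ⟶ iotaMod.obj (N.X n) where
  f
    | .one, q => (nu (N.X n) (xa (q - 2) q (by ring))).comp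
        (LinearMap.proj (⟨0, n, q - 2, by simp, by simp⟩ : KI n (q - 2)))
    | .two, q => (nu (N.X n) (xe (q - 1) q (by ring))).comp
        ((LinearMap.proj (⟨0, n, q - 1, by simp, by simp⟩ : KI n (q - 1))).comp
          (LinearMap.fst ℂ _ _)) +
        (nu (N.X n) (xc (q - 3) q (by ring))).comp
        ((LinearMap.proj (⟨0, n, q - 3, by simp, by simp⟩ : KI n (q - 3))).comp
          (LinearMap.snd ℂ _ _))
  comm_a i j h m := by
    change KX N n (i - 1) × KX N n (i - 3) at m
    refine Eq.trans ?_ (map_add ((iotaMod.obj (N.X n)).a i j h) _ _).symm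
    refine Eq.trans ?_ (congrArg₂ (· + ·) (a_nu_e (P := N.X n) (by ring) h _)
      (a_nu_c (P := N.X n) (by ring) h _)).symm
    exact (nu_a_congr N m.1 (by omega)).trans (add_zero _).symm
  comm_b i j h m := by
    change KX N n (i - 2) at m
    refine Eq.trans ?_ (b_nu_a (P := N.X n) (by ring) h _).symm
    have e : nu (N.X n) (xe (j - 1) j (by ring)) 0 = 0 := map_zero _
    refine (congrArg (fun z : (iotaMod.obj (N.X n)).X .two j => z + _) e).trans
      ((zero_add _).trans ?_)
    exact nu_c_congr N m (by omega)

theorem alphaMod_one {n q : ℤ} (u : KX N n (q - 2)) : (alphaMod N n).f .one q u =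
    nu (N.X n) (xa (q - 2) q (by ring)) (u ⟨0, n, q - 2, by simp, by simp⟩) := rfl

/-- Because n ⊗ c = n x ⊗ e(2), the comparison map factors on e(2) through the augmentation ρ. There
it is a quasi-isomorphism for every N, so freeness matters only on e(1). -/
theorem alphaMod_two {n q : ℤ} (u : KX N n (q + 1 - 1) × KX N n (q + 1 - 3)) :
    (alphaMod N n).f .two (q + 1) u = nu (N.X n) (xe q (q + 1) rfl) (rhoAux N n q u) := by
  rw [rhoAux_apply, map_add, nu_x]
  refine congrArg₂ (fun z z' : (iotaMod.obj (N.X n)).X .two (q + 1) => z + z') ?_ ?_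
  · change nu (N.X n) (xe (q + 1 - 1) (q + 1) _) (u.1 ⟨0, n, q + 1 - 1, _, _⟩) = _
    have e : q = q + 1 - 1 := by ring
    have gen (i : ℤ) (h : q = i) (hq hi ht) :
      nu (N.X n) (xe i (q + 1) hq) (u.1 ⟨0, n, i, hi, ht⟩) =
        nu (N.X n) (xe q (q + 1) rfl) (u.1 ⟨0, n, q, by simp, by simp⟩) := by subst h; rfl
    exact gen _ e _ _ _
  · exact nu_c_congr N u.2 (by ring)

theorem alphaMod_one_D {n n' q : ℤ} (h : n + 1 = n') (u : KX N n (q - 2)) :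
    (alphaMod N n').f .one q (D N 1 n n' (q - 2) h u) =
      nu (N.X n') (xa (q - 2) q (by ring)) ((N.d n n').f (q - 2)
        (u ⟨0, n, q - 2, by simp, by simp⟩)) := by
  rw [alphaMod_one]
  dsimp only [D, LinearMap.coe_mk, AddHom.coe_mk]
  -- The term from k = 1 has the form n x ⊗ a and dies in the tensor product.
  have e := nu_a_x (P := N.X n') (i := q - 2 - 2) (j := q - 2) (q := q) (by ring) (by ring)
    (u ⟨1, n', q - 2 - 2, by push_cast; omega, by push_cast; ring⟩)
  refine (map_add (nu (N.X n') (xa (q - 2) q (by ring))) _ _).trans ?_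
  refine (congrArg₂ (· + ·) ?_ ((map_zsmul _ _ _).trans
    ((congrArg _ e).trans (smul_zero _)))).trans (add_zero _)
  exact congrArg _ (d_apply_congr (hi' := by simp) (ht' := by simp) u (by omega))

theorem iotaC_d_nu {n n' : ℤ} {w : Vertex} {q : ℤ} (x : (tensorP2 1).Idx w q)
    (m : (N.X n).X x.j) :
    ((iotaC.obj N).d n n').f w q (nu (N.X n) x m) =
      nu (N.X n') x ((N.d n n').f x.j m) :=
  iotaMod_map_nu (N.d n n') x m

/-- The map `n ⊗ p ↦ n ⊗ p` from the resolution of `N` to `N ⊗_C P(2)⟨1⟩`. -/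
noncomputable def alpha : resCpx.obj N ⟶ iotaC.obj N where
  f n := alphaMod N n
  comm' n n' (h : n + 1 = n') := by
    refine GrB.hom_ext fun w q u => ?_
    cases w
    · change KX N n (q - 2) at u
      refine ((congrArg (((iotaC.obj N).d n n').f .one q) (alphaMod_one N u)).trans
        (iotaC_d_nu N _ _)).trans ?_
      refine Eq.trans ?_ (congrArg ((alphaMod N n').f .one q) (obj_d_one N h q u).symm)
      exact (alphaMod_one_D N h u).symm
    · obtain ⟨q, rfl⟩ : ∃ r, q = r + 1 := ⟨q - 1, by ring⟩
      change KX N n (q + 1 - 1) × KX N n (q + 1 - 3) at u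
      refine ((congrArg (((iotaC.obj N).d n n').f .two (q + 1)) (alphaMod_two N u)).trans
        (iotaC_d_nu N _ _)).trans ?_
      refine Eq.trans ?_ (congrArg ((alphaMod N n').f .two (q + 1))
        (obj_d_two N h (q + 1) u).symm)
      rw [alphaMod_two]
      exact congrArg (nu (N.X n') (xe q (q + 1) rfl)) (rhoAux_d N h q u)

/-- The isomorphism `N_q ≅ (N ⊗_C P(2)⟨1⟩)_(q+1) e(2)`. -/
noncomputable def nuE (q : ℤ) : (evC q).obj N ⟶ (evB .two (q + 1)).obj (iotaC.obj N) where
  f n := ModuleCat.ofHom (nu (N.X n) (xe q (q + 1) rfl))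
  comm' _ _ _ := ModuleCat.hom_ext (LinearMap.ext fun m => iotaC_d_nu N (xe q (q + 1) rfl) m)

theorem coneExact_nuE (q : ℤ) : ConeExact (nuE N q) :=
  .of_bijective _ fun _ => ⟨nu_e_injective rfl, exists_nu_e rfl⟩

theorem evB_alpha_two (q : ℤ) :
    (evB .two (q + 1)).map (alpha N) = (evC q).map (rho N) ≫ nuE N q :=
  HomologicalComplex.hom_ext _ _ fun _ => ModuleCat.hom_ext (LinearMap.ext fun u =>
    alphaMod_two N u)

theorem _root_.JW.ConeExact.comp {K L M : CochainComplex (ModuleCat.{0} ℂ) ℤ} {f : K ⟶ L}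
    {g : L ⟶ M} (hf : ConeExact f) (hg : ConeExact g) : ConeExact (f ≫ g) := by
  rw [← quasiIso_iff_coneExact] at *
  exact quasiIso_comp f g

variable {N}

theorem exists_seq {T : ℕ → Type} {R : ∀ k, T k → T (k + 1) → Prop}
    (h : ∀ k v, ∃ v', R k v v') (v : T 0) :
    ∃ f : ∀ k, T k, f 0 = v ∧ ∀ k, R k (f k) (f (k + 1)) := by
  choose g hg using h
  exact ⟨fun k => Nat.rec v g k, rfl, fun k => hg k _⟩

/-- The primitive u is built one component at a time from u_0 = m. The equation for component k asks
that x u_(k+1) be x_k - d u_k up to sign, which is solvable if x kills the right side, since ker x =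
im x by `hN`. This is the acyclicity of the periodic complex of a free C-module. -/
theorem exists_KX_of_cycle (hN : ∀ n i j h (m : (N.X n).X j), (N.X n).x j (j + 2) rfl m = 0 →
    ∃ m', (N.X n).x i j h m' = m) {j k l d : ℤ} (hjk : j + 1 = k) (hkl : k + 1 = l)
    (x : KX N k d) (hx : D N 1 k l d hkl x = 0) (m : (N.X j).X d)
    (hm : (N.X k).x d (d + 2) rfl (x ⟨0, k, d, by simp, by simp⟩ - (N.d j k).f d m) = 0) :
    ∃ u : KX N j d, D N 1 j k d hjk u = x ∧ u ⟨0, j, d, by simp, by simp⟩ = m := by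
  -- The invariant says that x annihilates x_k - d u_k, so that the next component exists. All
  -- degrees are quantified with equations so that the recursion needs no casts.
  let P (k' : ℕ) (v : ∀ i t, i = j + k' → t + 2 * k' = d → (N.X i).X t) : Prop :=
    ∀ i i' t t' (h : i = j + k') (h' : i' = k + k') (ht : t + 2 * k' = d) (htt : t + 2 = t'),
      (N.X i').x t t' htt (x ⟨k', i', t, h', ht⟩ - (N.d i i').f t (v i t h ht)) = 0
  let T (k' : ℕ) : Type := {v : ∀ i t, i = j + k' → t + 2 * k' = d → (N.X i).X t // P k' v}
  let R (k' : ℕ) (v : T k') (v' : T (k' + 1)) : Prop :=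
    ∀ i i' t (h : i = j + k') (h' : i' = k + k') (ht : t + 2 * k' = d),
      (N.d i i').f t (v.1 i t h ht) + ((1 * i'.negOnePow : ℤˣ) : ℤ) • (N.X i').x (t - 2) t (by ring)
        (v'.1 i' (t - 2) (by push_cast; omega) (by push_cast; omega)) = x ⟨k', i', t, h', ht⟩
  have step (k' : ℕ) (v : T k') : ∃ v', R k' v v' := by
    obtain ⟨v, hv⟩ := v
    obtain ⟨w, hw⟩ := hN (k + k') (d - 2 * k' - 2) (d - 2 * k') (by ring) _
      (hv (j + k') (k + k') (d - 2 * k') _ rfl rfl (by ring) rfl)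
    have hsq : ((1 * (k + k').negOnePow : ℤˣ) : ℤ) * ((1 * (k + k').negOnePow : ℤˣ) : ℤ) = 1 := by
      rw [← Units.val_mul, Int.units_mul_self, Units.val_one]
    obtain ⟨v', hv'⟩ : ∃ v' : ∀ i t, i = j + (k' + 1 : ℕ) → t + 2 * (k' + 1 : ℕ) = d → (N.X i).X t,
        ∀ hi ht, v' (k + k') (d - 2 * k' - 2) hi ht = ((1 * (k + k').negOnePow : ℤˣ) : ℤ) • w :=
      ⟨fun i t hi ht => tr (i := k + k') (t := d - 2 * k' - 2) (by push_cast at hi; omega)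
        (by push_cast at ht; omega) (((1 * (k + k').negOnePow : ℤˣ) : ℤ) • w), fun _ _ => rfl⟩
    refine ⟨⟨v', ?_⟩, ?_⟩
    · intro i i' t t' h h' ht htt
      obtain rfl : i = k + k' := by push_cast at h; omega
      obtain rfl : t = d - 2 * k' - 2 := by push_cast at ht; omega
      obtain rfl : t' = d - 2 * k' := by omega
      obtain rfl : i' = l + k' := by push_cast at h'; omega
      rw [hv']
      -- The invariant passes to k + 1: up to sign, d(x u_(k+1)) is d x_k, and by the cycle
      -- condition in component k this equals x x_(k+1) up to sign.
      have hc := congrFun hx ⟨k', l + k', d - 2 * k', rfl, by ring⟩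
      dsimp only [D, LinearMap.coe_mk, AddHom.coe_mk, Pi.zero_apply] at hc
      rw [d_apply_congr (i := l + k' - 1) (i' := k + k') (hi' := rfl) (ht' := by ring) x
        (by omega)] at hc
      have hs : ((1 * (l + k' : ℤ).negOnePow : ℤˣ) : ℤ) = -((1 * (k + k').negOnePow : ℤˣ) : ℤ) := by
        rw [one_mul, one_mul, ← negOnePow_add_one]; congr 2; omega
      rw [hs, neg_smul, add_neg_eq_zero] at hc
      rw [map_sub, map_zsmul, map_zsmul, ← GrC.Hom.comm, hw, map_sub, d_d_zero, sub_zero, hc,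
        smul_smul, hsq, one_smul, sub_self]
    · intro i i' t h h' ht
      subst h h'
      obtain rfl := eq_sub_of_add_eq ht
      change (N.d (j + k') (k + k')).f _ (v _ _ rfl ht) + ((1 * (k + k').negOnePow : ℤˣ) : ℤ) •
        (N.X (k + k')).x _ _ _ (v' _ _ _ _) = _
      rw [hv', map_zsmul, smul_smul, hsq, one_smul, hw, add_sub_cancel]
  obtain ⟨f, hf0, hf⟩ := exists_seq (T := T) (R := R) step
    ⟨fun i t hi ht => tr (by simpa using hi.symm) (by simpa using ht.symm) m, by
      intro i i' t t' h h' ht htt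
      obtain rfl : i = j := by simpa using h
      obtain rfl : i' = k := by simpa using h'
      obtain rfl : t = d := by simpa using ht
      subst htt
      exact hm⟩
  refine ⟨fun y => (f y.k).1 y.i y.t y.hi y.ht, funext fun y => ?_, ?_⟩
  · exact hf y.k (y.i - 1) y.i y.t (by have := y.hi; omega) y.hi y.ht
  · exact congrArg (fun v : T 0 => v.1 j d (by simp) (by simp)) hf0

/-- If every `N^i` is a free `C`-module, then the resolution computes `N ⊗_C P(2)⟨1⟩`. -/
theorem qisB_alpha (hN : ∀ n i j h (m : (N.X n).X j), (N.X n).x j (j + 2) rfl m = 0 →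
    ∃ m', (N.X n).x i j h m' = m) : qisB (alpha N) := by
  rw [qisB_iff]
  intro w q
  cases w
  · intro i j k l hij hjk hkl x y hx hxy
    change KX N k (q - 2) at x
    have hx' := (obj_d_one N hkl q x).symm.trans hx
    obtain ⟨m, rfl⟩ := exists_nu_a (P := N.X j) (i := q - 2) (by ring) y
    have h1 : nu (N.X k) (xa (q - 2) q (by ring)) (x ⟨0, k, q - 2, by simp, by simp⟩) =
      nu (N.X k) (xa (q - 2) q (by ring)) ((N.d j k).f (q - 2) m) := hxy.trans (iotaC_d_nu N _ _)
    rw [← sub_eq_zero, ← map_sub] at h1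
    -- The two sides agree modulo the image of x, so their difference is annihilated by x. This is
    -- the initial condition of the recursion.
    obtain ⟨t, ht, w, hw⟩ := nu_a_eq_zero _ h1
    obtain ⟨u, hu, hu0⟩ := exists_KX_of_cycle hN hjk hkl x hx' m (by rw [← hw, GrC.xx])
    refine ⟨u, 0, (obj_d_one N hjk q u).trans hu, ?_⟩
    refine (congrArg (nu (N.X j) (xa (q - 2) q (by ring))) hu0).trans ?_
    exact (add_zero _).symm.trans (congrArg _ (map_zero _).symm)
  · obtain ⟨q, rfl⟩ : ∃ r, q = r + 1 := ⟨q - 1, by ring⟩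
    rw [evB_alpha_two]
    exact (coneExact_rho N q).comp (coneExact_nuE N q)

end Res

end JW

/-! ### The left derived functor of ι̃. -/

namespace JW

namespace Res

open KX

/-- Here x sends (m₁, m₂) to (0, m₁), so kernel and image agree: each term of π̃(K N) is a sum of
copies of the free module π̃ P(2). Thus π̃(K N) is a functorial resolution of N on which the
comparison map is a quasi-isomorphism. -/
theorem exists_x_eq_of_resolution (N : CochainComplex GrC ℤ) (n i j : ℤ) (h : i + 2 = j)
    (m : ((piC.obj (resCpx.obj N)).X n).X j)
    (hm : ((piC.obj (resCpx.obj N)).X n).x j (j + 2) rfl m = 0) :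
    ∃ m', ((piC.obj (resCpx.obj N)).X n).x i j h m' = m := by
  change KX N n (j + 1 - 1) × KX N n (j + 1 - 3) at m
  refine ⟨(cast N n (by omega) m.2, 0), Prod.ext ?_ rfl⟩
  refine funext fun y => ?_
  have := congrFun (congrArg Prod.snd hm) ⟨y.k, y.i, y.t, y.hi, by have := y.ht; omega⟩
  exact this.symm

theorem alpha_naturality {N N' : CochainComplex GrC ℤ} (f : N ⟶ N') :
    resCpx.map f ≫ alpha N' = alpha N ≫ iotaC.map f := by
  refine HomologicalComplex.hom_ext _ _ fun n => GrB.hom_ext fun w q u => ?_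
  cases w
  · change KX N n (q - 2) at u
    refine Eq.trans ?_ (congrArg ((iotaMod.map (f.f n)).f .one q) (alphaMod_one N u)).symm
    exact (Iota.iotaMod_map_nu (f.f n) _ _).symm
  · obtain ⟨q, rfl⟩ : ∃ r, q = r + 1 := ⟨q - 1, by ring⟩
    change KX N n (q + 1 - 1) × KX N n (q + 1 - 3) at u
    refine Eq.trans ?_ (congrArg ((iotaMod.map (f.f n)).f .two (q + 1)) (alphaMod_two N u)).symm
    refine Eq.trans ?_ (Iota.iotaMod_map_nu (f.f n) _ _).symm
    refine (alphaMod_two N' _).trans (congrArg (Iota.nu (N'.X n) _) ?_)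
    refine Eq.trans ?_ (map_add ((f.f n).f q) _ _).symm
    exact congrArg _ ((f.f n).comm (q - 2) q (by ring) _).symm

theorem rho_naturality {N N' : CochainComplex GrC ℤ} (f : N ⟶ N') :
    piC.map (resCpx.map f) ≫ rho N' = rho N ≫ f := by
  refine HomologicalComplex.hom_ext _ _ fun n => GrC.hom_ext fun q u => ?_
  refine Eq.trans ?_ (map_add ((f.f n).f q) _ _).symm
  exact congrArg _ ((f.f n).comm (q - 2) q (by ring) _).symm

/-- On e(1) the resolution is a strand, which is filtered by N. On e(2) the augmentation ρ and the
two-out-of-three property suffice. -/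
theorem qisB_map {N N' : CochainComplex GrC ℤ} {f : N ⟶ N'} (hf : qisC f) {b : ℤ}
    (hb : ∀ i j, b < i → Subsingleton ((N.X i).X j))
    (hb' : ∀ i j, b < i → Subsingleton ((N'.X i).X j)) : qisB (resCpx.map f) := by
  intro w q
  cases w
  · rw [quasiIso_iff_coneExact]
    intro i j k l hij hjk hkl x y hx hxy
    obtain ⟨x', y', h1, h2⟩ := coneExact_strandMap hf hb hb' 1 (q - 2) i j k l hij hjk hkl x y
      ((strand_d 1 hkl x).trans ((obj_d_one N hkl q x).symm.trans hx))
      (hxy.trans ((obj_d_one N' hjk q y).trans (strand_d 1 hjk y).symm))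
    exact ⟨x', y', (obj_d_one N hjk q x').trans ((strand_d 1 hjk x').symm.trans h1),
      h2.trans (congrArg (y + ·) ((strand_d 1 hij y').trans (obj_d_one N' hij q y').symm))⟩
  · obtain ⟨q, rfl⟩ : ∃ r, q = r + 1 := ⟨q - 1, by ring⟩
    have h1 := (quasiIso_iff_coneExact _).2 (coneExact_rho N q)
    have h2 := (quasiIso_iff_coneExact _).2 (coneExact_rho N' q)
    have h3 := hf q
    have e : (evC q).map (piC.map (resCpx.map f)) ≫ (evC q).map (rho N') =
        (evC q).map (rho N) ≫ (evC q).map f := by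
      rw [← Functor.map_comp, rho_naturality, Functor.map_comp]
    have h4 : QuasiIso ((evC q).map (piC.map (resCpx.map f)) ≫ (evC q).map (rho N')) := by
      rw [e]; exact quasiIso_comp _ _
    exact quasiIso_of_comp_right ((evC q).map (piC.map (resCpx.map f))) ((evC q).map (rho N'))

/-- The product over k is in fact finite, because N^(n+k) = 0 once n + k > b. -/
theorem finiteDimensional_KX {N : CochainComplex GrC ℤ}
    (h : ∀ i j, FiniteDimensional ℂ ((N.X i).X j)) {b : ℤ}
    (hb : ∀ i j, b < i → Subsingleton ((N.X i).X j)) (n d : ℤ) :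
    FiniteDimensional ℂ (KX N n d) := by
  let φ : KX N n d →ₗ[ℂ] ∀ k : Fin (b - n + 1).toNat, (N.X (n + k.1)).X (d - 2 * k.1) :=
    LinearMap.pi fun k => LinearMap.proj (⟨k.1, n + k.1, d - 2 * k.1, rfl, by ring⟩ : KI n d)
  refine Module.Finite.of_injective φ fun u v huv => funext fun y => ?_
  by_cases hk : y.k < (b - n + 1).toNat
  · have := congrFun huv ⟨y.k, hk⟩
    obtain ⟨k, i, t, hi, ht⟩ := y
    subst hi
    obtain rfl := eq_sub_of_add_eq ht
    exact this
  · exact (hb _ _ (by have := y.hi; omega)).elim _ _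

theorem exists_subsingleton_KX {N : CochainComplex GrC ℤ} (h : ∀ i, (N.X i).IsFinDim) {b : ℤ}
    (hb : ∀ i j, b < i → Subsingleton ((N.X i).X j)) (n : ℤ) :
    ∃ m : ℤ, ∀ d, m < |d| → Subsingleton (KX N n d) := by
  have key (K : ℕ) : ∃ m : ℤ, ∀ k < K, ∀ t, m < |t| → Subsingleton ((N.X (n + k)).X t) := by
    induction K with
    | zero => exact ⟨0, fun k hk => absurd hk (Nat.not_lt_zero k)⟩
    | succ K ih =>
      obtain ⟨m, hm⟩ := ih
      obtain ⟨-, m', hm'⟩ := h (n + K)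
      refine ⟨max m m', fun k hk t ht => ?_⟩
      rcases Nat.lt_succ_iff_lt_or_eq.1 hk with hk | rfl
      · exact hm k hk t ((le_max_left _ _).trans_lt ht)
      · exact hm' t ((le_max_right _ _).trans_lt ht)
  obtain ⟨m, hm⟩ := key (b - n + 1).toNat
  refine ⟨m + 2 * (b - n + 1).toNat, fun d hd => ?_⟩
  have (y : KI n d) : Subsingleton ((N.X y.i).X y.t) := by
    obtain ⟨k, i, t, rfl, ht⟩ := y
    by_cases hk : k < (b - n + 1).toNat
    · exact hm k hk t (by
        rw [lt_abs] at hd ⊢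
        omega)
    · exact hb (n + k) t (by omega)
  exact inferInstanceAs (Subsingleton (∀ y : KI n d, (N.X y.i).X y.t))

end Res

/-- The resolution of complexes of finite dimensional modules. -/
noncomputable def resLt : CLt.FullSubcategory ⥤ BLt.FullSubcategory :=
  BLt.lift (CLt.ι ⋙ resCpx) fun N => by
    obtain ⟨h, b, hb⟩ := N.property
    have hb' : ∀ i j, b < i → Subsingleton ((N.obj.X i).X j) := fun i j hi => hb i j (Or.inl hi)
    have hfin := Res.finiteDimensional_KX (fun i => (h i).1) hb'
    refine ⟨fun n => ⟨fun v q => ?_, ?_⟩, b + 3, fun v n q hq => ?_⟩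
    · cases v
      · exact hfin n (q - 2)
      · have h1 := hfin n (q - 1)
        have h2 := hfin n (q - 3)
        exact inferInstanceAs (FiniteDimensional ℂ (KX N.obj n (q - 1) × KX N.obj n (q - 3)))
    · obtain ⟨m, hm⟩ := Res.exists_subsingleton_KX h hb' n
      refine ⟨m + 3, fun v q hq => ?_⟩
      rw [lt_abs] at hq
      cases v
      · exact hm (q - 2) (by rw [lt_abs]; omega)
      · have h1 := hm (q - 1) (by rw [lt_abs]; omega)
        have h2 := hm (q - 3) (by rw [lt_abs]; omega)
        exact inferInstanceAs (Subsingleton (KX N.obj n (q - 1) × KX N.obj n (q - 3)))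
    -- For a component of index k one has i + t = n + d - k < n + q and i ≥ n, so both bounds on N
    -- carry over.
    · have key (d : ℤ) (hd : d < q) : Subsingleton (KX N.obj n d) := by
        have (y : KI n d) : Subsingleton ((N.obj.X y.i).X y.t) := hb _ _ (by
          have := y.hi
          have := y.ht
          omega)
        exact inferInstanceAs (Subsingleton (∀ y : KI n d, (N.obj.X y.i).X y.t))
      cases v
      · exact key (q - 2) (by omega)
      · have h1 := key (q - 1) (by omega)
        have h2 := key (q - 3) (by omega)
        exact inferInstanceAs (Subsingleton (KX N.obj n (q - 1) × KX N.obj n (q - 3)))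

theorem resLt_inverts : qisCLt.IsInvertedBy (resLt ⋙ qisBLt.Q) := fun N N' f hf =>
  Localization.inverts qisBLt.Q qisBLt (resLt.map f) <| by
    obtain ⟨-, b, hb⟩ := N.property
    obtain ⟨-, b', hb'⟩ := N'.property
    exact Res.qisB_map (b := max b b') hf (fun i j h => hb i j (Or.inl ((le_max_left _ _).trans_lt h)))
      (fun i j h => hb' i j (Or.inl ((le_max_right _ _).trans_lt h)))

/-- The map from the resolution of `N` to `ι̃ N`. -/
noncomputable def alphaLt : resLt ⟶ iotaCpx where
  app N := BLt.homMk (Res.alpha N.obj)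
  naturality _ _ f := by
    ext1
    exact Res.alpha_naturality f.hom

/-- The augmentation `π̃ (resLt N) ⟶ N`. -/
noncomputable def rhoLt : resLt ⋙ piCpx ⟶ 𝟭 _ where
  app N := CLt.homMk (Res.rho N.obj)
  naturality _ _ f := by
    ext1
    exact Res.rho_naturality f.hom

/-- The functor on derived categories induced by the resolution. -/
noncomputable def resD : DLtC ⥤ DLtB := Localization.lift (resLt ⋙ qisBLt.Q) resLt_inverts qisCLt.Q

/-- The counit which makes `resD` the left derived functor of `ι̃`. -/
noncomputable def resCounit : qisCLt.Q ⋙ resD ⟶ iotaCpx ⋙ qisBLt.Q :=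
  (Localization.fac (resLt ⋙ qisBLt.Q) resLt_inverts qisCLt.Q).hom ≫
    Functor.whiskerRight alphaLt qisBLt.Q

/-- The criterion is applied with R = π̃ ∘ K and the augmentation ρ. On π̃(K N) the counit is
invertible since its terms are free over C. -/
instance isLeftDerivedFunctor_resD : resD.IsLeftDerivedFunctor resCounit qisCLt :=
  isLeftDerivedFunctor_of_resolution resCounit rhoLt
    (fun N q => (quasiIso_iff_coneExact _).2 (Res.coneExact_rho N.obj q)) fun N => by
      have h1 : IsIso (qisBLt.Q.map (alphaLt.app ((resLt ⋙ piCpx).obj N))) :=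
        Localization.inverts qisBLt.Q qisBLt (alphaLt.app ((resLt ⋙ piCpx).obj N))
          (Res.qisB_alpha (Res.exists_x_eq_of_resolution N.obj))
      have h2 : resCounit.app ((resLt ⋙ piCpx).obj N) =
          (Localization.fac (resLt ⋙ qisBLt.Q) resLt_inverts qisCLt.Q).hom.app _ ≫
            qisBLt.Q.map (alphaLt.app ((resLt ⋙ piCpx).obj N)) := rfl
      have h3 : IsIso ((Localization.fac (resLt ⋙ qisBLt.Q) resLt_inverts qisCLt.Q).hom.app
          ((resLt ⋙ piCpx).obj N)) := inferInstance
      rw [h2]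
      exact @IsIso.comp_isIso _ _ _ _ _ _ _ h3 h1

theorem hasLeftDerivedFunctor_iotaCpx : (iotaCpx ⋙ qisBLt.Q).HasLeftDerivedFunctor qisCLt :=
  Functor.HasLeftDerivedFunctor.mk' resD resCounit

/-- The left derived functor of `ι̃` is computed by the resolution. -/
noncomputable def LiotaDIso (h : (iotaCpx ⋙ qisBLt.Q).HasLeftDerivedFunctor qisCLt) :
    LiotaD h ≅ resD :=
  have : (LiotaD h).IsLeftDerivedFunctor ((iotaCpx ⋙ qisBLt.Q).totalLeftDerivedCounit qisCLt.Q qisCLt)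
      qisCLt := inferInstanceAs (((iotaCpx ⋙ qisBLt.Q).totalLeftDerived qisCLt.Q qisCLt).IsLeftDerivedFunctor
        ((iotaCpx ⋙ qisBLt.Q).totalLeftDerivedCounit qisCLt.Q qisCLt) qisCLt)
  Functor.leftDerivedUnique resD (LiotaD h)
    ((iotaCpx ⋙ qisBLt.Q).totalLeftDerivedCounit qisCLt.Q qisCLt) resCounit qisCLt

end JW

namespace JW

/-! ### Coordinates of `𝔻 M` -/

namespace Path

theorem arr_mul_inj {v : Vertex} {g g' k : Path} (h : (arr v).mul g = some k)
    (h' : (arr v).mul g' = some k) : g = g' := by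
  cases v <;> cases g <;> cases h <;> cases g' <;> cases h' <;> rfl

theorem len_bounds (g : Path) : 0 ≤ g.len ∧ g.len < 3 := by
  cases g <;> decide

theorem eq_of_right_of_len {g g' : Path} (h : g.right = g'.right) (h' : g.len = g'.len) :
    g = g' := by
  cases g <;> cases g' <;> first | rfl | (revert h'; decide) | (revert h; decide)

end Path

theorem add_zsmul_map_zero {A A' : Type} [AddCommGroup A] [AddCommGroup A'] [Module ℂ A]
    [Module ℂ A'] (y : A') (n : ℤ) (φ : A →ₗ[ℂ] A') {x : A} (h : x = 0) : y + n • φ x = y := by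
  rw [h, map_zero, smul_zero, add_zero]

namespace Koszul

open Shape

variable (M : CochainComplex GrB ℤ)

/-- The path fixes everything else: v is the vertex other than its end point, s is its length minus
q, and r = p - s. So (𝔻 M)^p_q e(1) has the coordinates e(1), a, and (𝔻 M)^p_q e(2) has the
coordinates e(2), b, c. -/
theorem idx_ext {p : ℤ} {w : Vertex} {q : ℤ} {x x' : (koszulShape p).Idx w q} (h : x.g = x'.g) :
    x = x' := by
  obtain ⟨⟨r, s, v, hj⟩, g, h1, h2, h3⟩ := x
  obtain ⟨⟨r', s', v', hj'⟩, g', h1', h2', h3'⟩ := x'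
  obtain rfl : g = g' := h
  dsimp only at h1 h1' h3 h3'
  obtain rfl : s = s' := by omega
  obtain rfl : r = r' := by omega
  obtain rfl : v = v' := by
    cases v <;> cases v' <;> first | rfl | (rw [h1] at h1'; cases h1')
  rfl

/-- The coordinate `M^r_s e(v)` of `(𝔻 M)^p_q e(w)` which belongs to a path `g`. -/
noncomputable def co {p : ℤ} {w : Vertex} {q : ℤ} (r s : ℤ) (v : Vertex) (g : Path)
    (h : r + s = p) (hg : g.left = v.other ∧ g.right = w ∧ -s + g.len = q) :
    ((koszulCpx.obj M).X p).X w q →ₗ[ℂ] (M.X r).X v s :=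
  proj (S := koszulShape p) (V M p) ⟨⟨r, s, v, h⟩, g, hg⟩

theorem d_apply {p p' : ℤ} (h : p + 1 = p') {w : Vertex} {q : ℤ}
    (z : ((koszulCpx.obj M).X p).X w q) : ((koszulCpx.obj M).d p p').f w q z =
    (dM M p p' h).f w q z + (p.negOnePow : ℤ) • (dK M p p' h).f w q z :=
  congrArg (fun χ : (koszulShape p).mod (V M p) ⟶ (koszulShape p').mod (V M p') => χ.f w q z)
    (dif_pos h : (koszulCpx.obj M).d p p' = Koszul.d M p p' h)

variable {M}

theorem proj_dM {p p' : ℤ} (hp : p + 1 = p') {w : Vertex} {q : ℤ} {r r' s : ℤ} {v : Vertex}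
    {g : Path} (hr : r + 1 = r') (h : r + s = p) (h' : r' + s = p')
    (hg : g.left = v.other ∧ g.right = w ∧ -s + g.len = q) (z : (koszulShape p).Comp (V M p) w q) :
    proj (S := koszulShape p') (V M p') ⟨⟨r', s, v, h'⟩, g, hg⟩ ((dM M p p' hp).f w q z) =
      (M.d r r').f v s (proj (S := koszulShape p) (V M p) ⟨⟨r, s, v, h⟩, g, hg⟩ z) := by
  subst hr
  exact proj_map (S := koszulShape p) (T := koszulShape p') (V := V M p) (W := V M p')
    (τ := fun j => ⟨j.r + 1, j.s, j.v, by have := j.h; omega⟩) (hτ := fun _ => ⟨rfl, rfl⟩)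
    (φ := fun j => (M.d j.r (j.r + 1)).f j.v j.s)
    (fun j j' e => by
      obtain ⟨a1, a2, a3, a4⟩ := j
      obtain ⟨b1, b2, b3, b4⟩ := j'
      simp only [KIdx.mk.injEq, add_left_inj] at e
      obtain ⟨rfl, rfl, rfl⟩ := e
      rfl) ⟨⟨r, s, v, h⟩, g, hg⟩ (hc := hg) z

theorem proj_dK {p p' : ℤ} (hp : p + 1 = p') {w : Vertex} {q : ℤ} {r s s' : ℤ} {v : Vertex}
    {g g' : Path} (hs : s + 1 = s') (hm : (Path.arr v).mul g = some g') (h : r + s = p)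
    (h' : r + s' = p') (hg : g.left = v.other ∧ g.right = w ∧ -s + g.len = q)
    (hg' : g'.left = v.other.other ∧ g'.right = w ∧ -s' + g'.len = q)
    (z : (koszulShape p).Comp (V M p) w q) :
    proj (S := koszulShape p') (V M p') ⟨⟨r, s', v.other, h'⟩, g', hg'⟩ ((dK M p p' hp).f w q z) =
      (M.X r).arr v s s' hs (proj (S := koszulShape p) (V M p) ⟨⟨r, s, v, h⟩, g, hg⟩ z) := by
  subst hs
  exact proj_lmulAux (S := koszulShape p) (T := koszulShape p') (V := V M p) (W := V M p')
    (τ := fun j => ⟨j.r, j.s + 1, j.v.other, by have := j.h; omega⟩) (u := fun j => .arr j.v)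
    (hu := fun j => dK_cond j.v j.s) (φ := fun j => (M.X j.r).arr j.v j.s (j.s + 1) rfl)
    ⟨⟨r, s, v, h⟩, g, hg⟩ g' hm (hc := hg') (fun x' e e' => idx_ext (by
      obtain ⟨⟨a1, a2, a3, a4⟩, g, hg⟩ := x'
      simp only [KIdx.mk.injEq] at e
      obtain ⟨-, -, e⟩ := e
      obtain rfl : a3 = v := by cases a3 <;> cases v <;> first | rfl | cases e
      exact Path.arr_mul_inj e' hm)) z

/-- Left multiplication by an arrow raises the length of a path, so it never produces a trivial
path. -/
theorem proj_dK_eq_zero {p p' : ℤ} (hp : p + 1 = p') {w : Vertex} {q : ℤ} {r s : ℤ} {v : Vertex}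
    {g : Path} (hl : g.len = 0) (h : r + s = p')
    (hg : g.left = v.other ∧ g.right = w ∧ -s + g.len = q) (z : (koszulShape p).Comp (V M p) w q) :
    proj (S := koszulShape p') (V M p') ⟨⟨r, s, v, h⟩, g, hg⟩ ((dK M p p' hp).f w q z) = 0 :=
  proj_lmulAux_eq_zero (S := koszulShape p) (T := koszulShape p') (V := V M p) (W := V M p')
    (τ := fun j => ⟨j.r, j.s + 1, j.v.other, by have := j.h; omega⟩) (u := fun j => .arr j.v)
    (hu := fun j => dK_cond j.v j.s) (φ := fun j => (M.X j.r).arr j.v j.s (j.s + 1) rfl)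
    ⟨⟨r, s, v, h⟩, g, hg⟩ (fun x' _ e => by
      have h1 := Path.len_mul e
      have h2 := (Path.len_bounds x'.g).1
      dsimp only at h1
      rw [Path.len_arr] at h1
      omega) z

/-- The differential in the coordinates of trivial paths. -/
theorem co_d_idem {p p' : ℤ} (hp : p + 1 = p') {w : Vertex} {q : ℤ} {r r' s : ℤ} {v : Vertex}
    {g : Path} (hl : g.len = 0) (hr : r + 1 = r') (h : r + s = p) (h' : r' + s = p')
    (hg : g.left = v.other ∧ g.right = w ∧ -s + g.len = q) (z : ((koszulCpx.obj M).X p).X w q) :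
    co M r' s v g h' hg (((koszulCpx.obj M).d p p').f w q z) =
      (M.d r r').f v s (co M r s v g h hg z) := by
  rw [d_apply M hp]
  refine (map_add (proj (S := koszulShape p') (V M p') ⟨⟨r', s, v, h'⟩, g, hg⟩) _ _).trans ?_
  refine (congrArg₂ (· + ·) (proj_dM hp hr h h' hg z) ((map_zsmul _ _ _).trans
    ((congrArg _ (proj_dK_eq_zero hp hl h' hg z)).trans (smul_zero _)))).trans (add_zero _)

/-- The differential in the coordinates of products with arrows. -/
theorem co_d {p p' : ℤ} (hp : p + 1 = p') {w : Vertex} {q : ℤ} {r r' s s' : ℤ} {v : Vertex}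
    {g g' : Path} (hr : r + 1 = r') (hs : s + 1 = s') (hm : (Path.arr v).mul g = some g')
    (h : r + s' = p) (h' : r' + s' = p') (h'' : r' + s = p)
    (hg : g.left = v.other ∧ g.right = w ∧ -s + g.len = q)
    (hg' : g'.left = v.other.other ∧ g'.right = w ∧ -s' + g'.len = q)
    (z : ((koszulCpx.obj M).X p).X w q) :
    co M r' s' v.other g' h' hg' (((koszulCpx.obj M).d p p').f w q z) =
      (M.d r r').f v.other s' (co M r s' v.other g' h hg' z) +
        (p.negOnePow : ℤ) • (M.X r').arr v s s' hs (co M r' s v g h'' hg z) := by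
  rw [d_apply M hp]
  refine (map_add (proj (S := koszulShape p') (V M p') ⟨⟨r', s', v.other, h'⟩, g', hg'⟩) _ _).trans ?_
  exact congrArg₂ (· + ·) (proj_dM hp hr h h' hg' z) ((map_zsmul _ _ _).trans
    (congrArg _ (proj_dK hp hs hm h'' h' hg hg' z)))

theorem co_map {M' : CochainComplex GrB ℤ} (f : M ⟶ M') {p : ℤ} {w : Vertex} {q : ℤ} {r s : ℤ}
    {v : Vertex} {g : Path} (h : r + s = p) (hg : g.left = v.other ∧ g.right = w ∧ -s + g.len = q)
    (z : ((koszulCpx.obj M).X p).X w q) :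
    co M' r s v g h hg (((koszulCpx.map f).f p).f w q z) =
      (f.f r).f v s (co M r s v g h hg z) :=
  proj_map (S := koszulShape p) (T := koszulShape p) (V := V M p) (W := V M' p)
    (τ := fun j => j) (hτ := fun _ => ⟨rfl, rfl⟩) (φ := fun j => (f.f j.r).f j.v j.s)
    Function.injective_id ⟨⟨r, s, v, h⟩, g, hg⟩ (hc := hg) z

/-- The element with a given coordinate. -/
noncomputable def single {p : ℤ} {w : Vertex} {q : ℤ} (r s : ℤ) (v : Vertex) (g : Path)
    (h : r + s = p) (hg : g.left = v.other ∧ g.right = w ∧ -s + g.len = q) :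
    (M.X r).X v s →ₗ[ℂ] ((koszulCpx.obj M).X p).X w q :=
  DirectSum.lof ℂ ((koszulShape p).Idx w q) (fun x => V M p x.j) ⟨⟨r, s, v, h⟩, g, hg⟩

theorem co_single_self {p : ℤ} {w : Vertex} {q : ℤ} {r s : ℤ} {v : Vertex} {g : Path}
    (h : r + s = p) (hg : g.left = v.other ∧ g.right = w ∧ -s + g.len = q) (m : (M.X r).X v s) :
    co M r s v g h hg (single r s v g h hg m) = m :=
  proj_lof_self (S := koszulShape p) (V := V M p) ⟨⟨r, s, v, h⟩, g, hg⟩ m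

theorem co_single_ne {p : ℤ} {w : Vertex} {q : ℤ} {r s r' s' : ℤ} {v v' : Vertex} {g g' : Path}
    (h : r + s = p) (hg : g.left = v.other ∧ g.right = w ∧ -s + g.len = q)
    (h' : r' + s' = p) (hg' : g'.left = v'.other ∧ g'.right = w ∧ -s' + g'.len = q)
    (hne : g' ≠ g) (m : (M.X r).X v s) :
    co M r' s' v' g' h' hg' (single r s v g h hg m) = 0 :=
  proj_lof_ne (S := koszulShape p) (V := V M p) (x := ⟨⟨r, s, v, h⟩, g, hg⟩)
    (x' := ⟨⟨r', s', v', h'⟩, g', hg'⟩) (fun e => hne (congrArg Idx.g e).symm) m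

theorem other_other (v : Vertex) : v.other.other = v := by cases v <;> rfl

theorem ext {p : ℤ} {w : Vertex} {q : ℤ} {z z' : ((koszulCpx.obj M).X p).X w q}
    (h : ∀ g : Path, g.right = w → ∀ (r s : ℤ) (v : Vertex) (h : r + s = p)
      (hg : g.left = v.other ∧ g.right = w ∧ -s + g.len = q),
      co M r s v g h hg z = co M r s v g h hg z') : z = z' :=
  ext_proj (S := koszulShape p) (V := V M p) fun ⟨⟨r, s, v, hj⟩, g, hg⟩ =>
    h g hg.2.1 r s v hj hg

theorem co_eq_zero {p : ℤ} {w : Vertex} {q : ℤ} {z : ((koszulCpx.obj M).X p).X w q}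
    {r s r' s' : ℤ} {v v' : Vertex} {g : Path} {h hg h' hg'} (hz : co M r s v g h hg z = 0) :
    co M r' s' v' g h' hg' z = 0 := by
  have e : (⟨⟨r, s, v, h⟩, g, hg⟩ : (koszulShape p).Idx w q) = ⟨⟨r', s', v', h'⟩, g, hg'⟩ :=
    idx_ext rfl
  have key (x x' : (koszulShape p).Idx w q) (e : x = x') (hx : proj (V M p) x z = 0) :
      proj (V M p) x' z = 0 := e ▸ hx
  exact key _ _ e hz

/-- The filtration of `(𝔻 M)_q e(w)` by path length. -/
noncomputable def columns (M : CochainComplex GrB ℤ) (w : Vertex) (q : ℤ) :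
    Columns ((evB w q).obj (koszulCpx.obj M)) (Γ := {g : Path // g.right = w}) (fun g => g.1.len)
      (fun g => reindex ((evB g.1.left.other (g.1.len - q)).obj M) (-(g.1.len - q))) where
  pr n g := co M (n + -(g.1.len - q)) (g.1.len - q) g.1.left.other g.1 (by ring)
    ⟨(other_other _).symm, g.2, by ring⟩
  exists_pr n g m := ⟨single _ _ _ g.1 (by ring) ⟨(other_other _).symm, g.2, by ring⟩ m,
    co_single_self _ _ _, fun g' h => co_single_ne _ _ _ _ (fun e => h (Subtype.ext e)) _⟩
  -- The Koszul part of the differential lengthens paths, so on the leading coordinate only the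
  -- differential of M remains.
  lead n n' g z hn hz := by
    obtain ⟨g, hg⟩ := g
    have key0 (hl : g.len = 0) := co_d_idem (M := M) hn (w := w) (q := q)
      (r := n + -(g.len - q)) (r' := n' + -(g.len - q)) (s := g.len - q) (v := g.left.other)
      (g := g) hl (by omega) (by ring) (by ring) ⟨(other_other _).symm, hg, by ring⟩ z
    have key1 (v : Vertex) (hv : g.left.other = v.other) (g0 : Path)
        (hm : (Path.arr v).mul g0 = some g) :
        co M (n' + -(g.len - q)) (g.len - q) g.left.other g (by ring)
          ⟨(other_other _).symm, hg, by ring⟩ (((koszulCpx.obj M).d n n').f w q z) =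
        (M.d (n + -(g.len - q)) (n' + -(g.len - q))).f g.left.other (g.len - q)
          (co M (n + -(g.len - q)) (g.len - q) g.left.other g (by ring)
            ⟨(other_other _).symm, hg, by ring⟩ z) := by
      have h1 := Path.len_mul hm
      rw [Path.len_arr] at h1
      have h2 := Path.right_mul hm
      have h3 : g0.left = v.other := by
        cases v <;> cases g0 <;> first | rfl | cases hm
      have h4 := co_d (M := M) hn (w := w) (q := q) (r := n + -(g.len - q))
        (r' := n' + -(g.len - q)) (s := g.len - q - 1) (s' := g.len - q) (v := v) (g := g0)
        (g' := g) (by omega) (by ring) hm (by ring) (by ring) (by omega)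
        ⟨h3, h2.symm.trans hg, by omega⟩ ⟨by rw [← hv, other_other], hg, by ring⟩ z
      have h5 : co M (n' + -(g.len - q)) (g.len - q - 1) v g0 (by omega)
          ⟨h3, h2.symm.trans hg, by omega⟩ z = 0 := co_eq_zero (hz ⟨g0, h2.symm.trans hg⟩ (by
            change g0.len < g.len
            omega))
      have gen (v' : Vertex) (e : g.left.other = v') :
          (∀ hh, co M (n' + -(g.len - q)) (g.len - q) v' g (by ring) hh
            (((koszulCpx.obj M).d n n').f w q z) =
            (M.d (n + -(g.len - q)) (n' + -(g.len - q))).f v' (g.len - q)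
            (co M (n + -(g.len - q)) (g.len - q) v' g (by ring) hh z)) →
          co M (n' + -(g.len - q)) (g.len - q) g.left.other g (by ring)
            ⟨(other_other _).symm, hg, by ring⟩ (((koszulCpx.obj M).d n n').f w q z) =
          (M.d (n + -(g.len - q)) (n' + -(g.len - q))).f g.left.other (g.len - q)
            (co M (n + -(g.len - q)) (g.len - q) g.left.other g (by ring)
              ⟨(other_other _).symm, hg, by ring⟩ z) := by
        subst e
        exact fun H => H _
      exact gen _ hv fun _ => h4.trans (add_zsmul_map_zero _ _ _ h5)
    -- The nontrivial paths are split as a = a e(1), b = b e(2), c = a b. The second factor is the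
    -- shorter path whose coordinate vanishes by hypothesis.
    cases g
    · exact key0 rfl
    · exact key0 rfl
    · exact key1 .two rfl .e1 rfl
    · exact key1 .one rfl .e2 rfl
    · exact key1 .two rfl .b rfl
  ext n z hz := ext fun g hg r s v h hg' => (co_eq_zero (hz ⟨g, hg⟩)).trans (map_zero _).symm
  bounded n := ⟨0, 3, fun g hg => by
    have := Path.len_bounds g.1
    omega⟩

end Koszul

/-- The subquotients for the path length are shifted complexes M_s e(v) with s fixed. There are at
most three of them, so no bound on M is needed. -/
theorem qisB_koszulCpx_map {M M' : CochainComplex GrB ℤ} {f : M ⟶ M'} (hf : qisB f) :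
    qisB (koszulCpx.map f) := by
  rw [qisB_iff] at hf ⊢
  intro w q
  refine (Koszul.columns M w q).coneExact (Koszul.columns M' w q)
    (fun g g' h => Subtype.ext (Path.eq_of_right_of_len (g.2.trans g'.2.symm) h)) _
    (fun g => reindexMap ((evB g.1.left.other (g.1.len - q)).map f) (-(g.1.len - q)))
    (fun g => (hf _ _).reindexMap _) fun n g z => Koszul.co_map f _ _ z

theorem koszulLt_inverts : qisBLt.IsInvertedBy (koszulLt ⋙ qisBGt.Q) := fun _ _ f hf =>
  Localization.inverts qisBGt.Q qisBGt (koszulLt.map f) (qisB_koszulCpx_map hf)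

end JW

/-! ### Acyclicity of (𝔻 Y) e(2) when Y e(1) → Y e(2) → Y e(1) is short exact. -/

namespace JW

namespace Koszul

theorem d_f_comm_a (M : CochainComplex GrB ℤ) (n n' i j : ℤ) (h : i + 1 = j)
    (m : (M.X n).X .two i) : (M.d n n').f .one j ((M.X n).a i j h m) =
      (M.X n').a i j h ((M.d n n').f .two i m) := (M.d n n').comm_a i j h m

theorem d_f_comm_b (M : CochainComplex GrB ℤ) (n n' i j : ℤ) (h : i + 1 = j)
    (m : (M.X n).X .one i) : (M.d n n').f .two j ((M.X n).b i j h m) =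
      (M.X n').b i j h ((M.d n n').f .one i m) := (M.d n n').comm_b i j h m

theorem d_f_d_f (M : CochainComplex GrB ℤ) (i j k : ℤ) (v : Vertex) (t : ℤ) (m : (M.X i).X v t) :
    (M.d j k).f v t ((M.d i j).f v t m) = 0 :=
  congrArg (fun χ => GrB.Hom.f χ v t m) (M.d_comp_d i j k)

theorem negOnePow_mul_self (n : ℤ) : (n.negOnePow : ℤ) * n.negOnePow = 1 := by
  rw [← Units.val_mul, Int.units_mul_self, Units.val_one]

theorem smul_smul_negOnePow {A : Type} [AddCommGroup A] (n : ℤ) (x : A) :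
    (n.negOnePow : ℤ) • (n.negOnePow : ℤ) • x = x := by
  rw [smul_smul, negOnePow_mul_self, one_smul]

/-- If `0 ⟶ Y e(1) ⟶ Y e(2) ⟶ Y e(1) ⟶ 0` is exact in each degree, then `(𝔻 Y) e(2)` has no
cohomology. -/
theorem acyc_two {Y : CochainComplex GrB ℤ}
    (hb : ∀ n i j h (m : (Y.X n).X .one i), (Y.X n).b i j h m = 0 → m = 0)
    (hab : ∀ n i j k h h' (m : (Y.X n).X .two j), (Y.X n).a j k h' m = 0 →
      ∃ m', (Y.X n).b i j h m' = m)
    (ha : ∀ n i j h (m : (Y.X n).X .one j), ∃ m', (Y.X n).a i j h m' = m) (q : ℤ) :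
    Acyc ((evB .two q).obj (koszulCpx.obj Y)) := by
  intro i j k hij hjk x hx
  change ((koszulCpx.obj Y).X j).X .two q at x
  change ((koszulCpx.obj Y).d j k).f .two q x = 0 at hx
  have ce : Path.e2.left = Vertex.one.other ∧ Path.e2.right = Vertex.two ∧
    -(-q) + Path.e2.len = q := ⟨rfl, rfl, by dsimp [Path.len]; ring⟩
  have cb : Path.b.left = Vertex.two.other ∧ Path.b.right = Vertex.two ∧
    -(1 - q) + Path.b.len = q := ⟨rfl, rfl, by dsimp [Path.len]; ring⟩
  have cc : Path.c.left = Vertex.one.other ∧ Path.c.right = Vertex.two ∧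
    -(2 - q) + Path.c.len = q := ⟨rfl, rfl, by dsimp [Path.len]; ring⟩
  have e1 := co_d (M := Y) hjk (r := j + q - 2) (r' := j + q - 1) (s := 1 - q) (s' := 2 - q)
    (v := .two) (g := .b) (g' := .c) (by ring) (by ring) rfl (by ring) (by omega) (by ring) cb cc x
  have e2 := co_d (M := Y) hjk (r := j + q - 1) (r' := j + q) (s := -q) (s' := 1 - q)
    (v := .one) (g := .e2) (g' := .b) (by ring) (by ring) rfl (by ring) (by omega) (by ring) ce cb x
  rw [hx, map_zero] at e1 e2
  have hs : (j.negOnePow : ℤ) = -(i.negOnePow : ℤ) := by rw [← hij, negOnePow_add_one]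
  rw [hs, neg_smul] at e1 e2
  set xe := co Y (j + q) (-q) .one .e2 (by ring) ce x
  set xb := co Y (j + q - 1) (1 - q) .two .b (by ring) cb x
  set xc := co Y (j + q - 2) (2 - q) .one .c (by ring) cc x
  change 0 = (Y.d (j + q - 2) (j + q - 1)).f .one (2 - q) xc +
    -((i.negOnePow : ℤ) • (Y.X (j + q - 1)).a (1 - q) (2 - q) (by ring) xb) at e1
  change 0 = (Y.d (j + q - 1) (j + q)).f .two (1 - q) xb +
    -((i.negOnePow : ℤ) • (Y.X (j + q)).b (-q) (1 - q) (by ring) xe) at e2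
  rw [eq_comm, add_neg_eq_zero] at e1 e2
  -- The coordinates e(2), b, c form three columns, joined by b and then a. The chase starts at the
  -- last one: surjectivity of a removes the c-coordinate, and exactness in the middle removes the
  -- b-coordinate.
  obtain ⟨yb, hyb⟩ := ha (j + q - 2) (1 - q) (2 - q) (by ring) ((i.negOnePow : ℤ) • xc)
  obtain ⟨w, hw⟩ := hab (j + q - 1) (-q) (1 - q) (2 - q) (by ring) (by ring)
    (xb - (Y.d (j + q - 2) (j + q - 1)).f .two (1 - q) yb) (by
      rw [map_sub, ← d_f_comm_a, hyb, map_zsmul, e1, smul_smul_negOnePow, sub_self])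
  let y : ((koszulCpx.obj Y).X i).X .two q :=
    single (M := Y) (j + q - 2) (1 - q) .two .b (by omega) cb yb +
    single (M := Y) (j + q - 1) (-q) .one .e2 (by omega) ce ((i.negOnePow : ℤ) • w)
  have yc : co Y (j + q - 2 - 1) (2 - q) .one .c (by omega) cc y = 0 := by
    rw [map_add, co_single_ne _ _ _ _ (by decide), co_single_ne _ _ _ _ (by decide), add_zero]
  have yb' : co Y (j + q - 2) (1 - q) .two .b (by omega) cb y = yb := by
    rw [map_add, co_single_self, co_single_ne _ _ _ _ (by decide), add_zero]
  have ye' : co Y (j + q - 1) (-q) .one .e2 (by omega) ce y = (i.negOnePow : ℤ) • w := by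
    rw [map_add, co_single_self, co_single_ne _ _ _ _ (by decide), zero_add]
  refine ⟨y, ?_⟩
  change ((koszulCpx.obj Y).d i j).f .two q y = x
  have uniq (g : Path) {r s r' s' : ℤ} {v v' : Vertex} {h hg h' hg'}
      (H : co Y r s v g h hg (((koszulCpx.obj Y).d i j).f .two q y) = co Y r s v g h hg x) :
      co Y r' s' v' g h' hg' (((koszulCpx.obj Y).d i j).f .two q y) = co Y r' s' v' g h' hg' x := by
    rw [← sub_eq_zero, ← map_sub] at H ⊢
    exact co_eq_zero H
  refine ext fun g hg r s v h hg' => ?_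
  have hg3 : g = .e2 ∨ g = .b ∨ g = .c := by revert hg; cases g <;> decide
  rcases hg3 with rfl | rfl | rfl
  · refine uniq _ (r := j + q) (s := -q) (v := .one) (h := by ring) (hg := ce) ?_
    refine (co_d_idem (M := Y) hij (r := j + q - 1) (r' := j + q) (s := -q) (v := .one) (g := .e2)
      rfl (by ring) (by omega) (by ring) ce y).trans ?_
    rw [ye']
    -- Nothing is left to choose for the e(2)-coordinate. It is correct because it becomes correct
    -- after applying the injective map b.
    refine sub_eq_zero.1 (hb (j + q) (-q) (1 - q) (by ring) _ ?_)
    rw [map_sub, ← d_f_comm_b, map_zsmul, hw, map_zsmul, map_sub, d_f_d_f, sub_zero, e2,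
      smul_smul_negOnePow]
    exact sub_self _
  · refine uniq _ (r := j + q - 1) (s := 1 - q) (v := .two) (h := by ring) (hg := cb) ?_
    refine (co_d (M := Y) hij (r := j + q - 2) (r' := j + q - 1) (s := -q) (s' := 1 - q)
      (v := .one) (g := .e2) (g' := .b) (by ring) (by ring) rfl (by omega) (by omega) (by omega)
      ce cb y).trans ?_
    rw [ye']
    refine (congrArg (· + _) (congrArg _ yb')).trans ?_
    change _ + (i.negOnePow : ℤ) • (Y.X (j + q - 1)).b (-q) (1 - q) _ ((i.negOnePow : ℤ) • w) = xb
    rw [map_zsmul, hw, smul_smul_negOnePow]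
    exact add_sub_cancel _ _
  · refine uniq _ (r := j + q - 2) (s := 2 - q) (v := .one) (h := by ring) (hg := cc) ?_
    refine (co_d (M := Y) hij (r := j + q - 2 - 1) (r' := j + q - 2) (s := 1 - q) (s' := 2 - q)
      (v := .two) (g := .b) (g' := .c) (by ring) (by ring) rfl (by omega) (by omega) (by omega)
      cb cc y).trans ?_
    rw [yb']
    refine (congrArg (· + _) ((congrArg _ yc).trans (map_zero _))).trans ?_
    change 0 + (i.negOnePow : ℤ) • (Y.X (j + q - 2)).a (1 - q) (2 - q) _ yb = xc
    rw [hyb, smul_smul_negOnePow, zero_add]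

end Koszul

end JW

namespace JW

/-! ### Coordinates of `ℂ𝕂(X)` -/

namespace CK

open Shape Koszul

variable (M : CochainComplex GrB ℤ)

theorem idx_ext {n : ℤ} {w : Vertex} {q : ℤ} {x x' : (tailShape n).Idx w q} (h : x.j.k = x'.j.k)
    (h' : x.g = x'.g) : x = x' := by
  obtain ⟨⟨i, k, t, hj⟩, g, h1, h2, h3⟩ := x
  obtain ⟨⟨i', k', t', hj'⟩, g', h1', h2', h3'⟩ := x'
  obtain rfl : g = g' := h'
  obtain rfl : k = k' := h
  dsimp only at h3 h3'
  obtain rfl : t = t' := by omega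
  obtain rfl : i = i' := by omega
  rfl

/-- The component of `ℂ𝕂(M)` in `M`. -/
def hd {n : ℤ} {w : Vertex} {q : ℤ} : ((ckCpx.obj M).X n).X w q →ₗ[ℂ] (M.X n).X w q :=
  LinearMap.fst ℂ _ _

/-- The coordinate of `ℂ𝕂(M)` in `M^i_t e(2)` which belongs to the summand
`M^i ⊗_B ℂ𝕂^(k+1)` and a path `g`. -/
noncomputable def tc {n : ℤ} {w : Vertex} {q : ℤ} (i : ℤ) (k : ℕ) (t : ℤ) (g : Path)
    (h : i + (k + 1) = n) (hg : g.left = .two ∧ g.right = w ∧ t - 2 * (k + 1) + g.len = q) :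
    ((ckCpx.obj M).X n).X w q →ₗ[ℂ] (M.X i).X .two t :=
  (proj (S := tailShape n) (V M n) ⟨⟨i, k, t, h⟩, g, hg⟩).comp (LinearMap.snd ℂ _ _)

theorem d_apply {n n' : ℤ} (h : n + 1 = n') {w : Vertex} {q : ℤ}
    (z : ((ckCpx.obj M).X n).X w q) : ((ckCpx.obj M).d n n').f w q z =
      ((M.d n n').f w q (hd M z), (alpha M n n' h).f w q (hd M z) +
        ((dM M n n' h).f w q z.2 + ((dL M n n' h).f w q z.2 + (dR M n n' h).f w q z.2))) :=
  congrArg (fun χ : (M.X n).prod ((tailShape n).mod (V M n)) ⟶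
    (M.X n').prod ((tailShape n').mod (V M n')) => χ.f w q z)
    (dif_pos h : (ckCpx.obj M).d n n' =
      GrB.prodHom (M.d n n') (alpha M n n' h) (dTail M n n' h))

variable {M}

theorem hd_d {n n' : ℤ} (h : n + 1 = n') {w : Vertex} {q : ℤ} (z : ((ckCpx.obj M).X n).X w q) :
    hd M (((ckCpx.obj M).d n n').f w q z) = (M.d n n').f w q (hd M z) :=
  congrArg Prod.fst (d_apply M h z)

theorem proj_dM {n n' : ℤ} (hn : n + 1 = n') {w : Vertex} {q : ℤ} {i i' : ℤ} {k : ℕ} {t : ℤ}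
    {g : Path} (hi : i + 1 = i') (h : i + (k + 1) = n) (h' : i' + (k + 1) = n')
    (hg : g.left = .two ∧ g.right = w ∧ t - 2 * (k + 1) + g.len = q)
    (z : (tailShape n).Comp (V M n) w q) :
    proj (S := tailShape n') (V M n') ⟨⟨i', k, t, h'⟩, g, hg⟩ ((dM M n n' hn).f w q z) =
      (M.d i i').f .two t (proj (S := tailShape n) (V M n) ⟨⟨i, k, t, h⟩, g, hg⟩ z) := by
  subst hi
  exact proj_map (S := tailShape n) (T := tailShape n') (V := V M n) (W := V M n')
    (τ := fun j => ⟨j.i + 1, j.k, j.t, by have := j.h; omega⟩) (hτ := fun _ => ⟨rfl, rfl⟩)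
    (φ := fun j => (M.d j.i (j.i + 1)).f .two j.t)
    (fun j j' e => by
      obtain ⟨a1, a2, a3, a4⟩ := j
      obtain ⟨b1, b2, b3, b4⟩ := j'
      simp only [TIdx.mk.injEq, add_left_inj] at e
      obtain ⟨rfl, rfl, rfl⟩ := e
      rfl) ⟨⟨i, k, t, h⟩, g, hg⟩ (hc := hg) z

theorem proj_dL {n n' : ℤ} (hn : n + 1 = n') {w : Vertex} {q : ℤ} {i : ℤ} {k : ℕ} {t t' : ℤ}
    {g : Path} (ht : t + 2 = t') (h : i + (k + 1) = n) (h' : i + ((k + 1 : ℕ) + 1) = n')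
    (hg : g.left = .two ∧ g.right = w ∧ t - 2 * (k + 1) + g.len = q)
    (hg' : g.left = .two ∧ g.right = w ∧ t' - 2 * ((k + 1 : ℕ) + 1) + g.len = q)
    (z : (tailShape n).Comp (V M n) w q) :
    proj (S := tailShape n') (V M n') ⟨⟨i, k + 1, t', h'⟩, g, hg'⟩ ((dL M n n' hn).f w q z) =
      (i.negOnePow : ℤ) • (M.X i).c t t' ht
        (proj (S := tailShape n) (V M n) ⟨⟨i, k, t, h⟩, g, hg⟩ z) := by
  subst ht
  exact proj_map (S := tailShape n) (T := tailShape n') (V := V M n) (W := V M n')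
    (τ := fun j => ⟨j.i, j.k + 1, j.t + 2, by have := j.h; push_cast; omega⟩)
    (hτ := fun _ => ⟨rfl, by push_cast; ring⟩)
    (φ := fun j => (j.i.negOnePow : ℤ) • (M.X j.i).c j.t (j.t + 2) rfl)
    (fun j j' e => by
      obtain ⟨a1, a2, a3, a4⟩ := j
      obtain ⟨b1, b2, b3, b4⟩ := j'
      simp only [TIdx.mk.injEq, add_left_inj] at e
      obtain ⟨rfl, rfl, rfl⟩ := e
      rfl) ⟨⟨i, k, t, h⟩, g, hg⟩ (hc := hg') z

theorem proj_dL_zero {n n' : ℤ} (hn : n + 1 = n') {w : Vertex} {q : ℤ} {x : (tailShape n').Idx w q}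
    (hx : x.j.k = 0) (z : (tailShape n).Comp (V M n) w q) :
    proj (V M n') x ((dL M n n' hn).f w q z) = 0 :=
  proj_map_eq_zero (S := tailShape n) (T := tailShape n') (V := V M n) (W := V M n')
    (τ := fun j => ⟨j.i, j.k + 1, j.t + 2, by have := j.h; push_cast; omega⟩)
    (hτ := fun _ => ⟨rfl, by push_cast; ring⟩)
    (φ := fun j => (j.i.negOnePow : ℤ) • (M.X j.i).c j.t (j.t + 2) rfl) x
    (fun _ e => by
      have := congrArg TIdx.k e
      rw [hx] at this
      exact Nat.succ_ne_zero _ this) z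

theorem proj_eq_of_lof {S T : Shape} {V : S.J → ModuleCat.{0} ℂ} {W : T.J → ModuleCat.{0} ℂ}
    {w w' : Vertex} {n n' : ℤ} {F : S.Comp V w n →ₗ[ℂ] T.Comp W w' n'} (y : T.Idx w' n')
    (x : S.Idx w n) (ψ : V x.j →ₗ[ℂ] W y.j)
    (h : ∀ m, proj W y (F (S.ten V w n x.j (some x.g) (by rintro _ ⟨⟩; exact x.cond) m)) = ψ m)
    (h' : ∀ x' m, x' ≠ x → proj W y
      (F (S.ten V w n x'.j (some x'.g) (by rintro _ ⟨⟩; exact x'.cond) m)) = 0)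
    (z : S.Comp V w n) : proj W y (F z) = ψ (proj V x z) := by
  suffices H : (proj W y).comp F = ψ.comp (proj V x) from LinearMap.congr_fun H z
  refine DirectSum.linearMap_ext _ fun x' => LinearMap.ext fun m => ?_
  by_cases e : x' = x
  · subst e
    exact (h m).trans (congrArg ψ (proj_lof_self (V := V) x' m).symm)
  · exact (h' x' m e).trans ((congrArg ψ (proj_lof_ne (V := V) e m)).trans (map_zero ψ)).symm

theorem proj_ten_eq_zero {S : Shape} {V : S.J → ModuleCat.{0} ℂ} {w : Vertex} {n : ℤ}
    {y : S.Idx w n} {j : S.J} {g : Option Path} {hg} (h : j = y.j → g = some y.g → False) (m : V j) :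
    proj V y (S.ten V w n j g hg m) = 0 := by
  cases g with
  | none => exact map_zero _
  | some g =>
    exact proj_lof_ne (V := V) (x := ⟨j, g, hg g rfl⟩)
      (fun e => h (congrArg Idx.j e) (congrArg (some ·.g) e)) m

theorem dR_ten {n n' : ℤ} (hn : n + 1 = n') {w : Vertex} {q : ℤ} (x : (tailShape n).Idx w q)
    (m : V M n x.j) :
    (dR M n n' hn).f w q (ten (tailShape n) (V M n) w q x.j (some x.g)
      (by rintro _ ⟨⟩; exact x.cond) m) =
    ten (tailShape n') (V M n') w q
      ⟨x.j.i, x.j.k + 1, x.j.t, by have := x.j.h; push_cast; omega⟩ (Path.c.mul x.g) (by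
        intro k hk
        have h3 := x.cond.2.2
        rw [Path.left_mul hk, Path.right_mul hk, Path.len_mul hk]
        refine ⟨rfl, x.cond.2.1, ?_⟩
        dsimp [Path.len] at h3 ⊢
        omega)
      (((x.j.i.negOnePow : ℤ) * (-1) ^ (x.j.k + 1)) • m) := by
  rw [Shape.lmul_ten]
  rfl

theorem proj_dR {n n' : ℤ} (hn : n + 1 = n') {q : ℤ} {i : ℤ} {k : ℕ} {t : ℤ}
    (h : i + (k + 1) = n) (h' : i + ((k + 1 : ℕ) + 1) = n')
    (hg : Path.e2.left = .two ∧ Path.e2.right = .two ∧ t - 2 * (k + 1) + Path.e2.len = q)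
    (hg' : Path.c.left = .two ∧ Path.c.right = .two ∧ t - 2 * ((k + 1 : ℕ) + 1) + Path.c.len = q)
    (z : (tailShape n).Comp (V M n) .two q) :
    proj (S := tailShape n') (V M n') ⟨⟨i, k + 1, t, h'⟩, .c, hg'⟩ ((dR M n n' hn).f .two q z) =
      ((i.negOnePow : ℤ) * (-1) ^ (k + 1)) •
        (proj (S := tailShape n) (V M n) ⟨⟨i, k, t, h⟩, .e2, hg⟩ z) := by
  refine proj_eq_of_lof (S := tailShape n) (T := tailShape n') (V := V M n) (W := V M n')
    ⟨⟨i, k + 1, t, h'⟩, .c, hg'⟩ ⟨⟨i, k, t, h⟩, .e2, hg⟩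
    (((i.negOnePow : ℤ) * (-1) ^ (k + 1)) • LinearMap.id) (fun m => ?_) (fun x' m hx' => ?_) z
  · rw [dR_ten]
    exact proj_lof_self (S := tailShape n') (V := V M n') ⟨⟨i, k + 1, t, h'⟩, .c, hg'⟩ _
  · rw [dR_ten]
    refine proj_ten_eq_zero (S := tailShape n') (V := V M n') (fun e e' => hx' (idx_ext ?_ ?_)) _
    · have : x'.j.k + 1 = k + 1 := congrArg TIdx.k e
      exact Nat.succ_injective this
    · exact (Iota.c_mul e').1

theorem proj_dR_eq_zero {n n' : ℤ} (hn : n + 1 = n') {w : Vertex} {q : ℤ}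
    {x : (tailShape n').Idx w q} (hx : x.j.k = 0 ∨ x.g ≠ .c)
    (z : (tailShape n).Comp (V M n) w q) : proj (V M n') x ((dR M n n' hn).f w q z) = 0 := by
  suffices H : (proj (V M n') x).comp ((dR M n n' hn).f w q) = 0 from LinearMap.congr_fun H z
  refine DirectSum.linearMap_ext _ fun x' => LinearMap.ext fun m => ?_
  refine (congrArg (proj (V M n') x) (dR_ten hn x' m)).trans ?_
  refine proj_ten_eq_zero (S := tailShape n') (V := V M n') (fun e e' => ?_) _
  rcases hx with hx | hx
  · have : x'.j.k + 1 = x.j.k := congrArg TIdx.k e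
    rw [hx] at this
    exact Nat.succ_ne_zero _ this
  · exact hx (Iota.c_mul e').2

theorem proj_first_self {n n' : ℤ} (hn : n + 1 = n') {w : Vertex} {q t : ℤ} {g : Path} {hg}
    (h' : n + ((0 : ℕ) + 1) = n')
    (hg' : g.left = .two ∧ g.right = w ∧ t - 2 * ((0 : ℕ) + 1) + g.len = q) (m : (M.X n).X .two t) :
    proj (S := tailShape n') (V M n') ⟨⟨n, 0, t, h'⟩, g, hg'⟩
      (first M n n' hn w q t (some g) hg m) = m :=
  proj_lof_self (S := tailShape n') (V := V M n') ⟨⟨n, 0, t, h'⟩, g, hg'⟩ m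

theorem proj_first_ne {n n' : ℤ} (hn : n + 1 = n') {w : Vertex} {q t : ℤ} {g : Path} {hg}
    {x : (tailShape n').Idx w q} (hx : x.j.k ≠ 0 ∨ x.g ≠ g) (m : (M.X n).X .two t) :
    proj (V M n') x (first M n n' hn w q t (some g) hg m) = 0 :=
  proj_lof_ne (S := tailShape n') (V := V M n')
    (x := ⟨⟨n, 0, t, by simpa using hn⟩, g, hg g rfl⟩) (x' := x) (fun e => by
      rcases hx with hx | hx
      · exact hx (congrArg (fun y : (tailShape n').Idx w q => y.j.k) e).symm
      · exact hx (congrArg Idx.g e).symm) m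

theorem proj_alpha_eq_zero {n n' : ℤ} (hn : n + 1 = n') {w : Vertex} {q : ℤ}
    {x : (tailShape n').Idx w q} (hx : x.j.k ≠ 0) (m : (M.X n).X w q) :
    proj (V M n') x ((alpha M n n' hn).f w q m) = 0 := by
  cases w
  · exact (map_zsmul _ _ _).trans ((congrArg _ (proj_first_ne hn (hg := cond_a q) (.inl hx) _)).trans (smul_zero _))
  · refine (map_zsmul _ _ _).trans ((congrArg _ ?_).trans (smul_zero _))
    exact (map_add _ _ _).trans ((congrArg₂ (· + ·) (proj_first_ne hn (hg := cond_e2 q) (.inl hx) _)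
      (proj_first_ne hn (hg := cond_c q) (.inl hx) _)).trans (add_zero _))

theorem tc_d_aux {n n' : ℤ} (hn : n + 1 = n') {w : Vertex} {q : ℤ} {i' : ℤ} {k : ℕ} {t : ℤ}
    {g : Path} (h' : i' + (k + 1) = n')
    (hg : g.left = .two ∧ g.right = w ∧ t - 2 * (k + 1) + g.len = q)
    (z : ((ckCpx.obj M).X n).X w q) {A D L R : (M.X i').X .two t}
    (hA : proj (S := tailShape n') (V M n') ⟨⟨i', k, t, h'⟩, g, hg⟩
      ((alpha M n n' hn).f w q (hd M z)) = A)
    (hD : proj (S := tailShape n') (V M n') ⟨⟨i', k, t, h'⟩, g, hg⟩ ((dM M n n' hn).f w q z.2) = D)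
    (hL : proj (S := tailShape n') (V M n') ⟨⟨i', k, t, h'⟩, g, hg⟩ ((dL M n n' hn).f w q z.2) = L)
    (hR : proj (S := tailShape n') (V M n') ⟨⟨i', k, t, h'⟩, g, hg⟩ ((dR M n n' hn).f w q z.2) = R) :
    tc M i' k t g h' hg (((ckCpx.obj M).d n n').f w q z) = A + (D + (L + R)) := by
  subst hA hD hL hR
  rw [d_apply M hn]
  refine (map_add (proj (S := tailShape n') (V M n') ⟨⟨i', k, t, h'⟩, g, hg⟩) _ _).trans ?_
  rw [map_add, map_add]

/-- The differential in the coordinates for `k + 1` and a path other than `c`. -/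
theorem tc_d_succ {n n' : ℤ} (hn : n + 1 = n') {w : Vertex} {q : ℤ} {i i' : ℤ} {k : ℕ} {t t' : ℤ}
    {g : Path} (hi : i + 1 = i') (ht : t + 2 = t') (hgc : g ≠ .c)
    (h : i + ((k + 1 : ℕ) + 1) = n) (h' : i' + ((k + 1 : ℕ) + 1) = n') (h'' : i' + (k + 1) = n)
    (hg : g.left = .two ∧ g.right = w ∧ t - 2 * (k + 1) + g.len = q)
    (hg' : g.left = .two ∧ g.right = w ∧ t' - 2 * ((k + 1 : ℕ) + 1) + g.len = q)
    (z : ((ckCpx.obj M).X n).X w q) :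
    tc M i' (k + 1) t' g h' hg' (((ckCpx.obj M).d n n').f w q z) =
      (M.d i i').f .two t' (tc M i (k + 1) t' g h hg' z) +
        (i'.negOnePow : ℤ) • (M.X i').c t t' ht (tc M i' k t g h'' hg z) := by
  rw [tc_d_aux hn h' hg' z (proj_alpha_eq_zero hn (Nat.succ_ne_zero k) _)
    (proj_dM hn hi h h' hg' z.2) (proj_dL hn ht h'' h' hg hg' z.2)
    (proj_dR_eq_zero hn (.inr hgc) z.2), add_zero, zero_add]
  rfl

/-- The differential in the coordinates for `k + 1` and `c`. -/
theorem tc_d_succ_c {n n' : ℤ} (hn : n + 1 = n') {q : ℤ} {i i' : ℤ} {k : ℕ} {t t' : ℤ}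
    (hi : i + 1 = i') (ht : t + 2 = t')
    (h : i + ((k + 1 : ℕ) + 1) = n) (h' : i' + ((k + 1 : ℕ) + 1) = n') (h'' : i' + (k + 1) = n)
    (hg : Path.c.left = .two ∧ Path.c.right = .two ∧ t - 2 * (k + 1) + Path.c.len = q)
    (hg' : Path.c.left = .two ∧ Path.c.right = .two ∧ t' - 2 * ((k + 1 : ℕ) + 1) + Path.c.len = q)
    (he : Path.e2.left = .two ∧ Path.e2.right = .two ∧ t' - 2 * (k + 1) + Path.e2.len = q)
    (z : ((ckCpx.obj M).X n).X .two q) :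
    tc M i' (k + 1) t' .c h' hg' (((ckCpx.obj M).d n n').f .two q z) =
      (M.d i i').f .two t' (tc M i (k + 1) t' .c h hg' z) +
        ((i'.negOnePow : ℤ) • (M.X i').c t t' ht (tc M i' k t .c h'' hg z) +
          (n.negOnePow : ℤ) • tc M i' k t' .e2 h'' he z) := by
  -- As i' + (k + 1) = n, the sign of the bicomplex and the alternation of β and γ combine to
  -- (-1)^n, independently of k.
  have hs : (n.negOnePow : ℤ) = (i'.negOnePow : ℤ) * (-1) ^ (k + 1) := by
    rw [← h'', Int.negOnePow_add, Units.val_mul]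
    congr 1
  rw [hs, tc_d_aux hn h' hg' z (proj_alpha_eq_zero hn (Nat.succ_ne_zero k) _)
    (proj_dM hn hi h h' hg' z.2) (proj_dL hn ht h'' h' hg hg' z.2)
    (proj_dR hn h'' h' he hg' z.2), zero_add]
  rfl

theorem add_add_zero {A : Type} [AddCommGroup A] (x y : A) : x + (y + (0 + 0)) = y + x := by
  rw [add_zero, add_zero, add_comm]

theorem tc_d_zero_a {n n' : ℤ} (hn : n + 1 = n') {q : ℤ} {i t : ℤ} (hi : i + 1 = n)
    (ht : q + 1 = t) (h : i + ((0 : ℕ) + 1) = n) (h' : n + ((0 : ℕ) + 1) = n')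
    (hg : Path.a.left = .two ∧ Path.a.right = .one ∧ t - 2 * ((0 : ℕ) + 1) + Path.a.len = q)
    (z : ((ckCpx.obj M).X n).X .one q) :
    tc M n 0 t .a h' hg (((ckCpx.obj M).d n n').f .one q z) =
      (M.d i n).f .two t (tc M i 0 t .a h hg z) +
        (n.negOnePow : ℤ) • (M.X n).b q t ht (hd M z) := by
  subst ht
  exact (tc_d_aux hn h' hg z ((map_zsmul _ _ _).trans
      (congrArg _ (proj_first_self hn (hg := cond_a q) h' hg _)))
    (proj_dM hn hi h h' hg z.2) (proj_dL_zero hn rfl z.2)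
    (proj_dR_eq_zero hn (.inl rfl) z.2)).trans (add_add_zero _ _)

theorem tc_d_zero_e {n n' : ℤ} (hn : n + 1 = n') {q : ℤ} {i t : ℤ} (hi : i + 1 = n)
    (ht : q + 2 = t) (h : i + ((0 : ℕ) + 1) = n) (h' : n + ((0 : ℕ) + 1) = n')
    (hg : Path.e2.left = .two ∧ Path.e2.right = .two ∧ t - 2 * ((0 : ℕ) + 1) + Path.e2.len = q)
    (z : ((ckCpx.obj M).X n).X .two q) :
    tc M n 0 t .e2 h' hg (((ckCpx.obj M).d n n').f .two q z) =
      (M.d i n).f .two t (tc M i 0 t .e2 h hg z) +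
        (n.negOnePow : ℤ) • (M.X n).c q t ht (hd M z) := by
  subst ht
  exact (tc_d_aux hn h' hg z ((map_zsmul _ _ _).trans (congrArg _ ((map_add _ _ _).trans
      ((congrArg₂ (· + ·) (proj_first_self hn (hg := cond_e2 q) h' hg _)
        (proj_first_ne hn (hg := cond_c q) (.inr (show Path.e2 ≠ .c by decide)) _)).trans
          (add_zero _)))))
    (proj_dM hn hi h h' hg z.2) (proj_dL_zero hn rfl z.2)
    (proj_dR_eq_zero hn (.inl rfl) z.2)).trans (add_add_zero _ _)

theorem tc_d_zero_c {n n' : ℤ} (hn : n + 1 = n') {q : ℤ} {i : ℤ} (hi : i + 1 = n)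
    (h : i + ((0 : ℕ) + 1) = n) (h' : n + ((0 : ℕ) + 1) = n')
    (hg : Path.c.left = .two ∧ Path.c.right = .two ∧ q - 2 * ((0 : ℕ) + 1) + Path.c.len = q)
    (z : ((ckCpx.obj M).X n).X .two q) :
    tc M n 0 q .c h' hg (((ckCpx.obj M).d n n').f .two q z) =
      (M.d i n).f .two q (tc M i 0 q .c h hg z) + (n.negOnePow : ℤ) • hd M z := by
  exact (tc_d_aux hn h' hg z ((map_zsmul _ _ _).trans (congrArg _ ((map_add _ _ _).trans
      ((congrArg₂ (· + ·)
        (proj_first_ne hn (hg := cond_e2 q) (.inr (show Path.c ≠ .e2 by decide)) _)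
        (proj_first_self hn (hg := cond_c q) h' hg _)).trans (zero_add _)))))
    (proj_dM hn hi h h' hg z.2) (proj_dL_zero hn rfl z.2)
    (proj_dR_eq_zero hn (.inl rfl) z.2)).trans (add_add_zero _ _)

theorem tc_map {N : CochainComplex GrB ℤ} (f : M ⟶ N) {n : ℤ} {w : Vertex} {q : ℤ} {i : ℤ} {k : ℕ}
    {t : ℤ} {g : Path} (h : i + (k + 1) = n)
    (hg : g.left = .two ∧ g.right = w ∧ t - 2 * (k + 1) + g.len = q)
    (z : ((ckCpx.obj M).X n).X w q) :
    tc N i k t g h hg (((ckCpx.map f).f n).f w q z) = (f.f i).f .two t (tc M i k t g h hg z) := by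
  refine (congrArg (proj (S := tailShape n) (V N n) ⟨⟨i, k, t, h⟩, g, hg⟩) (zero_add _)).trans ?_
  exact proj_map (S := tailShape n) (T := tailShape n) (V := V M n) (W := V N n)
    (τ := fun j => j) (hτ := fun _ => ⟨rfl, rfl⟩) (φ := fun j => (f.f j.i).f .two j.t)
    Function.injective_id ⟨⟨i, k, t, h⟩, g, hg⟩ (hc := hg) z.2

theorem ext {n : ℤ} {w : Vertex} {q : ℤ} {z z' : ((ckCpx.obj M).X n).X w q}
    (h0 : hd M z = hd M z')
    (h : ∀ (i : ℤ) (k : ℕ) (t : ℤ) (g : Path) (h : i + (k + 1) = n)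
      (hg : g.left = .two ∧ g.right = w ∧ t - 2 * (k + 1) + g.len = q),
      tc M i k t g h hg z = tc M i k t g h hg z') : z = z' :=
  Prod.ext h0 (ext_proj (S := tailShape n) (V := V M n) fun ⟨⟨i, k, t, hj⟩, g, hg⟩ =>
    h i k t g hj hg)

/-- An index is determined by k and the path, and i ≥ b bounds k. Hence for M bounded below the
direct sum over k is effectively finite, and elements may be given by arbitrary coordinates. -/
theorem finite_idx (n : ℤ) (w : Vertex) (q b : ℤ) :
    {x : (tailShape n).Idx w q | b ≤ x.j.i}.Finite := by
  refine Set.Finite.of_injOn (f := fun x => (x.j.k, x.g))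
    (t := (Set.Iic (n - b).toNat) ×ˢ Set.univ) (fun x hx => ?_) (fun x _ x' _ e => ?_)
    ((Set.finite_Iic _).prod Set.finite_univ)
  · refine ⟨?_, trivial⟩
    have h1 := x.j.h
    have h2 : b ≤ x.j.i := hx
    change x.j.k ≤ (n - b).toNat
    omega
  · exact idx_ext (congrArg Prod.fst e) (congrArg Prod.snd e)

/-- Elements with given coordinates exist if `M` is bounded below. -/
theorem exists_tc {b : ℤ} (hb : ∀ v i j, i < b → Subsingleton ((M.X i).X v j)) {n : ℤ}
    {w : Vertex} {q : ℤ} (m : (M.X n).X w q)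
    (f : ∀ (i : ℤ) (k : ℕ) (t : ℤ) (g : Path) (_ : i + (k + 1) = n)
      (_ : g.left = .two ∧ g.right = w ∧ t - 2 * (k + 1) + g.len = q), (M.X i).X .two t) :
    ∃ z : ((ckCpx.obj M).X n).X w q, hd M z = m ∧
      ∀ i k t g h hg, tc M i k t g h hg z = f i k t g h hg := by
  obtain ⟨z, hz⟩ := exists_proj (S := tailShape n) (V := V M n) _ (finite_idx n w q b)
    (fun x hx => hb _ _ _ (not_le.1 hx)) fun x => f x.j.i x.j.k x.j.t x.g x.j.h x.cond
  exact ⟨(m, z), rfl, fun i k t g h hg => hz ⟨⟨i, k, t, h⟩, g, hg⟩⟩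

theorem tc_eq_zero {n : ℤ} {w : Vertex} {q : ℤ} {z : ((ckCpx.obj M).X n).X w q} {k : ℕ}
    {i i' t t' : ℤ} {g : Path} {h h' hg hg'} (hz : tc M i k t g h hg z = 0) :
    tc M i' k t' g h' hg' z = 0 := by
  obtain rfl : i = i' := by omega
  obtain rfl : t = t' := by omega
  exact hz

end CK

end JW

/-! ### Acyclicity of ℂ𝕂(M) e(2), and invariance of ℂ𝕂 under quasi-isomorphisms. -/

namespace JW

namespace CK

open Koszul

variable {M : CochainComplex GrB ℤ}

theorem right_eq_two {g : Path} (h : g.left = .two) (h' : g.right = .two) : g = .e2 ∨ g = .c := by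
  revert h h'; cases g <;> decide

theorem right_eq_one {g : Path} (h : g.left = .two) (h' : g.right = .one) : g = .a := by
  revert h h'; cases g <;> decide

theorem tc_cond_c {q t : ℤ} {k : ℕ}
    (hg : Path.e2.left = .two ∧ Path.e2.right = .two ∧ t - 2 * (k + 1) + Path.e2.len = q) :
    Path.c.left = .two ∧ Path.c.right = .two ∧ t - 2 * ((k + 1 : ℕ) + 1) + Path.c.len = q :=
  ⟨rfl, rfl, by have := hg.2.2; dsimp [Path.len] at this ⊢; omega⟩

/-- A contracting homotopy of `ℂ𝕂(M) e(2)` in coordinates. -/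
noncomputable def contrCoord (s : ℤ) {n n' q : ℤ} (hn : n + 1 = n')
    (x : ((ckCpx.obj M).X n').X .two q) (i : ℤ) (k : ℕ) (t : ℤ) : ∀ (g : Path)
    (_ : i + (k + 1) = n) (_ : g.left = .two ∧ g.right = .two ∧ t - 2 * (k + 1) + g.len = q),
    (M.X i).X .two t
  | .e2, h, hg => s • tc M i (k + 1) t .c (by omega) (tc_cond_c hg) x
  | _, _, _ => 0

/-- `ℂ𝕂(M) e(2)` has no cohomology if `M` is bounded below. -/
theorem acyc_two {b : ℤ} (hb : ∀ v i j, i < b → Subsingleton ((M.X i).X v j)) (q : ℤ) :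
    Acyc ((evB .two q).obj (ckCpx.obj M)) := by
  intro i j l hij hjl x hx
  change ((ckCpx.obj M).X j).X .two q at x
  change ((ckCpx.obj M).d j l).f .two q x = 0 at hx
  have hs : (j.negOnePow : ℤ) = -(i.negOnePow : ℤ) := by rw [← hij, negOnePow_add_one]
  have c0 : Path.c.left = .two ∧ Path.c.right = .two ∧ q - 2 * ((0 : ℕ) + 1) + Path.c.len = q :=
    ⟨rfl, rfl, by dsimp [Path.len]; omega⟩
  -- Up to sign, the differential maps the head identically to the c-coordinate for k = 0, and the
  -- e(2)-coordinate for k to the c-coordinate for k + 1. So y is read off from the c-coordinates of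
  -- x, and its own c-coordinates are zero.
  obtain ⟨y, hy0, hy⟩ := exists_tc hb (n := i) (w := .two) (q := q)
    ((i.negOnePow : ℤ) • tc M i 0 q .c (by omega) c0 x) (contrCoord i.negOnePow hij x)
  have hye {i' : ℤ} {k : ℕ} {t : ℤ} (h : i' + (k + 1) = i)
      (hg : Path.e2.left = .two ∧ Path.e2.right = .two ∧ t - 2 * (k + 1) + Path.e2.len = q) :
      tc M i' k t .e2 h hg y =
        (i.negOnePow : ℤ) • tc M i' (k + 1) t .c (by omega) (tc_cond_c hg) x := hy _ _ _ _ _ _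
  have hyc {i' : ℤ} {k : ℕ} {t : ℤ} (h : i' + (k + 1) = i)
      (hg : Path.c.left = .two ∧ Path.c.right = .two ∧ t - 2 * (k + 1) + Path.c.len = q) :
      tc M i' k t .c h hg y = 0 := hy _ _ _ _ _ _
  have z0 := tc_d_zero_c hjl (i := i) hij (by omega) (by omega) c0 x
  rw [hx, map_zero, hs, neg_smul, eq_comm, add_neg_eq_zero] at z0
  refine ⟨y, ?_⟩
  change ((ckCpx.obj M).d i j).f .two q y = x
  refine ext ?_ fun i' k t g h hg => ?_
  · rw [hd_d hij, hy0, map_zsmul, z0, smul_smul_negOnePow]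
  · rcases right_eq_two hg.1 hg.2.1 with rfl | rfl
    · have ht := hg.2.2
      dsimp only [Path.len] at ht
      -- The e(2)-coordinate of x is not used in y. It is recovered from d x = 0 in the c-coordinate
      -- for k + 1.
      have zs := tc_d_succ_c hjl (i := i' - 1) (i' := i') (k := k) (t := t - 2) (t' := t) (by ring)
        (by ring) (by push_cast; omega) (by push_cast; omega) h
        ⟨rfl, rfl, by dsimp [Path.len]; omega⟩ (tc_cond_c hg) hg x
      rw [hx, map_zero, hs, neg_smul, ← add_assoc, eq_comm, add_neg_eq_zero] at zs
      cases k with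
      | zero =>
        obtain rfl : i' = i := by omega
        obtain rfl : q = t - 2 := by push_cast at ht; omega
        refine (tc_d_zero_e hij (i := i' - 1) (by ring) (by omega) (by omega) h hg y).trans ?_
        rw [hye, hy0, ← smul_smul_negOnePow i' (tc M i' 0 t .e2 h hg x), ← zs, smul_add,
          map_zsmul, map_zsmul]
      | succ k =>
        refine (tc_d_succ hij (w := .two) (i := i' - 1) (t := t - 2) (by ring) (by ring) (by decide)
          (by omega) h (by push_cast at h; omega) ⟨rfl, rfl, by dsimp [Path.len]; omega⟩ hg y).trans ?_
        rw [hye, hye, ← smul_smul_negOnePow i (tc M i' (k + 1) t .e2 h hg x), ← zs, smul_add,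
          map_zsmul, map_zsmul, smul_comm]
    · cases k with
      | zero =>
        obtain rfl : i' = i := by omega
        obtain rfl : t = q := by have := hg.2.2; dsimp [Path.len] at this; omega
        refine (tc_d_zero_c hij (i := i' - 1) (by ring) (by omega) h hg y).trans ?_
        rw [hyc, map_zero, zero_add, hy0, smul_smul_negOnePow]
      | succ k =>
        have ht := hg.2.2
        dsimp only [Path.len] at ht
        refine (tc_d_succ_c hij (i := i' - 1) (t := t - 2) (by ring) (by ring)
          (by omega) h (by push_cast at h; omega) ⟨rfl, rfl, by dsimp [Path.len]; omega⟩ hg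
          ⟨rfl, rfl, by dsimp [Path.len]; omega⟩ y).trans ?_
        rw [hyc, hyc, hye, map_zero, map_zero, smul_zero, zero_add, zero_add, smul_smul_negOnePow]

/-- All terms except the differential of M come from the head or from a smaller k, where the
coordinates are assumed to vanish. -/
theorem tc_d_a {n n' : ℤ} (hn : n + 1 = n') {q : ℤ} {i i' : ℤ} {k : ℕ} {t : ℤ} (hi : i + 1 = i')
    (h : i + (k + 1) = n) (h' : i' + (k + 1) = n')
    (hg : Path.a.left = .two ∧ Path.a.right = .one ∧ t - 2 * (k + 1) + Path.a.len = q)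
    (z : ((ckCpx.obj M).X n).X .one q) (h0 : hd M z = 0)
    (hz : ∀ (k' : ℕ) (i t : ℤ) h hg, k' < k → tc M i k' t .a h hg z = 0) :
    tc M i' k t .a h' hg (((ckCpx.obj M).d n n').f .one q z) =
      (M.d i i').f .two t (tc M i k t .a h hg z) := by
  have ht := hg.2.2
  dsimp only [Path.len] at ht
  cases k with
  | zero =>
    obtain rfl : i' = n := by omega
    refine (tc_d_zero_a hn hi (by push_cast at ht; omega) h h' hg z).trans ?_
    rw [h0, map_zero, smul_zero, add_zero]
  | succ k =>
    refine (tc_d_succ hn (w := .one) (t := t - 2) hi (by ring) (by decide) h h'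
      (by push_cast at h'; omega) ⟨rfl, rfl, by dsimp [Path.len]; push_cast at ht; omega⟩
      hg z).trans ?_
    rw [hz k _ _ _ _ (Nat.lt_succ_self k), map_zero, smul_zero, add_zero]

/-- The filtration of `ℂ𝕂(M) e(1)` by the degree in `ℂ𝕂`. -/
noncomputable def columnsAux (M : CochainComplex GrB ℤ) (q : ℤ) :
    ℕ → CochainComplex (ModuleCat.{0} ℂ) ℤ
  | 0 => (evB .one q).obj M
  | k + 1 => reindex ((evB .two (q + 2 * k + 1)).obj M) (-(k + 1))

theorem tc_cond_a (q : ℤ) (k : ℕ) : Path.a.left = .two ∧ Path.a.right = .one ∧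
    q + 2 * k + 1 - 2 * (k + 1) + Path.a.len = q := ⟨rfl, rfl, by dsimp [Path.len]; ring⟩

/-- As e(2) B e(1) is spanned by a, there is one coordinate for each k: column 0 is M e(1), and the
later columns are shifts of M e(2). Boundedness below makes the filtration finite in each degree. -/
noncomputable def columns {b : ℤ} (hb : ∀ v i j, i < b → Subsingleton ((M.X i).X v j)) (q : ℤ) :
    Columns ((evB .one q).obj (ckCpx.obj M)) (fun k : ℕ => (k : ℤ)) (columnsAux M q) where
  pr n
    | 0 => hd M
    | k + 1 => tc M (n + -(k + 1)) k (q + 2 * k + 1) .a (by ring) (tc_cond_a q k)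
  exists_pr n k m := by
    cases k with
    | zero =>
      obtain ⟨z, h0, h⟩ := exists_tc hb (n := n) (w := .one) (q := q) m fun _ _ _ _ _ _ => 0
      refine ⟨z, h0, fun k hk => ?_⟩
      cases k with
      | zero => exact (hk rfl).elim
      | succ k => exact h _ _ _ _ _ _
    | succ k =>
      classical
      obtain ⟨z, h0, h⟩ := exists_tc hb (n := n) (w := .one) (q := q) 0 fun i k' t g h hg =>
        if e : i = n + -(k + 1) ∧ t = q + 2 * k + 1 then by
          rw [e.1, e.2]; exact m
        else 0
      refine ⟨z, (h _ _ _ _ _ _).trans (dif_pos ⟨rfl, rfl⟩), fun k' hk => ?_⟩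
      cases k' with
      | zero => exact h0
      | succ k' => exact (h _ _ _ _ _ _).trans (dif_neg fun e => hk (by
          have := e.2
          omega))
  lead n n' k z hn hz := by
    cases k with
    | zero => exact hd_d hn z
    | succ k =>
      exact tc_d_a hn (by omega) _ _ _ z (hz 0 (by positivity)) fun k' i t h hg hk =>
        tc_eq_zero (hz (k' + 1) (by simpa using hk))
  ext n z hz := by
    refine ext ?_ fun i k t g h hg => ?_
    · exact hz 0
    · obtain rfl := right_eq_one hg.1 hg.2.1
      exact (tc_eq_zero (hz (k + 1))).trans (map_zero _).symm
  bounded n := ⟨0, n - b + 1, fun k hk => by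
    cases k with
    | zero => exact hb _ _ _ (by
        have hk' : ((0 : ℕ) : ℤ) < 0 ∨ n - b + 1 ≤ ((0 : ℕ) : ℤ) := hk
        omega)
    | succ k => exact hb _ (n + -(k + 1)) _ (by
        have hk' : ((k + 1 : ℕ) : ℤ) < 0 ∨ n - b + 1 ≤ ((k + 1 : ℕ) : ℤ) := hk
        omega)⟩

/-- The maps induced on the columns. -/
noncomputable def columnsMap {M' : CochainComplex GrB ℤ} (f : M ⟶ M') (q : ℤ) :
    ∀ k, columnsAux M q k ⟶ columnsAux M' q k
  | 0 => (evB .one q).map f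
  | k + 1 => reindexMap ((evB .two (q + 2 * k + 1)).map f) (-(k + 1))

end CK

/-- On e(2) both complexes are acyclic, so only e(1) needs a comparison of columns. -/
theorem qisB_ckCpx_map {M M' : CochainComplex GrB ℤ} {f : M ⟶ M'} (hf : qisB f) {b : ℤ}
    (hb : ∀ v i j, i < b → Subsingleton ((M.X i).X v j))
    (hb' : ∀ v i j, i < b → Subsingleton ((M'.X i).X v j)) : qisB (ckCpx.map f) := by
  rw [qisB_iff] at hf ⊢
  intro w q
  cases w
  · refine (CK.columns hb q).coneExact (CK.columns hb' q) Nat.cast_injective _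
      (CK.columnsMap f q) (fun k => ?_) fun n k z => ?_
    · cases k with
      | zero => exact hf _ _
      | succ k => exact (hf _ _).reindexMap _
    · cases k with
      | zero => rfl
      | succ k => exact CK.tc_map f _ _ z
  · exact ConeExact.of_acyc _ (CK.acyc_two hb q) (CK.acyc_two hb' q)

theorem ckGt_inverts : qisBGt.IsInvertedBy (ckGt ⋙ qisBGt.Q) := fun M M' f hf => by
  obtain ⟨N, hN⟩ := M.property
  obtain ⟨N', hN'⟩ := M'.property
  exact Localization.inverts qisBGt.Q qisBGt (ckGt.map f) (qisB_ckCpx_map hf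
    (b := min (-N) (-N')) (fun v i j h => hN v i j (.inl (lt_of_lt_of_le h (min_le_left _ _))))
    fun v i j h => hN' v i j (.inl (lt_of_lt_of_le h (min_le_right _ _))))

end JW

/-! ### The projection ℂ𝕂(X) ⟶ X and when it is a quasi-isomorphism. -/

namespace JW

/-- In the resolution, b is the inclusion of the c-component and a is the projection onto the
e(2)-component. This makes the sequence Y e(1) → Y e(2) → Y e(1) short exact. -/
theorem acyc_koszulCpx_resCpx_two (N : CochainComplex GrC ℤ) (q : ℤ) :
    Acyc ((evB .two q).obj (koszulCpx.obj (resCpx.obj N))) :=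
  Koszul.acyc_two (Y := resCpx.obj N)
    (fun n i j h (m : KX N n (i - 2)) hm => by
      have hm' : KX.cast N n (by omega : i - 2 = j - 3) m = 0 := congrArg Prod.snd hm
      exact funext fun y => congrFun hm' ⟨y.k, y.i, y.t, y.hi, y.ht.trans (by omega)⟩)
    (fun n i j k h h' (m : KX N n (j - 1) × KX N n (j - 3)) hm => by
      have hm' : KX.cast N n (by omega : j - 1 = k - 2) m.1 = 0 := hm
      refine ⟨KX.cast N n (by omega : j - 3 = i - 2) m.2, Prod.ext ?_ rfl⟩
      exact funext fun y => (congrFun hm' ⟨y.k, y.i, y.t, y.hi, y.ht.trans (by omega)⟩).symm)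
    (fun n i j h (m : KX N n (j - 2)) => ⟨(KX.cast N n (by omega : j - 2 = i - 1) m, 0), rfl⟩) q

/-- The projection `ℂ𝕂(X) ⟶ X`. -/
noncomputable def ckEta : ckCpx ⟶ 𝟭 (CochainComplex GrB ℤ) where
  app X :=
    { f := fun n =>
        { f := fun v q => LinearMap.fst ℂ _ _
          comm_a := fun _ _ _ _ => rfl
          comm_b := fun _ _ _ _ => rfl }
      comm' := fun n n' (h : n + 1 = n') =>
        GrB.hom_ext fun v q z => (CK.hd_d (M := X) h z).symm }
  naturality X X' f := rfl

namespace CK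

variable {M : CochainComplex GrB ℤ}

/-- A complex, as the first of a sequence of complexes whose other terms are zero. -/
noncomputable def onlyCol (K : CochainComplex (ModuleCat.{0} ℂ) ℤ) :
    ℕ → CochainComplex (ModuleCat.{0} ℂ) ℤ
  | 0 => K
  | _ + 1 => { X := fun _ => ModuleCat.of ℂ PUnit, d := 0 }

/-- The filtration of `K` with the only subquotient `K`. -/
noncomputable def onlyColumns (K : CochainComplex (ModuleCat.{0} ℂ) ℤ) :
    Columns K (fun k : ℕ => (k : ℤ)) (onlyCol K) where
  pr n
    | 0 => LinearMap.id
    | _ + 1 => 0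
  exists_pr n k m := by
    cases k with
    | zero =>
      refine ⟨m, rfl, fun k hk => ?_⟩
      cases k with
      | zero => exact (hk rfl).elim
      | succ k => rfl
    | succ k =>
      refine ⟨0, rfl, fun k' _ => ?_⟩
      cases k' with
      | zero => rfl
      | succ k' => rfl
  lead n n' k z hn hz := by
    cases k <;> rfl
  ext n z hz := hz 0
  bounded n := ⟨0, 1, fun k hk => by
    cases k with
    | zero =>
      have hk' : ((0 : ℕ) : ℤ) < 0 ∨ 1 ≤ ((0 : ℕ) : ℤ) := hk
      omega
    | succ k => exact inferInstanceAs (Subsingleton PUnit)⟩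

/-- The maps induced by the projection `ℂ𝕂(M) ⟶ M` on the columns. -/
noncomputable def onlyColMap (M : CochainComplex GrB ℤ) (q : ℤ) :
    ∀ k, columnsAux M q k ⟶ onlyCol ((evB .one q).obj M) k
  | 0 => 𝟙 _
  | _ + 1 => 0

end CK

/-- On e(1) the kernel of the projection has shifts of X e(2) as subquotients, and these are acyclic
by `hX`. On e(2) source and target are both acyclic. -/
theorem qisB_ckEta {X : CochainComplex GrB ℤ} {b : ℤ}
    (hb : ∀ v i j, i < b → Subsingleton ((X.X i).X v j))
    (hX : ∀ q, Acyc ((evB .two q).obj X)) : qisB (ckEta.app X) := by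
  rw [qisB_iff]
  intro w q
  cases w
  · refine (CK.columns hb q).coneExact (CK.onlyColumns _) Nat.cast_injective _
      (CK.onlyColMap X q) (fun k => ?_) fun n k z => ?_
    · cases k with
      | zero => exact ConeExact.of_bijective _ fun i => Function.bijective_id
      | succ k =>
        refine ConeExact.of_acyc _ (fun i j l hij hjl => ?_) fun i j l _ _ x _ => ⟨0, rfl⟩
        exact hX (q + 2 * k + 1) _ _ _ (by omega) (by omega)
    · cases k <;> rfl
  · exact ConeExact.of_acyc _ (CK.acyc_two hb q) (hX q)

end JW

/-! ### The counit from the resolution of π̃ M to M. -/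

namespace JW

namespace GrB

/-- The identification of `M_q e(v)` for equal `q`. -/
def tr (M : GrB) {v : Vertex} {q q' : ℤ} (h : q = q') : M.X v q →ₗ[ℂ] M.X v q' :=
  h ▸ LinearMap.id

variable {M N : GrB}

theorem f_tr (φ : M ⟶ N) {v : Vertex} {q q' : ℤ} (h : q = q') (m : M.X v q) :
    φ.f v q' (M.tr h m) = N.tr h (φ.f v q m) := by
  subst h; rfl

theorem tr_c {i q q' : ℤ} (h : q = q') (hq : i + 2 = q) (m : M.X .two i) :
    M.tr h (M.c i q hq m) = M.c i q' (by omega) m := by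
  subst h; rfl

theorem c_tr {q q' j : ℤ} (h : q = q') (hj : q' + 2 = j) (m : M.X .two q) :
    M.c q' j hj (M.tr h m) = M.c q j (by omega) m := by
  subst h; rfl

theorem a_c {i j k : ℤ} (h : i + 2 = j) (h' : j + 1 = k) (m : M.X .two i) :
    M.a j k h' (M.c i j h m) = 0 := M.ba _ _ _ _ _ _

theorem b_a {i j k : ℤ} (h : i + 1 = j) (h' : j + 1 = k) (m : M.X .two i) :
    M.b j k h' (M.a i j h m) = M.c i k (by omega) m := by
  subst h; rfl

theorem c_b {i j k : ℤ} (h : i + 1 = j) (h' : j + 2 = k) (m : M.X .one i) :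
    M.c j k h' (M.b i j h m) = 0 := by
  have := M.ba i j (j + 1) h rfl m
  simp [c, this]

end GrB

namespace Eps

open KX Res

variable (M : CochainComplex GrB ℤ)

/-- The counit `resCpx (π̃ M) ⟶ M` in `e(2)`. -/
def two (n q : ℤ) :
    (KX (piC.obj M) n (q - 1) × KX (piC.obj M) n (q - 3)) →ₗ[ℂ] (M.X n).X .two q :=
  ((M.X n).tr (by ring : q - 1 + 1 = q)).comp ((rhoAux (piC.obj M) n (q - 1)).comp
    ((KX.cast _ n (by ring)).prodMap (KX.cast _ n (by ring))))

theorem two_d {n n' : ℤ} (h : n + 1 = n') (q : ℤ)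
    (u : KX (piC.obj M) n (q - 1) × KX (piC.obj M) n (q - 3)) :
    (M.d n n').f .two q (two M n q u) = two M n' q (D (piC.obj M) 1 n n' (q - 1) h u.1,
      D (piC.obj M) 1 n n' (q - 3) h u.2 + S (piC.obj M) n n' (q - 1) (q - 3) h (by ring) u.1) := by
  refine (GrB.f_tr (M.d n n') _ _).trans (congrArg ((M.X n').tr _) ?_)
  exact rhoAux_d (piC.obj M) h (q - 1) _

theorem two_inr {n q t : ℤ} (h : t + 1 + 2 = q) (u : KX (piC.obj M) n (q - 3)) :
    two M n q (0, u) =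
      (M.X n).c (t + 1) q h (u ⟨0, n, t, by simp, by push_cast; omega⟩) := by
  obtain rfl : t = q - 1 - 2 := by omega
  refine (congrArg ((M.X n).tr _) (zero_add _)).trans ?_
  exact GrB.tr_c (i := q - 1 - 2 + 1) (by ring) (by ring) _

theorem two_inl {n q t : ℤ} (h : t + 1 = q) (u : KX (piC.obj M) n (q - 1)) :
    two M n q (u, 0) = (M.X n).tr h (u ⟨0, n, t, by simp, by push_cast; omega⟩) := by
  obtain rfl : t = q - 1 := by omega
  exact congrArg ((M.X n).tr _) ((congrArg (_ + ·)
    (map_zero ((M.X n).c (q - 1 - 2 + 1) (q - 1 + 1) (by ring)))).trans (add_zero _))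

theorem a_two_inr {n q j : ℤ} (h : q + 1 = j) (u : KX (piC.obj M) n (q - 3)) :
    (M.X n).a q j h (two M n q (0, u)) = 0 := by
  rw [two_inr M (t := q - 3) (by ring)]
  exact GrB.a_c _ _ _

/-- The counit `resCpx (π̃ M) ⟶ M` in `e(1)`. -/
noncomputable def one (n q : ℤ) : KX (piC.obj M) n (q - 2) →ₗ[ℂ] (M.X n).X .one q :=
  ((M.X n).a (q - 1) q (by ring)).comp ((two M n (q - 1)).comp
    ((LinearMap.inl ℂ _ _).comp (KX.cast _ n (by ring))))

/-- As c a = 0, the component of c contributes nothing after multiplication by a. -/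
theorem a_two {n q j : ℤ} (h : q + 1 = j)
    (u : KX (piC.obj M) n (q - 1) × KX (piC.obj M) n (q - 3)) :
    (M.X n).a q j h (two M n q u) = one M n j (KX.cast _ n (by omega) u.1) := by
  obtain rfl : q = j - 1 := by omega
  have : u = (u.1, 0) + (0, u.2) := by simp
  conv_lhs => rw [this]
  rw [map_add, map_add, a_two_inr, add_zero]
  rfl

theorem b_one {n q j : ℤ} (h : q + 1 = j) (u : KX (piC.obj M) n (q - 2)) :
    (M.X n).b q j h (one M n q u) = two M n j (0, KX.cast _ n (by omega) u) := by
  refine (GrB.b_a _ _ _).trans ?_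
  rw [two_inr M (t := q - 1 - 1) (by omega), LinearMap.comp_apply, LinearMap.comp_apply]
  refine (congrArg _ (two_inl M (t := q - 1 - 1) (by omega) _)).trans ?_
  exact GrB.c_tr _ _ _

/-- The counit `resCpx (π̃ M) ⟶ M`. -/
noncomputable def mod (n : ℤ) : resMod (piC.obj M) n ⟶ M.X n where
  f
    | .one, q => one M n q
    | .two, q => two M n q
  comm_a i j h m := (a_two M h m).symm
  comm_b i j h m := (b_one M h m).symm

end Eps

/-- The counit `resCpx (π̃ M) ⟶ M`. -/
noncomputable def eps : piC ⋙ resCpx ⟶ 𝟭 _ where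
  app M :=
    { f := fun n => Eps.mod M n
      comm' := fun n n' (h : n + 1 = n') => GrB.hom_ext fun v q m => by
        cases v
        · refine Eq.trans ?_ (congrArg (Eps.one M n' q) (Res.obj_d_one (piC.obj M) h q m).symm)
          change (M.d n n').f .one q ((M.X n).a (q - 1) q _ _) = (M.X n').a (q - 1) q _ _
          rw [GrB.Hom.comm_a]
          refine (congrArg ((M.X n').a (q - 1) q _) (Eps.two_d M h (q - 1) _)).trans ?_
          rw [Eps.a_two]
          rfl
        · exact (Eps.two_d M h q m).trans
            (congrArg (Eps.two M n' q) (Res.obj_d_two (piC.obj M) h q m).symm) }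
  naturality M M' f := by
    have two (n q : ℤ) (u : KX (piC.obj M) n (q - 1) × KX (piC.obj M) n (q - 3)) :
        Eps.two M' n q (KX.map (piC.map f) n (q - 1) u.1, KX.map (piC.map f) n (q - 3) u.2) =
          (f.f n).f .two q (Eps.two M n q u) := by
      refine Eq.trans ?_ (GrB.f_tr (f.f n) _ _).symm
      refine congrArg ((M'.X n).tr _) ?_
      exact congrArg (fun χ : piC.obj (resCpx.obj (piC.obj M)) ⟶ piC.obj M' =>
        GrC.Hom.f (χ.f n) (q - 1) (KX.cast (piC.obj M) n (by ring : q - 1 = q - 1 + 1 - 1) u.1,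
          KX.cast (piC.obj M) n (by ring : q - 3 = q - 1 + 1 - 3) u.2))
        (Res.rho_naturality (piC.map f))
    refine HomologicalComplex.hom_ext _ _ fun n => GrB.hom_ext fun v q m => ?_
    cases v
    · refine Eq.trans ?_ ((f.f n).comm_a _ _ _ _).symm
      refine congrArg ((M'.X n).a (q - 1) q (by ring)) ?_
      refine Eq.trans ?_ (two n (q - 1) _)
      refine congrArg (Eps.two M' n (q - 1)) (Prod.ext rfl (map_zero _).symm)
    · exact two n q m

/-- Both maps are n ⊗ p ↦ n p. So π̃ turns the counit into a quasi-isomorphism, although the counit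
itself need not be one: it says nothing about complexes killed by π̃. -/
theorem piC_map_eps (M : CochainComplex GrB ℤ) : piC.map (eps.app M) = Res.rho (piC.obj M) := by
  refine HomologicalComplex.hom_ext _ _ fun n => GrC.hom_ext fun q m => ?_
  have gen (q' : ℤ) (h : q' = q) (h' : q' + 1 = q + 1)
      (u : KX (piC.obj M) n (q + 1 - 1) × KX (piC.obj M) n (q + 1 - 3)) :
      (M.X n).tr h' (Res.rhoAux (piC.obj M) n q' (KX.cast _ n (by omega) u.1,
        KX.cast _ n (by omega) u.2)) = Res.rhoAux (piC.obj M) n q u := by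
    subst h; rfl
  exact gen _ (by ring) _ m

end JW

/-! ### Right multiplication in the coordinates of 𝔻 M, and coordinates of ℂ𝕂(𝔻 M) e(1). -/

namespace JW

namespace Shape

variable {S : Shape} {V : S.J → ModuleCat.{0} ℂ}

theorem proj_act {α : Path} {v w : Vertex} {n n' : ℤ} {hw : α.right = w} {h : n + α.len = n'}
    (j : S.J) (g k : Path) (hk : g.mul α = some k) {hg hc}
    (inj : ∀ x : S.Idx v n, x.j = j → x.g.mul α = some k → x = ⟨j, g, hg⟩) (z : S.Comp V v n) :
    proj V ⟨j, k, hc⟩ (S.act V α v w n n' hw h z) = proj V ⟨j, g, hg⟩ z := by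
  refine CK.proj_eq_of_lof (F := S.act V α v w n n' hw h) ⟨j, k, hc⟩ ⟨j, g, hg⟩ LinearMap.id
    (fun m => ?_) (fun x' m hx' => ?_) z
  · rw [act_ten, S.ten_congr V (g := (some g).bind fun k => k.mul α) (g' := some k) hk
      (hg' := by rintro _ ⟨⟩; exact hc)]
    exact proj_lof_self (V := V) ⟨j, k, hc⟩ m
  · rw [act_ten]
    exact CK.proj_ten_eq_zero (fun e e' => hx' (inj x' e e')) m

theorem proj_act_eq_zero {α : Path} {v w : Vertex} {n n' : ℤ} {hw : α.right = w}
    {h : n + α.len = n'} (y : S.Idx w n') (hy : ∀ g : Path, g.mul α = some y.g → False)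
    (z : S.Comp V v n) : proj V y (S.act V α v w n n' hw h z) = 0 := by
  suffices H : (proj V y).comp (S.act V α v w n n' hw h) = 0 from LinearMap.congr_fun H z
  refine DirectSum.linearMap_ext _ fun x' => LinearMap.ext fun m => ?_
  change proj V y (S.act V α v w n n' hw h
    (DirectSum.lof ℂ (S.Idx v n) (fun x => V x.j) x' m)) = 0
  rw [lof_eq_ten, act_ten]
  exact CK.proj_ten_eq_zero (fun _ e' => hy x'.g e') m

end Shape

theorem Path.mul_right_inj {g g' α k : Path} (h : g.mul α = some k) (h' : g'.mul α = some k) :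
    g = g' := by
  revert h h'; cases g <;> cases g' <;> cases α <;> cases k <;> decide

namespace Koszul

open Shape

variable {M : CochainComplex GrB ℤ} {p : ℤ} {i j : ℤ}

theorem co_a_a {r s : ℤ} (h : r + s = p) (hij : i + 1 = j)
    (he : Path.e2.left = Vertex.one.other ∧ Path.e2.right = .two ∧ -s + Path.e2.len = i)
    (hc : Path.a.left = Vertex.one.other ∧ Path.a.right = .one ∧ -s + Path.a.len = j)
    (z : ((koszulCpx.obj M).X p).X .two i) :
    co M r s .one .a h hc (((koszulCpx.obj M).X p).a i j hij z) = co M r s .one .e2 h he z :=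
  proj_act (S := koszulShape p) (V := V M p) (hw := Path.right_a) (h := Path.add_len_a hij)
    ⟨r, s, .one, h⟩ .e2 .a rfl
    (fun _ _ e' => idx_ext (Path.mul_right_inj e' rfl)) z

theorem co_b_c {r s : ℤ} (h : r + s = p) (hij : i + 1 = j)
    (he : Path.a.left = Vertex.one.other ∧ Path.a.right = .one ∧ -s + Path.a.len = i)
    (hc : Path.c.left = Vertex.one.other ∧ Path.c.right = .two ∧ -s + Path.c.len = j)
    (z : ((koszulCpx.obj M).X p).X .one i) :
    co M r s .one .c h hc (((koszulCpx.obj M).X p).b i j hij z) = co M r s .one .a h he z :=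
  proj_act (S := koszulShape p) (V := V M p) (hw := Path.right_b) (h := Path.add_len_b hij)
    ⟨r, s, .one, h⟩ .a .c rfl
    (fun _ _ e' => idx_ext (Path.mul_right_inj e' rfl)) z

theorem co_b_b {r s : ℤ} (h : r + s = p) (hij : i + 1 = j)
    (he : Path.e1.left = Vertex.two.other ∧ Path.e1.right = .one ∧ -s + Path.e1.len = i)
    (hc : Path.b.left = Vertex.two.other ∧ Path.b.right = .two ∧ -s + Path.b.len = j)
    (z : ((koszulCpx.obj M).X p).X .one i) :
    co M r s .two .b h hc (((koszulCpx.obj M).X p).b i j hij z) = co M r s .two .e1 h he z :=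
  proj_act (S := koszulShape p) (V := V M p) (hw := Path.right_b) (h := Path.add_len_b hij)
    ⟨r, s, .two, h⟩ .e1 .b rfl
    (fun _ _ e' => idx_ext (Path.mul_right_inj e' rfl)) z

theorem co_b_e2 {r s : ℤ} (h : r + s = p) (hij : i + 1 = j)
    (hc : Path.e2.left = Vertex.one.other ∧ Path.e2.right = .two ∧ -s + Path.e2.len = j)
    (z : ((koszulCpx.obj M).X p).X .one i) :
    co M r s .one .e2 h hc (((koszulCpx.obj M).X p).b i j hij z) = 0 :=
  proj_act_eq_zero (S := koszulShape p) (V := V M p) (hw := Path.right_b) (h := Path.add_len_b hij)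
    ⟨⟨r, s, .one, h⟩, .e2, hc⟩
    (fun g e' => by cases g <;> cases e') z

/-- Since e(2) c = c and b c = c c = 0, right multiplication by c on (𝔻 M) e(2) only moves the
e(2)-coordinate to the c-coordinate. With the next two lemmas this describes it completely. -/
theorem co_c_c {r s : ℤ} (h : r + s = p) (hij : i + 2 = j)
    (he : Path.e2.left = Vertex.one.other ∧ Path.e2.right = .two ∧ -s + Path.e2.len = i)
    (hc : Path.c.left = Vertex.one.other ∧ Path.c.right = .two ∧ -s + Path.c.len = j)
    (z : ((koszulCpx.obj M).X p).X .two i) :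
    co M r s .one .c h hc (((koszulCpx.obj M).X p).c i j hij z) = co M r s .one .e2 h he z :=
  (co_b_c h (by omega) ⟨rfl, rfl, by
    have := he.2.2
    dsimp [Path.len] at this ⊢
    omega⟩ hc _).trans (co_a_a h rfl he _ z)

theorem co_c_e2 {r s : ℤ} (h : r + s = p) (hij : i + 2 = j)
    (hc : Path.e2.left = Vertex.one.other ∧ Path.e2.right = .two ∧ -s + Path.e2.len = j)
    (z : ((koszulCpx.obj M).X p).X .two i) :
    co M r s .one .e2 h hc (((koszulCpx.obj M).X p).c i j hij z) = 0 :=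
  co_b_e2 (i := i + 1) h (by omega) hc _

theorem co_c_b {r s : ℤ} (h : r + s = p) (hij : i + 2 = j)
    (hc : Path.b.left = Vertex.two.other ∧ Path.b.right = .two ∧ -s + Path.b.len = j)
    (z : ((koszulCpx.obj M).X p).X .two i) :
    co M r s .two .b h hc (((koszulCpx.obj M).X p).c i j hij z) = 0 := by
  have he : Path.e1.left = Vertex.two.other ∧ Path.e1.right = .one ∧ -s + Path.e1.len = i + 1 :=
    ⟨rfl, rfl, by
      have := hc.2.2
      dsimp [Path.len] at this ⊢
      omega⟩
  refine (co_b_b h (by omega) he hc _).trans ?_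
  exact proj_act_eq_zero (S := koszulShape p) (V := V M p) (hw := Path.right_a) (h := Path.add_len_a rfl)
    ⟨⟨r, s, .two, h⟩, .e1, he⟩
    (fun g e' => by cases g <;> cases e') z

end Koszul

/-! ### Coordinates of `ℂ𝕂(𝔻 M) e(1)` -/

namespace CKD

open CK Koszul

variable (M : CochainComplex GrB ℤ)

theorem cond_tail {q s : ℤ} {k : ℕ} {g : Path} (hq : g.len - s - 2 * k - 1 = q) :
    Path.a.left = .two ∧ Path.a.right = .one ∧ -s + g.len - 2 * (k + 1) + Path.a.len = q :=
  ⟨rfl, rfl, by have : Path.a.len = 1 := rfl; omega⟩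

/-- The coordinate of `ℂ𝕂(𝔻 M) e(1)` in `M^r_s e(v)` which belongs to a path `g` and to the summand
`𝔻 M ⊗_B ℂ𝕂^(k+1)`. -/
noncomputable def dc {n q : ℤ} (r s : ℤ) (v : Vertex) (g : Path) (k : ℕ)
    (h : r + s + (k + 1) = n) (hq : g.len - s - 2 * k - 1 = q) (hg : g.left = v.other)
    (hg' : g.right = .two) :
    ((ckCpx.obj (koszulCpx.obj M)).X n).X .one q →ₗ[ℂ] (M.X r).X v s :=
  (co M r s v g rfl ⟨hg, hg', rfl⟩).comp
    (tc (koszulCpx.obj M) (r + s) k (-s + g.len) .a h (cond_tail hq))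

/-- The coordinate of `ℂ𝕂(𝔻 M) e(1)` in `M^r_s e(v)` which belongs to a path `g` and to the summand
`𝔻 M ⊗_B ℂ𝕂^0`. -/
noncomputable def hc {n q : ℤ} (r s : ℤ) (v : Vertex) (g : Path)
    (h : r + s = n) (hg : g.left = v.other ∧ g.right = .one ∧ -s + g.len = q) :
    ((ckCpx.obj (koszulCpx.obj M)).X n).X .one q →ₗ[ℂ] (M.X r).X v s :=
  (co M r s v g h hg).comp (hd (koszulCpx.obj M))

variable {M} {n n' q : ℤ}

theorem dc_eq {r s i t : ℤ} {v : Vertex} {g : Path} {k : ℕ} (hi : r + s = i)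
    (hg : g.left = v.other ∧ g.right = .two ∧ -s + g.len = t) (h : i + (k + 1) = n)
    (ht : Path.a.left = .two ∧ Path.a.right = .one ∧ t - 2 * (k + 1) + Path.a.len = q)
    (z : ((ckCpx.obj (koszulCpx.obj M)).X n).X .one q) :
    co M r s v g hi hg (tc (koszulCpx.obj M) i k t .a h ht z) =
      dc M r s v g k (by omega) (by have := ht.2.2; dsimp [Path.len] at this; omega) hg.1 hg.2.1 z := by
  subst hi
  obtain ⟨h1, h2, rfl⟩ := hg
  rfl

theorem ext {z z' : ((ckCpx.obj (koszulCpx.obj M)).X n).X .one q}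
    (h0 : ∀ r s v g h hg, hc M r s v g h hg z = hc M r s v g h hg z')
    (h : ∀ r s v g k h hq hg hg', dc M r s v g k h hq hg hg' z = dc M r s v g k h hq hg hg' z') :
    z = z' := by
  refine CK.ext ?_ fun i k t g hi hg => ?_
  · exact Koszul.ext fun g hg r s v h hg' => h0 r s v g h hg'
  · obtain rfl := right_eq_one hg.1 hg.2.1
    refine Koszul.ext fun g hg1 r s v hr hg2 => ?_
    refine (dc_eq hr hg2 hi hg z).trans ((h _ _ _ _ _ _ _ _ _).trans (dc_eq hr hg2 hi hg z').symm)

theorem dc_map {M' : CochainComplex GrB ℤ} (f : M ⟶ M') {r s : ℤ} {v : Vertex} {g : Path} {k : ℕ}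
    (h : r + s + (k + 1) = n) (hq : g.len - s - 2 * k - 1 = q) (hg : g.left = v.other)
    (hg' : g.right = .two) (z : ((ckCpx.obj (koszulCpx.obj M)).X n).X .one q) :
    dc M' r s v g k h hq hg hg' (((ckCpx.map (koszulCpx.map f)).f n).f .one q z) =
      (f.f r).f v s (dc M r s v g k h hq hg hg' z) :=
  (congrArg (co M' r s v g rfl ⟨hg, hg', rfl⟩)
    (tc_map (koszulCpx.map f) h (cond_tail hq) z)).trans (co_map f _ _ _)

variable (M) in
/-- The coordinate of `ℂ𝕂(𝔻 M) e(1)` which belongs to `e(2)` and to `𝔻 M ⊗_B ℂ𝕂^(k+1)`. -/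
noncomputable def dE (r s : ℤ) (k : ℕ) (h : r + s + (k + 1) = n)
    (hq : Path.e2.len - s - 2 * k - 1 = q) :
    ((ckCpx.obj (koszulCpx.obj M)).X n).X .one q →ₗ[ℂ] (M.X r).X .one s :=
  dc M r s .one .e2 k h hq rfl rfl

variable (M) in
/-- The coordinate of `ℂ𝕂(𝔻 M) e(1)` which belongs to `b` and to `𝔻 M ⊗_B ℂ𝕂^(k+1)`. -/
noncomputable def dB (r s : ℤ) (k : ℕ) (h : r + s + (k + 1) = n)
    (hq : Path.b.len - s - 2 * k - 1 = q) :
    ((ckCpx.obj (koszulCpx.obj M)).X n).X .one q →ₗ[ℂ] (M.X r).X .two s :=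
  dc M r s .two .b k h hq rfl rfl

variable (M) in
/-- The coordinate of `ℂ𝕂(𝔻 M) e(1)` which belongs to `c` and to `𝔻 M ⊗_B ℂ𝕂^(k+1)`. -/
noncomputable def dC (r s : ℤ) (k : ℕ) (h : r + s + (k + 1) = n)
    (hq : Path.c.len - s - 2 * k - 1 = q) :
    ((ckCpx.obj (koszulCpx.obj M)).X n).X .one q →ₗ[ℂ] (M.X r).X .one s :=
  dc M r s .one .c k h hq rfl rfl

theorem dB_map {M' : CochainComplex GrB ℤ} (f : M ⟶ M') {r s : ℤ} {k : ℕ}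
    (h : r + s + (k + 1) = n) (hq : Path.b.len - s - 2 * k - 1 = q)
    (z : ((ckCpx.obj (koszulCpx.obj M)).X n).X .one q) :
    dB M' r s k h hq (((ckCpx.map (koszulCpx.map f)).f n).f .one q z) =
      (f.f r).f .two s (dB M r s k h hq z) := dc_map f _ _ _ _ z

theorem dC_map {M' : CochainComplex GrB ℤ} (f : M ⟶ M') {r s : ℤ} {k : ℕ}
    (h : r + s + (k + 1) = n) (hq : Path.c.len - s - 2 * k - 1 = q)
    (z : ((ckCpx.obj (koszulCpx.obj M)).X n).X .one q) :
    dC M' r s k h hq (((ckCpx.map (koszulCpx.map f)).f n).f .one q z) =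
      (f.f r).f .one s (dC M r s k h hq z) := dc_map f _ _ _ _ z

/-- Elements with given coordinates exist if `𝔻 M` is bounded below. -/
theorem exists_dc {b : ℤ} (hb : ∀ v i j, i < b → Subsingleton (((koszulCpx.obj M).X i).X v j))
    (m : ((koszulCpx.obj M).X n).X .one q)
    (f : ∀ (k : ℕ) (i t : ℤ) (_ : i + (k + 1) = n) (_ : t - 2 * k - 1 = q),
      ((koszulCpx.obj M).X i).X .two t) :
    ∃ z : ((ckCpx.obj (koszulCpx.obj M)).X n).X .one q,
      (∀ r s v g h hg, hc M r s v g h hg z = co M r s v g h hg m) ∧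
      (∀ r s k h hq, dE M r s k h hq z =
        co M r s .one .e2 rfl ⟨rfl, rfl, rfl⟩ (f k (r + s) (-s + Path.e2.len) h (by omega))) ∧
      (∀ r s k h hq, dB M r s k h hq z =
        co M r s .two .b rfl ⟨rfl, rfl, rfl⟩ (f k (r + s) (-s + Path.b.len) h (by omega))) ∧
      (∀ r s k h hq, dC M r s k h hq z =
        co M r s .one .c rfl ⟨rfl, rfl, rfl⟩ (f k (r + s) (-s + Path.c.len) h (by omega))) := by
  obtain ⟨z, h0, h⟩ := exists_tc hb (n := n) (w := .one) (q := q) m fun i k t g h hg =>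
    f k i t h (by
      obtain rfl := right_eq_one hg.1 hg.2.1
      have := hg.2.2
      dsimp [Path.len] at this
      omega)
  exact ⟨z, fun r s v g _ hg => congrArg (co M r s v g _ hg) h0,
    fun r s k _ _ => congrArg (co M r s .one .e2 rfl ⟨rfl, rfl, rfl⟩) (h _ _ _ _ _ _),
    fun r s k _ _ => congrArg (co M r s .two .b rfl ⟨rfl, rfl, rfl⟩) (h _ _ _ _ _ _),
    fun r s k _ _ => congrArg (co M r s .one .c rfl ⟨rfl, rfl, rfl⟩) (h _ _ _ _ _ _)⟩

end CKD

end JW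

/-! ### The differential of ℂ𝕂(𝔻 M) e(1) in coordinates. -/

namespace JW

namespace CKD

open CK Koszul

variable {M : CochainComplex GrB ℤ} {n n' q : ℤ}

/-- On e(1) only the half x ⊗ g ↦ x c ⊗ g of β and γ survives, because the other half would involve
c a = 0. -/
theorem dc_d_succ (hn : n + 1 = n') {r r' s : ℤ} {v : Vertex} {g : Path} {k : ℕ} (hr : r + 1 = r')
    (h : r + s + ((k + 1 : ℕ) + 1) = n) (h' : r' + s + ((k + 1 : ℕ) + 1) = n')
    (hq : g.len - s - 2 * (k + 1 : ℕ) - 1 = q) (hg : g.left = v.other) (hg' : g.right = .two)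
    (z : ((ckCpx.obj (koszulCpx.obj M)).X n).X .one q) :
    dc M r' s v g (k + 1) h' hq hg hg' (((ckCpx.obj (koszulCpx.obj M)).d n n').f .one q z) =
      co M r' s v g rfl ⟨hg, hg', rfl⟩ (((koszulCpx.obj M).d (r + s) (r' + s)).f .two (-s + g.len)
        (tc (koszulCpx.obj M) (r + s) (k + 1) (-s + g.len) .a h (cond_tail hq) z)) +
      ((r' + s).negOnePow : ℤ) • co M r' s v g rfl ⟨hg, hg', rfl⟩
        (((koszulCpx.obj M).X (r' + s)).c (-s + g.len - 2) (-s + g.len) (by ring)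
          (tc (koszulCpx.obj M) (r' + s) k (-s + g.len - 2) .a (by push_cast at h'; omega)
            ⟨rfl, rfl, by have : Path.a.len = 1 := rfl; push_cast at hq; omega⟩ z)) := by
  refine (congrArg (co M r' s v g rfl ⟨hg, hg', rfl⟩) (tc_d_succ hn (w := .one) (i := r + s)
    (t := -s + g.len - 2) (by omega) (by ring) (by decide) h h' (by push_cast at h'; omega)
      ⟨rfl, rfl, by have : Path.a.len = 1 := rfl; push_cast at hq; omega⟩
      (cond_tail hq) z)).trans ?_
  rw [map_add, map_zsmul]
  rfl

/-- The first column is reached from the head by e(1) ↦ b ⊗ a, so right multiplication by b takes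
the place of that by c. -/
theorem dc_d_zero (hn : n + 1 = n') {r r' s : ℤ} {v : Vertex} {g : Path} (hr : r + 1 = r')
    (h : r + s + ((0 : ℕ) + 1) = n) (h' : r' + s + ((0 : ℕ) + 1) = n')
    (hq : g.len - s - 2 * (0 : ℕ) - 1 = q) (hg : g.left = v.other) (hg' : g.right = .two)
    (z : ((ckCpx.obj (koszulCpx.obj M)).X n).X .one q) :
    dc M r' s v g 0 h' hq hg hg' (((ckCpx.obj (koszulCpx.obj M)).d n n').f .one q z) =
      co M r' s v g rfl ⟨hg, hg', rfl⟩ (((koszulCpx.obj M).d (r + s) (r' + s)).f .two (-s + g.len)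
        (tc (koszulCpx.obj M) (r + s) 0 (-s + g.len) .a h (cond_tail hq) z)) +
      (n.negOnePow : ℤ) • co M r' s v g (by push_cast at h; omega)
        ⟨hg, hg', by push_cast at hq; omega⟩
        (((koszulCpx.obj M).X n).b q (q + 1) rfl (hd (koszulCpx.obj M) z)) := by
  obtain rfl : n = r' + s := by push_cast at h; omega
  obtain rfl : q = -s + g.len - 1 := by push_cast at hq; omega
  refine (congrArg (co M r' s v g rfl ⟨hg, hg', rfl⟩) (tc_d_zero_a hn (i := r + s)
    (by omega) (by ring) h h' (cond_tail hq) z)).trans ?_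
  rw [map_add, map_zsmul]
  have gen (t : ℤ) (ht : -s + g.len - 1 + 1 = t) (h1 : -s + g.len = t) :
      co M r' s v g rfl ⟨hg, hg', h1⟩ (((koszulCpx.obj M).X (r' + s)).b (-s + g.len - 1) t ht
        (hd (koszulCpx.obj M) z)) =
      co M r' s v g rfl ⟨hg, hg', by ring⟩ (((koszulCpx.obj M).X (r' + s)).b (-s + g.len - 1)
        (-s + g.len - 1 + 1) rfl (hd (koszulCpx.obj M) z)) := by
    subst ht; rfl
  exact congrArg (fun y => _ + (((r' + s).negOnePow : ℤ) • y)) (gen _ (by ring) rfl)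

/-- The differential in the coordinates of `e(2)`. -/
theorem dc_d_e2 (hn : n + 1 = n') {r r' s : ℤ} {k : ℕ} (hr : r + 1 = r')
    (h : r + s + (k + 1) = n) (h' : r' + s + (k + 1) = n')
    (hq : Path.e2.len - s - 2 * k - 1 = q)
    (z : ((ckCpx.obj (koszulCpx.obj M)).X n).X .one q) :
    dE M r' s k h' hq (((ckCpx.obj (koszulCpx.obj M)).d n n').f .one q z) =
      (M.d r r').f .one s (dE M r s k h hq z) := by
  cases k with
  | zero =>
    refine (dc_d_zero hn hr h h' hq rfl rfl z).trans ?_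
    rw [co_b_e2, smul_zero, add_zero]
    exact co_d_idem (by omega) rfl hr rfl rfl _ _
  | succ k =>
    refine (dc_d_succ hn hr h h' hq rfl rfl z).trans ?_
    rw [co_c_e2, smul_zero, add_zero]
    exact co_d_idem (by omega) rfl hr rfl rfl _ _

/-- The differential in the coordinates of `b`. -/
theorem dc_d_b (hn : n + 1 = n') {r r' s s' : ℤ} {k : ℕ} (hr : r + 1 = r') (hs : s + 1 = s')
    (h : r + s' + ((k + 1 : ℕ) + 1) = n) (h' : r' + s' + ((k + 1 : ℕ) + 1) = n')
    (h'' : r' + s + ((k + 1 : ℕ) + 1) = n)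
    (hq : Path.b.len - s' - 2 * (k + 1 : ℕ) - 1 = q)
    (hq' : Path.e2.len - s - 2 * (k + 1 : ℕ) - 1 = q)
    (z : ((ckCpx.obj (koszulCpx.obj M)).X n).X .one q) :
    dB M r' s' (k + 1) h' hq
        (((ckCpx.obj (koszulCpx.obj M)).d n n').f .one q z) =
      (M.d r r').f .two s' (dB M r s' (k + 1) h hq z) +
        ((r + s').negOnePow : ℤ) • (M.X r').b s s' hs
          (dE M r' s (k + 1) h'' hq' z) := by
  refine (dc_d_succ hn hr h h' hq rfl rfl z).trans ?_
  rw [co_c_b, smul_zero, add_zero]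
  refine (co_d (v := .one) (g := .e2) (by omega) hr hs rfl rfl rfl (by omega)
    ⟨rfl, rfl, by dsimp [Path.len]; omega⟩ ⟨rfl, rfl, rfl⟩ _).trans ?_
  exact congrArg (fun y => _ + (((r + s').negOnePow : ℤ) • (M.X r').b s s' hs y))
    (dc_eq (by omega) _ _ _ z)

/-- The differential in the coordinates of `c`. -/
theorem dc_d_c (hn : n + 1 = n') {r r' s s' : ℤ} {k : ℕ} (hr : r + 1 = r') (hs : s + 1 = s')
    (h : r + s' + ((k + 1 : ℕ) + 1) = n) (h' : r' + s' + ((k + 1 : ℕ) + 1) = n')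
    (h'' : r' + s + ((k + 1 : ℕ) + 1) = n) (h3 : r' + s' + (k + 1) = n)
    (hq : Path.c.len - s' - 2 * (k + 1 : ℕ) - 1 = q)
    (hq' : Path.b.len - s - 2 * (k + 1 : ℕ) - 1 = q) (hq3 : Path.e2.len - s' - 2 * k - 1 = q)
    (z : ((ckCpx.obj (koszulCpx.obj M)).X n).X .one q) :
    dC M r' s' (k + 1) h' hq
        (((ckCpx.obj (koszulCpx.obj M)).d n n').f .one q z) =
      (M.d r r').f .one s' (dC M r s' (k + 1) h hq z) +
        ((r + s').negOnePow : ℤ) • (M.X r').a s s' hs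
          (dB M r' s (k + 1) h'' hq' z) +
        ((r' + s').negOnePow : ℤ) • dE M r' s' k h3 hq3 z := by
  refine (dc_d_succ hn hr h h' hq rfl rfl z).trans ?_
  refine congrArg₂ (fun y y' => y + ((r' + s').negOnePow : ℤ) • y') ?_ ?_
  · refine (co_d (v := .two) (g := .b) (by omega) hr hs rfl rfl rfl (by omega)
      ⟨rfl, rfl, by dsimp [Path.len]; omega⟩ ⟨rfl, rfl, rfl⟩ _).trans ?_
    exact congrArg (fun y => _ + (((r + s').negOnePow : ℤ) • (M.X r').a s s' hs y))
      (dc_eq (by omega) _ _ _ z)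
  · exact (co_c_c rfl (by ring) ⟨rfl, rfl, by dsimp [Path.len]; ring⟩ ⟨rfl, rfl, rfl⟩ _).trans
      (dc_eq rfl _ _ _ z)

/-- The differential in the coordinates of `b` with `k = 0`. -/
theorem dc_d_zero_b (hn : n + 1 = n') {r r' s s' : ℤ} (hr : r + 1 = r') (hs : s + 1 = s')
    (h : r + s' + ((0 : ℕ) + 1) = n) (h' : r' + s' + ((0 : ℕ) + 1) = n')
    (h'' : r' + s + ((0 : ℕ) + 1) = n) (h3 : r' + s' = n)
    (hq : Path.b.len - s' - 2 * (0 : ℕ) - 1 = q) (hq' : Path.e2.len - s - 2 * (0 : ℕ) - 1 = q)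
    (h3' : Path.e1.left = Vertex.two.other ∧ Path.e1.right = .one ∧ -s' + Path.e1.len = q)
    (z : ((ckCpx.obj (koszulCpx.obj M)).X n).X .one q) :
    dB M r' s' 0 h' hq (((ckCpx.obj (koszulCpx.obj M)).d n n').f .one q z) =
      (M.d r r').f .two s' (dB M r s' 0 h hq z) +
        ((r + s').negOnePow : ℤ) • (M.X r').b s s' hs (dE M r' s 0 h'' hq' z) +
        (n.negOnePow : ℤ) • hc M r' s' .two .e1 h3 h3' z := by
  refine (dc_d_zero hn hr h h' hq rfl rfl z).trans ?_
  refine congrArg₂ (fun y y' => y + (n.negOnePow : ℤ) • y') ?_ ?_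
  · refine (co_d (v := .one) (g := .e2) (by omega) hr hs rfl rfl rfl (by omega)
      ⟨rfl, rfl, by dsimp [Path.len]; omega⟩ ⟨rfl, rfl, rfl⟩ _).trans ?_
    exact congrArg (fun y => _ + (((r + s').negOnePow : ℤ) • (M.X r').b s s' hs y))
      (dc_eq (by omega) _ _ _ z)
  · exact co_b_b h3 rfl h3' _ _

/-- The differential in the coordinates of `c` with `k = 0`. -/
theorem dc_d_zero_c (hn : n + 1 = n') {r r' s s' : ℤ} (hr : r + 1 = r') (hs : s + 1 = s')
    (h : r + s' + ((0 : ℕ) + 1) = n) (h' : r' + s' + ((0 : ℕ) + 1) = n')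
    (h'' : r' + s + ((0 : ℕ) + 1) = n) (h3 : r' + s' = n)
    (hq : Path.c.len - s' - 2 * (0 : ℕ) - 1 = q) (hq' : Path.b.len - s - 2 * (0 : ℕ) - 1 = q)
    (h3' : Path.a.left = Vertex.one.other ∧ Path.a.right = .one ∧ -s' + Path.a.len = q)
    (z : ((ckCpx.obj (koszulCpx.obj M)).X n).X .one q) :
    dC M r' s' 0 h' hq (((ckCpx.obj (koszulCpx.obj M)).d n n').f .one q z) =
      (M.d r r').f .one s' (dC M r s' 0 h hq z) +
        ((r + s').negOnePow : ℤ) • (M.X r').a s s' hs (dB M r' s 0 h'' hq' z) +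
        (n.negOnePow : ℤ) • hc M r' s' .one .a h3 h3' z := by
  refine (dc_d_zero hn hr h h' hq rfl rfl z).trans ?_
  refine congrArg₂ (fun y y' => y + (n.negOnePow : ℤ) • y') ?_ ?_
  · refine (co_d (v := .two) (g := .b) (by omega) hr hs rfl rfl rfl (by omega)
      ⟨rfl, rfl, by dsimp [Path.len]; omega⟩ ⟨rfl, rfl, rfl⟩ _).trans ?_
    exact congrArg (fun y => _ + (((r + s').negOnePow : ℤ) • (M.X r').a s s' hs y))
      (dc_eq (by omega) _ _ _ z)
  · exact co_b_c h3 rfl h3' _ _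

/-- The differential in the coordinate of `e(1)`. -/
theorem hc_d_e1 (hn : n + 1 = n') {r r' s : ℤ} (hr : r + 1 = r') (h : r + s = n) (h' : r' + s = n')
    (hg : Path.e1.left = Vertex.two.other ∧ Path.e1.right = .one ∧ -s + Path.e1.len = q)
    (z : ((ckCpx.obj (koszulCpx.obj M)).X n).X .one q) :
    hc M r' s .two .e1 h' hg (((ckCpx.obj (koszulCpx.obj M)).d n n').f .one q z) =
      (M.d r r').f .two s (hc M r s .two .e1 h hg z) :=
  (congrArg (co M r' s .two .e1 h' hg) (hd_d hn z)).trans (co_d_idem hn rfl hr h h' hg _)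

/-- The differential in the coordinate of `a`. -/
theorem hc_d_a (hn : n + 1 = n') {r r' s s' : ℤ} (hr : r + 1 = r') (hs : s + 1 = s')
    (h : r + s' = n) (h' : r' + s' = n') (h'' : r' + s = n)
    (hg : Path.e1.left = Vertex.two.other ∧ Path.e1.right = .one ∧ -s + Path.e1.len = q)
    (hg' : Path.a.left = Vertex.one.other ∧ Path.a.right = .one ∧ -s' + Path.a.len = q)
    (z : ((ckCpx.obj (koszulCpx.obj M)).X n).X .one q) :
    hc M r' s' .one .a h' hg' (((ckCpx.obj (koszulCpx.obj M)).d n n').f .one q z) =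
      (M.d r r').f .one s' (hc M r s' .one .a h hg' z) +
        (n.negOnePow : ℤ) • (M.X r').a s s' hs (hc M r' s .two .e1 h'' hg z) :=
  (congrArg (co M r' s' .one .a h' hg') (hd_d hn z)).trans
    (co_d (v := .two) (g := .e1) hn hr hs rfl h h' h'' hg hg' _)

end CKD

end JW

/-! ### The projection of ℂ𝕂(𝔻 M) e(1) onto a strand of π̃ M. -/

namespace JW

namespace CKD

open CK Koszul

variable {M : CochainComplex GrB ℤ} {n n' q : ℤ}

theorem ext_cases {z z' : ((ckCpx.obj (koszulCpx.obj M)).X n).X .one q}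
    (h1 : ∀ r s h hg, hc M r s .two .e1 h hg z = hc M r s .two .e1 h hg z')
    (h2 : ∀ r s h hg, hc M r s .one .a h hg z = hc M r s .one .a h hg z')
    (h3 : ∀ r s k h hq, dE M r s k h hq z = dE M r s k h hq z')
    (h4 : ∀ r s k h hq, dB M r s k h hq z = dB M r s k h hq z')
    (h5 : ∀ r s k h hq, dC M r s k h hq z = dC M r s k h hq z') :
    z = z' := by
  refine ext (fun r s v g h hg => ?_) fun r s v g k h hq hg hg' => ?_
  · obtain ⟨rfl, rfl⟩ | ⟨rfl, rfl⟩ : (g = .e1 ∧ v = .two) ∨ (g = .a ∧ v = .one) := by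
      obtain ⟨hg1, hg2, -⟩ := hg
      revert hg1 hg2
      cases g <;> cases v <;> decide
    · exact h1 r s h hg
    · exact h2 r s h hg
  · obtain ⟨rfl, rfl⟩ | ⟨rfl, rfl⟩ | ⟨rfl, rfl⟩ :
        (g = .e2 ∧ v = .one) ∨ (g = .b ∧ v = .two) ∨ (g = .c ∧ v = .one) := by
      revert hg hg'
      cases g <;> cases v <;> decide
    · exact h3 r s k h hq
    · exact h4 r s k h hq
    · exact h5 r s k h hq

theorem cond_b {t : ℤ} {k : ℕ} (h : t + 2 * k = -q - 3) :
    Path.b.len - (t + 1) - 2 * (k + 1 : ℕ) - 1 = q := by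
  dsimp [Path.len]; omega

theorem cond_c {t : ℤ} {k : ℕ} (h : t + 2 * k = -q - 3) :
    Path.c.len - t - 2 * (k + 2 : ℕ) - 1 = q := by
  dsimp [Path.len]; omega

/-- The map from `ℂ𝕂(𝔻 M) e(1)` to a strand of `π̃ M`. -/
noncomputable def p (M : CochainComplex GrB ℤ) (n q : ℤ) :
    ((ckCpx.obj (koszulCpx.obj M)).X n).X .one q →ₗ[ℂ] KX (piC.obj M) (n + q) (-q - 3) :=
  -- Write E_k, B_k, C_k for the coordinates `dE`, `dB`, `dC`. The differential identifies, up to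
  -- sign, E_k with C_(k+1), the head coordinate of e(1) with B_0, and the head coordinate of a with
  -- C_0. The survivors are B_(k+1). The correction by C_(k+2) is the one of Gaussian elimination,
  -- needed since E_(k+1) also maps to B_(k+1) through b.
  LinearMap.pi fun y =>
    (dB M y.i (y.t + 1) (y.k + 1) (by have := y.hi; have := y.ht; push_cast; omega) (cond_b y.ht)) -
    ((M.X y.i).b y.t (y.t + 1) rfl).comp (dC M y.i y.t (y.k + 2) (by have := y.hi; have := y.ht; push_cast; omega) (cond_c y.ht))

theorem p_apply (u : ((ckCpx.obj (koszulCpx.obj M)).X n).X .one q) {k : ℕ} {i t : ℤ}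
    (hi : i = n + q + k) (ht : t + 2 * k = -q - 3) :
    p M n q u ⟨k, i, t, hi, ht⟩ =
      (dB M i (t + 1) (k + 1) (by push_cast; omega) (cond_b ht) u) -
      (M.X i).b t (t + 1) rfl (dC M i t (k + 2) (by push_cast; omega) (cond_c ht) u) := rfl

theorem p_D_aux {A : Type} [AddCommGroup A] (x y z w : A) (σ τ : ℤ) (h : τ = -σ) :
    x + σ • y - (z + τ • w + σ • y) = x - z + σ • w := by
  subst h; rw [neg_smul]; abel

/-- The contributions of E_(k+1) to the two terms of `p` cancel. The term of B_(k+2) in C_(k+2) is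
multiplied by a and then by b, which gives the action of x = c. -/
theorem p_D (h : n + 1 = n') (u : ((ckCpx.obj (koszulCpx.obj M)).X n).X .one q) :
    p M n' q (((ckCpx.obj (koszulCpx.obj M)).d n n').f .one q u) =
      KX.D (piC.obj M) (q + 1).negOnePow (n + q) (n' + q) (-q - 3) (by omega) (p M n q u) := by
  refine funext fun ⟨k, i, t, hi, ht⟩ => ?_
  change p M n' q (((ckCpx.obj (koszulCpx.obj M)).d n n').f .one q u) ⟨k, i, t, hi, ht⟩ =
    (M.d (i - 1) i).f .two (t + 1) (p M n q u ⟨k, i - 1, t, by omega, ht⟩) +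
      (((q + 1).negOnePow * i.negOnePow : ℤˣ) : ℤ) • (M.X i).c (t - 2 + 1) (t + 1) (by omega)
        (p M n q u ⟨k + 1, i, t - 2, by push_cast; omega, by push_cast; omega⟩)
  rw [p_apply, p_apply, p_apply]
  have h1 : Path.e2.len - t - 2 * (k + 1 : ℕ) - 1 = q := by dsimp [Path.len]; push_cast; omega
  rw [dc_d_b (n := n) (n' := n') h (r := i - 1) (r' := i) (s := t) (by ring) rfl
      (by push_cast; omega) _ (by push_cast; omega) (cond_b ht) h1 u,
    dc_d_c (n := n) (n' := n') h (r := i - 1) (r' := i) (s := t - 2 + 1) (by ring) (by ring)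
      (by push_cast; omega) _ (by push_cast; omega) (by push_cast; omega) (cond_c ht)
      (cond_b (by push_cast; omega)) h1 u]
  have e1 : (i - 1 + (t + 1)).negOnePow = (i + t).negOnePow := by
    rw [show i - 1 + (t + 1) = i + t by ring]
  have e2 : ((i - 1 + t).negOnePow : ℤ) = -((i + t).negOnePow : ℤ) := by
    rw [show i + t = i - 1 + t + 1 by ring, negOnePow_add_one, neg_neg]
  -- As t = -q - 3 - 2k, t has the parity of q + 1. This is why the strand has ε = (-1)^(q+1).
  have e3 : (q + 1).negOnePow * i.negOnePow = (i + t).negOnePow := by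
    rw [← Int.negOnePow_add, Int.negOnePow_eq_iff]
    exact ⟨q + k + 2, by omega⟩
  rw [e1, e3, map_add, map_add, map_zsmul, map_zsmul, map_sub, map_sub, GrB.c_b, sub_zero,
    GrB.b_a, ← d_f_comm_b]
  exact p_D_aux _ _ _ _ _ _ e2

theorem p_map {M' : CochainComplex GrB ℤ} (f : M ⟶ M')
    (u : ((ckCpx.obj (koszulCpx.obj M)).X n).X .one q) :
    p M' n q (((ckCpx.map (koszulCpx.map f)).f n).f .one q u) =
      KX.map (piC.map f) (n + q) (-q - 3) (p M n q u) := by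
  refine funext fun ⟨k, i, t, hi, ht⟩ => ?_
  change _ = (f.f i).f .two (t + 1) (p M n q u ⟨k, i, t, hi, ht⟩)
  rw [p_apply, p_apply, dB_map, dC_map, map_sub, GrB.Hom.comm_b]

variable {b : ℤ}

/-- The B-coordinates for positive k can be prescribed freely, with all other coordinates zero. -/
theorem p_surjective (hb : ∀ v i j, i < b → Subsingleton (((koszulCpx.obj M).X i).X v j))
    (y : KX (piC.obj M) (n + q) (-q - 3)) : ∃ u, p M n q u = y := by
  obtain ⟨u, -, -, hB, hC⟩ := exists_dc (M := M) (n := n) (q := q) hb 0 fun k i t hi ht =>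
    match k, hi, ht with
    | 0, _, _ => 0
    | k + 1, hi, ht =>
      single (n + q + k) (-q - 3 - 2 * k + 1) .two .b (by push_cast at hi; omega)
        ⟨rfl, rfl, by dsimp [Path.len]; push_cast at ht; omega⟩
        (y ⟨k, n + q + k, -q - 3 - 2 * k, rfl, by ring⟩)
  refine ⟨u, funext fun ⟨k, i, t, hi, ht⟩ => ?_⟩
  rw [p_apply, hB, hC]
  subst hi
  obtain rfl : t = -q - 3 - 2 * k := by omega
  refine (congrArg₂ (fun z z' : (M.X (n + q + k)).X .two (-q - 3 - 2 * k + 1) => z - z')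
    (co_single_self _ _ _) ((congrArg _ (co_single_ne _ _ _ _ (by decide) _)).trans
      (map_zero _))).trans (sub_zero _)

end CKD

end JW

/-! ### Contraction of the kernel of the projection. -/

namespace JW

namespace CKD

open CK Koszul

variable {M : CochainComplex GrB ℤ} {n n' q b : ℤ}

theorem co_single_dC {i t r s r' s' : ℤ} {k : ℕ} (u : ((ckCpx.obj (koszulCpx.obj M)).X n).X .one q)
    (hr : r' = r) (hs : s' = s) (c : ℤ) {h : r' + s' = i}
    {hg : Path.e2.left = Vertex.one.other ∧ Path.e2.right = .two ∧ -s' + Path.e2.len = t}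
    {h' : r + s = i}
    {hg' : Path.e2.left = Vertex.one.other ∧ Path.e2.right = .two ∧ -s + Path.e2.len = t}
    {h1 : r' + s' + (k + 1) = n} {h2 : Path.c.len - s' - 2 * k - 1 = q}
    {h1' : r + s + (k + 1) = n} {h2' : Path.c.len - s - 2 * k - 1 = q} :
    co M r s .one .e2 h' hg' (single r' s' .one .e2 h hg (c • dC M r' s' k h1 h2 u)) =
      c • dC M r s k h1' h2' u := by
  subst hr; subst hs
  exact co_single_self _ _ _

theorem cond_c' {t : ℤ} {k : ℕ} (h : t - 2 * k - 1 = q) :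
    Path.c.len - -t - 2 * (k + 1 : ℕ) - 1 = q := by
  dsimp [Path.len]; push_cast; omega

/-- A contraction of the kernel of `p`. -/
theorem exists_contr (hb : ∀ v i j, i < b → Subsingleton (((koszulCpx.obj M).X i).X v j))
    (hn : n + 1 = n') (u : ((ckCpx.obj (koszulCpx.obj M)).X n').X .one q) :
    ∃ v : ((ckCpx.obj (koszulCpx.obj M)).X n).X .one q,
      (∀ r s s' (hs : s + 1 = s') h hg h1 h2 h3 h4, hc M r s' .two .e1 h hg v =
        (n.negOnePow : ℤ) • (dB M r s' 0 h1 h2 u -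
          (M.X r).b s s' hs (dC M r s 1 h3 h4 u))) ∧
      (∀ r s h hg h1 h2, hc M r s .one .a h hg v = (n.negOnePow : ℤ) • dC M r s 0 h1 h2 u) ∧
      (∀ r s k h hq h1 h2, dE M r s k h hq v =
        ((r + s).negOnePow : ℤ) • dC M r s (k + 1) h1 h2 u) ∧
      (∀ r s k h hq, dB M r s k h hq v = 0) ∧ (∀ r s k h hq, dC M r s k h hq v = 0) := by
  -- Each cancelling pair is inverted: E_k comes from C_(k+1), and the head coordinates of e(1) and
  -- a come from B_0 and C_0. The coordinate B_0 of the differential also receives b E_0, where E_0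
  -- is C_1 up to sign, and the term with C_1 compensates for this.
  let m1 : (M.X (n + q)).X .two (-q) := (n.negOnePow : ℤ) •
    (dB M (n + q) (-q) 0 (by push_cast; omega) (by dsimp [Path.len]; ring) u -
      (M.X (n + q)).b (-q - 1) (-q) (by ring) (dC M (n + q) (-q - 1) 1 (by push_cast; omega)
        (by dsimp [Path.len]; ring) u))
  let m2 : (M.X (n + q - 1)).X .one (1 - q) := (n.negOnePow : ℤ) •
    dC M (n + q - 1) (1 - q) 0 (by push_cast; omega) (by dsimp [Path.len]; ring) u
  have c1 : Path.e1.left = Vertex.two.other ∧ Path.e1.right = .one ∧ -(-q) + Path.e1.len = q :=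
    ⟨rfl, rfl, by dsimp [Path.len]; ring⟩
  have c2 : Path.a.left = Vertex.one.other ∧ Path.a.right = .one ∧ -(1 - q) + Path.a.len = q :=
    ⟨rfl, rfl, by dsimp [Path.len]; ring⟩
  obtain ⟨v, h0, hE, hB, hC⟩ := exists_dc (M := M) (n := n) (q := q) hb
    (single (n + q) (-q) .two .e1 (by ring) c1 m1 + single (n + q - 1) (1 - q) .one .a (by ring) c2 m2)
    fun k i t hi ht => single (i + t) (-t) .one .e2 (by ring)
      ⟨rfl, rfl, by dsimp [Path.len]; ring⟩
      ((i.negOnePow : ℤ) • dC M (i + t) (-t) (k + 1) (by push_cast; omega) (cond_c' ht) u)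
  refine ⟨v, ?_, ?_, ?_, ?_, ?_⟩
  · intro r s s' hs h hg h1 h2 h3 h4
    have hg3 := hg.2.2
    dsimp only [Path.len] at hg3
    obtain rfl : s' = -q := by omega
    obtain rfl : r = n + q := by omega
    obtain rfl : s = -q - 1 := by omega
    rw [h0, map_add]
    refine (congrArg₂ (· + ·) (co_single_self _ _ _) (co_single_ne _ _ _ _ (by decide) _)).trans ?_
    exact add_zero _
  · intro r s h hg h1 h2
    have hg3 := hg.2.2
    dsimp only [Path.len] at hg3
    obtain rfl : s = 1 - q := by omega
    obtain rfl : r = n + q - 1 := by omega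
    rw [h0, map_add]
    refine (congrArg₂ (· + ·) (co_single_ne _ _ _ _ (by decide) _) (co_single_self _ _ _)).trans ?_
    exact zero_add _
  · intro r s k h hq h1 h2
    rw [hE]
    exact co_single_dC u (by dsimp [Path.len]; ring) (by dsimp [Path.len]; ring) _
  · intro r s k h hq
    rw [hB]
    exact co_single_ne _ _ _ _ (by decide) _
  · intro r s k h hq
    rw [hC]
    exact co_single_ne _ _ _ _ (by decide) _

theorem dB_eq_of_p_eq_zero {u : ((ckCpx.obj (koszulCpx.obj M)).X n).X .one q} (hu : p M n q u = 0)
    {r s s' : ℤ} {k : ℕ} (hs : s + 1 = s') {h hq h' hq'} :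
    dB M r s' (k + 1) h hq u = (M.X r).b s s' hs (dC M r s (k + 2) h' hq' u) := by
  subst hs
  have hq2 : Path.c.len - s - 2 * (k + 2 : ℕ) - 1 = q := hq'
  dsimp only [Path.len] at hq2
  push_cast at hq2 h'
  exact sub_eq_zero.1 ((p_apply u (k := k) (i := r) (t := s) (by omega) (by omega)).symm.trans
    (congrFun hu _))

theorem eq_smul_of_add {A : Type} [AddCommGroup A] {x y z : A} {m n : ℤ}
    (h : 0 = x + (n.negOnePow : ℤ) • y + (m.negOnePow : ℤ) • z) (hm : m = n + 1) :
    (n.negOnePow : ℤ) • (x + (n.negOnePow : ℤ) • y) = z := by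
  subst hm
  rw [negOnePow_add_one, neg_smul, eq_comm, add_neg_eq_zero] at h
  rw [h, smul_smul_negOnePow]

/-- On the kernel B_(k+1) is determined by C_(k+2), and for a cycle E_k is d C_(k+1) up to sign.
Thus such a cycle is governed by the coordinates from which `exists_contr` builds its primitive. The
primitive lies in the kernel because its B- and C-coordinates vanish. -/
theorem acyc_ker_p (hb : ∀ v i j, i < b → Subsingleton (((koszulCpx.obj M).X i).X v j))
    {n'' : ℤ} (hn : n + 1 = n') (hn' : n' + 1 = n'')
    {u : ((ckCpx.obj (koszulCpx.obj M)).X n').X .one q} (hp : p M n' q u = 0)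
    (hu : ((ckCpx.obj (koszulCpx.obj M)).d n' n'').f .one q u = 0) :
    ∃ v, ((ckCpx.obj (koszulCpx.obj M)).d n n').f .one q v = u ∧ p M n q v = 0 := by
  obtain ⟨v, v1, v2, vE, vB, vC⟩ := exists_contr hb hn u
  -- On the kernel B_(k+1) is a multiple of b, so multiplication by a kills it.
  have ha (r s s' : ℤ) (k : ℕ) (hs : s + 1 = s') (h hq) :
      (M.X r).a s s' hs (dB M r s (k + 1) h hq u) = 0 := by
    have hq2 : Path.b.len - s - 2 * (k + 1 : ℕ) - 1 = q := hq
    dsimp only [Path.len] at hq2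
    push_cast at hq2
    rw [dB_eq_of_p_eq_zero (s := s - 1) (k := k) hp (by ring) (h' := by push_cast at h ⊢; omega)
      (hq' := by dsimp [Path.len]; push_cast; omega)]
    exact (M.X r).ba _ _ _ _ _ _
  -- With the term in a gone, the C-coordinate of d u = 0 relates only C_(k+1) and E_k.
  have hdC (r r' s : ℤ) (k : ℕ) (hr : r + 1 = r') (h hq h' hq') :
      (M.d r r').f .one s (dC M r s (k + 1) h hq u) =
        ((r + s).negOnePow : ℤ) • dE M r' s k h' hq' u := by
    have hq2 : Path.c.len - s - 2 * (k + 1 : ℕ) - 1 = q := hq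
    dsimp only [Path.len] at hq2
    push_cast at hq2 h
    have := dc_d_c (M := M) hn' (r := r) (r' := r') (s := s - 1) (s' := s) (k := k) hr (by ring)
      (by push_cast; omega) (by push_cast; omega) (by push_cast; omega) h' hq
      (by dsimp [Path.len]; push_cast; omega) hq' u
    have e : ((r' + s).negOnePow : ℤ) = -((r + s).negOnePow : ℤ) := by
      rw [show r' + s = r + s + 1 by omega, negOnePow_add_one]
    rw [hu, map_zero, ha, smul_zero, add_zero, e, neg_smul, eq_comm, add_neg_eq_zero] at this
    exact this
  have mem : p M n q v = 0 := by
    refine funext fun ⟨k, i, t, hi, ht⟩ => ?_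
    rw [p_apply, vB, vC, map_zero, sub_zero]
    rfl
  refine ⟨v, ext_cases ?_ ?_ ?_ ?_ ?_, mem⟩
  · intro r s h hg
    have hg3 := hg.2.2
    dsimp only [Path.len] at hg3
    have H1 : Path.b.len - (s) - 2 * (0 : ℕ) - 1 = q := by dsimp [Path.len]; omega
    have H2 : Path.c.len - (s - 1) - 2 * (1 : ℕ) - 1 = q := by dsimp [Path.len]; omega
    have H3 : Path.e2.len - (s - 1) - 2 * (0 : ℕ) - 1 = q := by dsimp [Path.len]; omega
    have h1 := hdC (r - 1) r (s - 1) 0 (by ring) (by push_cast; omega)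
      H2 (by push_cast; omega) H3
    have h2 := dc_d_zero_b (M := M) hn' (r := r - 1) (r' := r) (s := s - 1) (s' := s) (by ring)
      (by ring) (by push_cast; omega) (by push_cast; omega) (by push_cast; omega) h H1 H3 hg u
    have e1 : (r - 1 + s).negOnePow = n.negOnePow := by rw [show r - 1 + s = n by omega]
    have e2 : ((r - 1 + (s - 1)).negOnePow : ℤ) = -(n.negOnePow : ℤ) := by
      rw [show n = r - 1 + (s - 1) + 1 by omega, negOnePow_add_one, neg_neg]
    rw [hu, map_zero, e1] at h2
    rw [e2] at h1
    rw [hc_d_e1 hn (r := r - 1) (r' := r) (s := s) (by ring) (by omega) h hg v,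
      v1 (r - 1) (s - 1) s (by ring) _ _ (by push_cast; omega) H1 (by push_cast; omega) H2, map_zsmul, map_sub, d_f_comm_b]
    -- The head coordinate of u at e(1) is expressed by the B_0-coordinate of d u = 0; d C_1 is
    -- traded for E_0 by `hdC`.
    refine Eq.trans ?_ (eq_smul_of_add h2 hn.symm)
    refine congrArg _ ((congrArg (fun y => _ - (M.X r).b (s - 1) s (by ring) y) h1).trans ?_)
    rw [neg_smul, map_neg, map_zsmul, sub_neg_eq_add]
  · intro r s h hg
    have hg3 := hg.2.2
    dsimp only [Path.len] at hg3
    have H1 : Path.b.len - (s - 1) - 2 * (0 : ℕ) - 1 = q := by dsimp [Path.len]; omega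
    have H2 : Path.c.len - (s - 1 - 1) - 2 * (1 : ℕ) - 1 = q := by dsimp [Path.len]; omega
    have H3 : Path.c.len - s - 2 * (0 : ℕ) - 1 = q := by dsimp [Path.len]; omega
    have H4 : -(s - 1) + Path.e1.len = q := by dsimp [Path.len]; omega
    have h2 := dc_d_zero_c (M := M) hn' (r := r - 1) (r' := r) (s := s - 1) (s' := s) (by ring)
      (by ring) (by push_cast; omega) (by push_cast; omega) (by push_cast; omega) h H3 H1 hg u
    have e1 : (r - 1 + s).negOnePow = n.negOnePow := by rw [show r - 1 + s = n by omega]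
    rw [hu, map_zero, e1] at h2
    rw [hc_d_a hn (r := r - 1) (r' := r) (s := s - 1) (s' := s) (by ring) (by ring) (by omega) h
        (by omega) ⟨rfl, rfl, H4⟩ hg v,
      v2 (r - 1) s _ _ (by push_cast; omega) H3,
      v1 r (s - 1 - 1) (s - 1) (by ring) _ _ (by push_cast; omega) H1 (by push_cast; omega) H2, map_zsmul, map_zsmul, map_sub,
      (M.X r).ba, sub_zero, ← smul_add]
    exact eq_smul_of_add h2 hn.symm
  · intro r s k h hq
    have hq2 := hq
    dsimp only [Path.len] at hq2
    rw [dc_d_e2 hn (r := r - 1) (r' := r) (s := s) (by ring) (by omega) h hq v,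
      vE (r - 1) s k _ _ (by push_cast; omega) (by dsimp [Path.len]; push_cast; omega), map_zsmul,
      hdC (r - 1) r s k (by ring) _ _ h hq, smul_smul_negOnePow]
  · intro r s k h hq
    have hq2 := hq
    dsimp only [Path.len] at hq2
    cases k with
    | zero =>
      push_cast at h hq2
      rw [dc_d_zero_b hn (r := r - 1) (r' := r) (s := s - 1) (s' := s) (by ring) (by ring)
          (by push_cast; omega) h (by push_cast; omega) (by omega) hq
          (by dsimp [Path.len]; push_cast; omega) ⟨rfl, rfl, by dsimp [Path.len]; omega⟩ v,
        vB, map_zero, zero_add,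
        vE r (s - 1) 0 _ _ (by push_cast; omega) (by dsimp [Path.len]; push_cast; omega),
        v1 r (s - 1) s (by ring) _ _ h hq (by push_cast; omega)
          (by dsimp [Path.len]; push_cast; omega), smul_smul_negOnePow, map_zsmul]
      have e : (r + (s - 1)).negOnePow = (r - 1 + s).negOnePow := by
        rw [show r + (s - 1) = r - 1 + s by ring]
      rw [e, smul_smul_negOnePow]
      exact add_sub_cancel _ _
    | succ k =>
      rw [dc_d_b hn (r := r - 1) (r' := r) (s := s - 1) (s' := s) (by ring) (by ring)
          (by push_cast at h ⊢; omega) h (by push_cast at h ⊢; omega) hq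
          (by dsimp [Path.len]; push_cast at hq2 ⊢; omega) v,
        vB, map_zero, zero_add,
        vE r (s - 1) (k + 1) _ _ (by push_cast at h ⊢; omega)
          (by dsimp [Path.len]; push_cast at hq2 ⊢; omega), map_zsmul]
      have e : (r + (s - 1)).negOnePow = (r - 1 + s).negOnePow := by
        rw [show r + (s - 1) = r - 1 + s by ring]
      rw [e, smul_smul_negOnePow]
      exact (dB_eq_of_p_eq_zero hp _).symm
  · intro r s k h hq
    have hq2 := hq
    dsimp only [Path.len] at hq2
    cases k with
    | zero =>
      push_cast at h hq2
      rw [dc_d_zero_c hn (r := r - 1) (r' := r) (s := s - 1) (s' := s) (by ring) (by ring)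
          (by push_cast; omega) h (by push_cast; omega) (by omega) hq
          (by dsimp [Path.len]; push_cast; omega) ⟨rfl, rfl, by dsimp [Path.len]; omega⟩ v,
        vC, vB, map_zero, map_zero, smul_zero, zero_add, zero_add, v2 r s _ _ h hq,
        smul_smul_negOnePow]
    | succ k =>
      rw [dc_d_c hn (r := r - 1) (r' := r) (s := s - 1) (s' := s) (by ring) (by ring)
          (by push_cast at h ⊢; omega) h (by push_cast at h ⊢; omega)
          (by push_cast at h ⊢; omega) hq
          (by dsimp [Path.len]; push_cast at hq2 ⊢; omega)
          (by dsimp [Path.len]; push_cast at hq2 ⊢; omega) v,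
        vC, vB, map_zero, map_zero, smul_zero, zero_add, zero_add, vE r s k _ _ h hq,
        smul_smul_negOnePow]

end CKD

end JW

/-! ### The zigzag of quasi-isomorphisms and the theorem. -/

namespace JW

namespace CKD

/-- The map from `ℂ𝕂(𝔻 M) e(1)` to a strand of `π̃ M`, as a map of complexes. -/
noncomputable def pMap (M : CochainComplex GrB ℤ) (q : ℤ) :
    (evB .one q).obj (ckCpx.obj (koszulCpx.obj M)) ⟶
      reindex (KX.strand (piC.obj M) (q + 1).negOnePow (-q - 3)) q where
  f n := ModuleCat.ofHom (p M n q)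
  comm' n n' (h : n + 1 = n') :=
    ModuleCat.hom_ext (LinearMap.ext fun u =>
      (KX.strand_d (N := piC.obj M) (q + 1).negOnePow (by omega : n + q + 1 = n' + q)
        (p M n q u)).trans (p_D h u).symm)

/-- A surjective map of complexes with acyclic kernel is a quasi-isomorphism: lift y, then correct
the lift inside the kernel. -/
theorem coneExact_pMap {M : CochainComplex GrB ℤ} {b : ℤ}
    (hb : ∀ v i j, i < b → Subsingleton (((koszulCpx.obj M).X i).X v j)) (q : ℤ) :
    ConeExact (pMap M q) := by
  intro i j k l hij hjk hkl x y hx hxy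
  change ((ckCpx.obj (koszulCpx.obj M)).X k).X .one q at x
  change ((ckCpx.obj (koszulCpx.obj M)).d k l).f .one q x = 0 at hx
  change KX (piC.obj M) (j + q) (-q - 3) at y
  have hxy' : p M k q x = KX.D (piC.obj M) (q + 1).negOnePow (j + q) (k + q) (-q - 3) (by omega) y :=
    hxy.trans (KX.strand_d _ _ y)
  obtain ⟨z, rfl⟩ := p_surjective hb y
  have h0 : p M k q (x - ((ckCpx.obj (koszulCpx.obj M)).d j k).f .one q z) = 0 := by
    rw [map_sub, p_D hjk, hxy', sub_self]
  have h1 : ((ckCpx.obj (koszulCpx.obj M)).d k l).f .one q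
      (x - ((ckCpx.obj (koszulCpx.obj M)).d j k).f .one q z) = 0 := by
    rw [map_sub, hx, Koszul.d_f_d_f, sub_self]
  obtain ⟨v, hv, hv'⟩ := acyc_ker_p hb hjk hkl h0 h1
  refine ⟨z + v, 0, ?_, ?_⟩
  · change ((ckCpx.obj (koszulCpx.obj M)).d j k).f .one q (z + v) = x
    rw [map_add, hv, add_sub_cancel]
  · refine (map_add (p M j q) z v).trans (congrArg (p M j q z + ·) (hv'.trans (map_zero _).symm))

end CKD

/-- Only π̃ of f has to be a quasi-isomorphism. The part e(1) is computed by strands of π̃ M,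
compatibly with f, and the part e(2) is acyclic. This is how ℂ𝕂 forgets, on the Koszul dual side,
what π̃ kills. -/
theorem qisB_ckCpx_map_koszulCpx_map {M M' : CochainComplex GrB ℤ} {f : M ⟶ M'}
    (hf : qisC (piC.map f)) (hM : BLt M) (hM' : BLt M') :
    qisB (ckCpx.map (koszulCpx.map f)) := by
  obtain ⟨N, hN⟩ := (koszulLt.obj ⟨M, hM⟩).property
  obtain ⟨N', hN'⟩ := (koszulLt.obj ⟨M', hM'⟩).property
  have hb : ∀ v i j, i < -N → Subsingleton (((koszulCpx.obj M).X i).X v j) :=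
    fun v i j h => hN v i j (.inl h)
  have hb' : ∀ v i j, i < -N' → Subsingleton (((koszulCpx.obj M').X i).X v j) :=
    fun v i j h => hN' v i j (.inl h)
  intro w q
  cases w
  · have h1 := (quasiIso_iff_coneExact _).2 (CKD.coneExact_pMap hb q)
    have h2 := (quasiIso_iff_coneExact _).2 (CKD.coneExact_pMap hb' q)
    obtain ⟨-, c, hc⟩ := (piCpx.obj ⟨M, hM⟩).property
    obtain ⟨-, c', hc'⟩ := (piCpx.obj ⟨M', hM'⟩).property
    have h3 := (quasiIso_iff_coneExact _).2 ((KX.coneExact_strandMap hf (b := max c c')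
      (fun i j h => hc i j (.inl ((le_max_left _ _).trans_lt h)))
      (fun i j h => hc' i j (.inl ((le_max_right _ _).trans_lt h)))
      (q + 1).negOnePow (-q - 3)).reindexMap q)
    have h4 : (evB .one q).map (ckCpx.map (koszulCpx.map f)) ≫ CKD.pMap M' q =
        CKD.pMap M q ≫ reindexMap (KX.strandMap (piC.map f) (q + 1).negOnePow (-q - 3)) q :=
      HomologicalComplex.hom_ext _ _ fun n =>
        ModuleCat.hom_ext (LinearMap.ext fun u => CKD.p_map f u)
    have h5 : QuasiIso ((evB .one q).map (ckCpx.map (koszulCpx.map f)) ≫ CKD.pMap M' q) := by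
      rw [h4]; infer_instance
    exact quasiIso_of_comp_right _ (CKD.pMap M' q)
  · exact (quasiIso_iff_coneExact _).2
      (ConeExact.of_acyc _ (CK.acyc_two hb q) (CK.acyc_two hb' q))

/-- The map `ℂ𝕂 X ⟶ X`. -/
noncomputable def ckEtaGt : ckGt ⟶ 𝟭 BGt.FullSubcategory where
  app X := ObjectProperty.homMk (ckEta.app X.obj)
  naturality _ _ f := ObjectProperty.hom_ext _ (ckEta.naturality f.hom)

/-- The map `K(π̃ M) ⟶ M`. -/
noncomputable def epsLt : piCpx ⋙ resLt ⟶ 𝟭 BLt.FullSubcategory where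
  app M := ObjectProperty.homMk (eps.app M.obj)
  naturality _ _ f := ObjectProperty.hom_ext _ (eps.naturality f.hom)

/-- The map `ℂ𝕂(𝔻(K(π̃ M))) ⟶ 𝔻(K(π̃ M))`. -/
noncomputable def ckEtaLt : (piCpx ⋙ resLt ⋙ koszulLt) ⋙ ckGt ⟶ piCpx ⋙ resLt ⋙ koszulLt :=
  Functor.whiskerLeft (piCpx ⋙ resLt ⋙ koszulLt) ckEtaGt

/-- The map `ℂ𝕂(𝔻(K(π̃ M))) ⟶ ℂ𝕂(𝔻 M)`. -/
noncomputable def ckEpsLt : (piCpx ⋙ resLt ⋙ koszulLt) ⋙ ckGt ⟶ koszulLt ⋙ ckGt :=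
  Functor.whiskerRight epsLt (koszulLt ⋙ ckGt)

theorem qisBGt_ckEtaGt {X : BGt.FullSubcategory} (hX : ∀ q, Acyc ((evB .two q).obj X.obj)) :
    qisBGt (ckEtaGt.app X) := by
  obtain ⟨N, hN⟩ := X.property
  exact qisB_ckEta (fun v i j h => hN v i j (.inl h)) hX

theorem qisBGt_map_koszulLt_ckGt {M M' : BLt.FullSubcategory} {f : M ⟶ M'}
    (hf : qisC (piC.map f.hom)) : qisBGt ((koszulLt ⋙ ckGt).map f) :=
  qisB_ckCpx_map_koszulCpx_map hf M.property M'.property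

theorem qisC_map_epsLt (M : BLt.FullSubcategory) : qisC (piC.map (epsLt.app M).hom) := by
  have h : qisC (Res.rho (piC.obj M.obj)) := (qisC_iff _).2 (Res.coneExact_rho _)
  rw [← piC_map_eps] at h
  exact h

theorem qisBGt_ckEtaLt (M : BLt.FullSubcategory) : qisBGt (ckEtaLt.app M) :=
  qisBGt_ckEtaGt (X := (piCpx ⋙ resLt ⋙ koszulLt).obj M)
    (acyc_koszulCpx_resCpx_two (piC.obj M.obj))

theorem qisBGt_ckEpsLt (M : BLt.FullSubcategory) : qisBGt (ckEpsLt.app M) :=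
  qisBGt_map_koszulLt_ckGt (f := epsLt.app M) (qisC_map_epsLt M)

theorem isIso_whiskerRight_Q {C : Type*} [Category C] {F G : C ⥤ BGt.FullSubcategory} (τ : F ⟶ G)
    (h : ∀ X, qisBGt (τ.app X)) : IsIso (Functor.whiskerRight τ qisBGt.Q) := by
  have (X : C) : IsIso ((Functor.whiskerRight τ qisBGt.Q).app X) :=
    Localization.inverts qisBGt.Q qisBGt _ (h X)
  exact NatIso.isIso_of_isIso_app _

/-- The isomorphism before passing to the localization of the source. -/
noncomputable def koszulProjectorIso :
    (piCpx ⋙ resLt ⋙ koszulLt) ⋙ qisBGt.Q ≅ (koszulLt ⋙ ckGt) ⋙ qisBGt.Q :=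
  have := isIso_whiskerRight_Q ckEtaLt qisBGt_ckEtaLt
  have := isIso_whiskerRight_Q ckEpsLt qisBGt_ckEpsLt
  -- The zigzag is 𝔻(K(π̃ M)) ⟵ ℂ𝕂(𝔻(K(π̃ M))) ⟶ ℂ𝕂(𝔻 M), so the first arrow has to be inverted.
  (asIso (Functor.whiskerRight ckEtaLt qisBGt.Q)).symm ≪≫
    asIso (Functor.whiskerRight ckEpsLt qisBGt.Q)

/-- `𝔻 ∘ K ∘ π̃` on derived categories is induced by the functors on complexes. -/
noncomputable def projectorKoszulFac (hD : qisBLt.IsInvertedBy (koszulLt ⋙ qisBGt.Q)) :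
    qisBLt.Q ⋙ (piD ⋙ resD) ⋙ koszulD hD ≅ (piCpx ⋙ resLt ⋙ koszulLt) ⋙ qisBGt.Q :=
  Functor.isoWhiskerRight (Localization.fac (piCpx ⋙ qisCLt.Q) piCpx_inverts qisBLt.Q)
      (resD ⋙ koszulD hD) ≪≫
    Functor.isoWhiskerLeft piCpx (Functor.isoWhiskerRight
      (Localization.fac (resLt ⋙ qisBLt.Q) resLt_inverts qisCLt.Q) (koszulD hD)) ≪≫
    Functor.isoWhiskerLeft (piCpx ⋙ resLt) (Localization.fac (koszulLt ⋙ qisBGt.Q) hD qisBLt.Q)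

/-- `ℂ𝕂 ∘ 𝔻` on derived categories is induced by the functors on complexes. -/
noncomputable def koszulCkFac (hD : qisBLt.IsInvertedBy (koszulLt ⋙ qisBGt.Q))
    (hCK : qisBGt.IsInvertedBy (ckGt ⋙ qisBGt.Q)) :
    qisBLt.Q ⋙ koszulD hD ⋙ ckD hCK ≅ (koszulLt ⋙ ckGt) ⋙ qisBGt.Q :=
  Functor.isoWhiskerRight (Localization.fac (koszulLt ⋙ qisBGt.Q) hD qisBLt.Q) (ckD hCK) ≪≫
    Functor.isoWhiskerLeft koszulLt (Localization.fac (ckGt ⋙ qisBGt.Q) hCK qisBGt.Q)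

/-- The isomorphism `𝔻 ∘ K ∘ π̃ ≅ ℂ𝕂 ∘ 𝔻` of functors on derived categories. -/
noncomputable def koszulProjectorDIso (hD : qisBLt.IsInvertedBy (koszulLt ⋙ qisBGt.Q))
    (hCK : qisBGt.IsInvertedBy (ckGt ⋙ qisBGt.Q)) :
    (piD ⋙ resD) ⋙ koszulD hD ≅ koszulD hD ⋙ ckD hCK :=
  Localization.liftNatIso qisBLt.Q qisBLt (qisBLt.Q ⋙ (piD ⋙ resD) ⋙ koszulD hD)
    (qisBLt.Q ⋙ koszulD hD ⋙ ckD hCK) _ _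
    (projectorKoszulFac hD ≪≫ koszulProjectorIso ≪≫ (koszulCkFac hD hCK).symm)

end JW

theorem mainTheorem1 :
    ∃ (hι : (JW.iotaCpx ⋙ JW.qisBLt.Q).HasLeftDerivedFunctor JW.qisCLt)
      (hD : JW.qisBLt.IsInvertedBy (JW.koszulLt ⋙ JW.qisBGt.Q))
      (hCK : JW.qisBGt.IsInvertedBy (JW.ckGt ⋙ JW.qisBGt.Q)),
      Nonempty (JW.projectorD hι ⋙ JW.koszulD hD ≅ JW.koszulD hD ⋙ JW.ckD hCK) :=
  ⟨JW.hasLeftDerivedFunctor_iotaCpx, JW.koszulLt_inverts, JW.ckGt_inverts,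
    -- By uniqueness of derived functors, ℒι̃ may be replaced by the functor induced by the explicit
    -- resolution.
    ⟨Functor.isoWhiskerRight (Functor.isoWhiskerLeft JW.piD
      (JW.LiotaDIso JW.hasLeftDerivedFunctor_iotaCpx)) (JW.koszulD _) ≪≫
      JW.koszulProjectorDIso _ _⟩⟩
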